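/- Let $m\ge 1$ and $d\ge 2$ be integers and $n=dm$. Put $W=\mathbb C^m$ with a basis $e_1,\dots,e_m$, and $V=\mathbb C^n=W^{(1)}\oplus\dots\oplus W^{(d)}$, where each $W^{(k)}$ is a copy of $W$ via $\chi_k:W\to W^{(k)}$; for $M\subset W$ write $M^{(k)}=\chi_k(M)$, and put $e_{(k-1)m+r}=\chi_k(e_r)$, a basis of $V$. Embed $\mathrm{GL}(m)$ in $\mathrm{GL}(n)$ by $x\mapsto\mathrm{diag}(x,\dots,x)$. Let $\alpha:\{1,\dots,n\}\to\{1,\dots,p\}$ be surjective and let $P\subset\mathrm{GL}(n)$ be the stabilizer of the flag $\mathcal F_\alpha=\{\langle e_i:\alpha(i)\le j\rangle\}_{j=1}^{p-1}$; these are the parabolic subgroups that contain the torus $H$ of operators diagonal in the basis $(e_i)$. Assume that $Q=P\cap \mathrm{GL}(m)$ is a parabolic subgroup of $\mathrm{GL}(m)$. Let $\beta(r)=(\alpha(r),\alpha(m+r),\dots,\alpha((d-1)m+r))$ for $1\le r\le m$. Then the image of $\beta$ is totally ordered by the componentwise order of $\{1,\dots,p\}^d$. Let $b_1<\dots<b_q$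 be its elements, put $\mathcal F_\beta=\{\langle e_r:\beta(r)\le b_j\rangle\}_{j=1}^{q-1}$ and $d_j=\#\{r:\beta(r)\le b_j\}$. Then $gQ\mapsto g\mathcal F_\beta$ identifies $Y=\mathrm{GL}(m)/Q$ with the variety $\mathrm{Fl}(d_1,\dots,d_{q-1};W)$ of partial flags, $gP\mapsto g\mathcal F_\alpha$ identifies $X=\mathrm{GL}(n)/P$ with a variety of partial flags in $V$, and the map $\phi:Y\to X$, $gQ\mapsto gP$, is a morphism of varieties. Let $\mathcal G(\alpha,\beta)$ be the graph with left vertices $l_1,\dots,l_q$, right vertices $r_1,\dots,r_p$, and an edge of colour $k\in\{1,\dots,d\}$ between $l_i$ and $r_j$ whenever $(b_i)_k=j$ and $i$ is maximal for this property. Edges through $l_q$ are called bounding, all other edges ordinary. For flags, put $F_0=V_0=0$, $F_q=W$. (a) $\phi(\{F_1,\dots,F_{q-1}\})=\{V_1,\dots,V_{p-1}\}$, where for $1\le j\le p-1$ $$V_j=V_{j-1}+F_{i_1}^{(1)}\oplus\dots\oplus F_{i_d}^{(d)},\qquad V_j=F_{i'_1}^{(1)}\oplus\dots\oplus F_{i'_d}^{(d)}.$$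 Here $i_k$ is the index $i$ such that $l_i$ and $r_j$ are joined by an edge of colour $k$ ($i_k=0$ if no edge of colour $k$ passes through $r_j$), and $i'_k$ is the index of the left end point of the last edge of colour $k$ arriving at or above $r_j$, i.e. at some $r_{j'}$ with $j'\le j$ maximal ($i'_k=0$ if there is none). (b) Let $[L_j]\in\mathrm{Pic}\,X$ ($1\le j\le p-1$) and $[M_i]\in\mathrm{Pic}\,Y$ ($1\le i\le q-1$) be the preferred generators, i.e. the pull-backs of the bundles $\mathcal O(1)$ along the projections to the Grassmannians (with their Plücker embeddings). Then $\phi^*[L_j]=\sum_{k=1}^d[M_{i'_k}]$ for all $j$, where $[M_0]=[M_q]=0$ and $i'_k=i'_k(j)$ is as in (a). (c) Call $\phi$ linear if each $\phi^*[L_j]$ is $0$ or one of the $[M_i]$. Then $\phi$ is linear if and only if, whenever $r_j,r_{j'}$ with $j<j'$ are incident with edges of the same colour $c$, every ordinary edge arriving at $r_{j''}$ with $j\le j''<j'$ is also of colour $c$. (d) Call a map $\varphi:\mathrm{Fl}(p_1,\dots,p_k;A)\to\mathrm{Fl}(q_1,\dots,q_\ell;B)$ a strict standard extension if there are a decomposition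 $B=A'\oplus Z$, a linear isomorphism $\varepsilon:A\to A'$, subspaces $Z_1\subset\dots\subset Z_\ell$ of $Z$ (repetitions allowed) and a nondecreasing map $\kappa:\{1,\dots,\ell\}\to\{0,\dots,k+1\}$ such that $\varphi(\{A_1,\dots,A_k\})=\{\varepsilon(A_{\kappa(j)})+Z_j\}_{j=1}^{\ell}$ for all flags, with $A_0=0$, $A_{k+1}=A$; call $\varphi$ a standard extension if $\varphi$, or its composition with the duality map sending a flag in $B$ to the flag of annihilators in $B^*$, is a strict standard extension. Then $\phi$ is a standard extension if and only if all ordinary edges of $\mathcal G(\alpha,\beta)$ are of the same colour. Moreover, in this case $\phi$ is a strict standard extension. -/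

import Mathlib

open Module Filter Topology

set_option linter.unusedVariables false

noncomputable section

universe u v

/-! ## Complex algebraic varieties as spaces with functions, and their Picard groups -/

/-- A (classical) complex variety viewed as a space with functions: a topological space (the
Zariski topology) together with, at every point `x`, the algebra of those functions that are
regular in a neighbourhood of `x`.  The regular functions on an open set `U` are the functions
that are regular at every point of `U`. -/
class SpaceWithFunctions (X : Type u) extends TopologicalSpace X where
  regularAt : X → Subalgebra ℂ (X → ℂ)
  /-- Regularity at `x` depends only on the germ at `x`. -/
  congr_germ : ∀ {x : X} {f g : X → ℂ}, f ∈ regularAt x → (∀ᶠ y in 𝓝 x, f y = g y) →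
    g ∈ regularAt x
  /-- Regularity is an open condition. -/
  eventually_mem : ∀ {x : X} {f : X → ℂ}, f ∈ regularAt x → ∀ᶠ y in 𝓝 x, f ∈ regularAt y
  /-- The non-vanishing locus of a regular function is open. -/
  eventually_ne : ∀ {x : X} {f : X → ℂ}, f ∈ regularAt x → f x ≠ 0 → ∀ᶠ y in 𝓝 x, f y ≠ 0
  /-- The reciprocal of a regular function is regular where the function does not vanish. -/
  inv_mem : ∀ {x : X} {f : X → ℂ}, f ∈ regularAt x → f x ≠ 0 → (fun y => (f y)⁻¹) ∈ regularAt x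

open SpaceWithFunctions

/-- Morphisms of varieties: continuous maps that pull regular functions back to regular
functions. -/
structure RegularMap (X : Type u) (Y : Type v) [SpaceWithFunctions X] [SpaceWithFunctions Y] where
  toFun : X → Y
  continuous_toFun : Continuous toFun
  regular_comp : ∀ (x : X) (f : Y → ℂ), f ∈ regularAt (toFun x) → f ∘ toFun ∈ regularAt x

/-- A line bundle on `X`, given by transition functions: a trivialising open neighbourhood `nhd x`
of each point `x`, and nowhere vanishing regular functions `g x y` on `nhd x ∩ nhd y` satisfying
the cocycle condition.  (The values of `g x y` outside `nhd x ∩ nhd y` are irrelevant; a local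
section has coordinates `f x` on `nhd x` with `f x = g x y * f y`.) -/
structure LineBundle (X : Type u) [SpaceWithFunctions X] where
  nhd : X → Set X
  isOpen_nhd : ∀ x, IsOpen (nhd x)
  mem_nhd : ∀ x, x ∈ nhd x
  g : X → X → X → ℂ
  regular : ∀ x y, ∀ z ∈ nhd x ∩ nhd y, g x y ∈ regularAt z
  ne_zero : ∀ x y, ∀ z ∈ nhd x ∩ nhd y, g x y z ≠ 0
  cocycle : ∀ x y w, ∀ z ∈ nhd x ∩ nhd y ∩ nhd w, g x y z * g y w z = g x w z

namespace LineBundle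

variable {X : Type u} {Y : Type v} [SpaceWithFunctions X] [SpaceWithFunctions Y]

/-- Isomorphism of line bundles: after shrinking the trivialising neighbourhoods, the cocycles
differ by a coboundary. -/
def Iso (L M : LineBundle X) : Prop :=
  ∃ (V : X → Set X) (h : X → X → ℂ),
    (∀ x, IsOpen (V x)) ∧ (∀ x, x ∈ V x) ∧ (∀ x, V x ⊆ L.nhd x ∩ M.nhd x) ∧
    (∀ x, ∀ z ∈ V x, h x ∈ regularAt z ∧ h x z ≠ 0) ∧
    (∀ x y, ∀ z ∈ V x ∩ V y, M.g x y z * h y z = h x z * L.g x y z)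

/-- Isomorphism from equality of the cocycles on the common domains. -/
theorem Iso.of_eq {L M : LineBundle X}
    (h : ∀ x y, ∀ z ∈ (L.nhd x ∩ M.nhd x) ∩ (L.nhd y ∩ M.nhd y), M.g x y z = L.g x y z) :
    Iso L M :=
  ⟨fun x => L.nhd x ∩ M.nhd x, fun _ _ => 1,
    fun x => (L.isOpen_nhd x).inter (M.isOpen_nhd x), fun x => ⟨L.mem_nhd x, M.mem_nhd x⟩,
    fun _ => le_rfl, fun _ z _ => ⟨one_mem (regularAt z), one_ne_zero⟩,
    fun x y z hz => by rw [h x y z hz]; ring⟩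

theorem Iso.refl (L : LineBundle X) : Iso L L := Iso.of_eq fun _ _ _ _ => rfl

theorem Iso.symm {L M : LineBundle X} : Iso L M → Iso M L := by
  rintro ⟨V, h, ho, hm, hs, hr, hc⟩
  refine ⟨V, fun x z => (h x z)⁻¹, ho, hm, fun x z hz => (hs x hz).symm,
    fun x z hz => ⟨inv_mem (hr x z hz).1 (hr x z hz).2, inv_ne_zero (hr x z hz).2⟩, ?_⟩
  intro x y z hz
  have h1 := (hr x z hz.1).2
  have h2 := (hr y z hz.2).2
  have := hc x y z hz
  field_simp
  rw [mul_comm, ← this]; ring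

theorem Iso.trans {L M N : LineBundle X} : Iso L M → Iso M N → Iso L N := by
  rintro ⟨V, h, ho, hm, hs, hr, hc⟩ ⟨V', h', ho', hm', hs', hr', hc'⟩
  refine ⟨fun x => V x ∩ V' x, fun x z => h' x z * h x z, fun x => (ho x).inter (ho' x),
    fun x => ⟨hm x, hm' x⟩, fun x z hz => ⟨(hs x hz.1).1, (hs' x hz.2).2⟩,
    fun x z hz => ⟨mul_mem (hr' x z hz.2).1 (hr x z hz.1).1,
      mul_ne_zero (hr' x z hz.2).2 (hr x z hz.1).2⟩, ?_⟩
  intro x y z hz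
  have h1 := hc x y z ⟨hz.1.1, hz.2.1⟩
  have h2 := hc' x y z ⟨hz.1.2, hz.2.2⟩
  linear_combination h y z * h2 + h' x z * h1

instance setoid (X : Type u) [SpaceWithFunctions X] : Setoid (LineBundle X) :=
  ⟨Iso, Iso.refl, Iso.symm, Iso.trans⟩

/-- The trivial line bundle. -/
def trivial (X : Type u) [SpaceWithFunctions X] : LineBundle X where
  nhd _ := Set.univ
  isOpen_nhd _ := isOpen_univ
  mem_nhd _ := Set.mem_univ _
  g _ _ _ := 1
  regular _ _ z _ := one_mem (regularAt z)
  ne_zero _ _ _ _ := one_ne_zero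
  cocycle _ _ _ _ _ := one_mul _

/-- The tensor product of line bundles. -/
def tensor (L M : LineBundle X) : LineBundle X where
  nhd x := L.nhd x ∩ M.nhd x
  isOpen_nhd x := (L.isOpen_nhd x).inter (M.isOpen_nhd x)
  mem_nhd x := ⟨L.mem_nhd x, M.mem_nhd x⟩
  g x y z := L.g x y z * M.g x y z
  regular x y z hz := mul_mem (L.regular x y z ⟨hz.1.1, hz.2.1⟩) (M.regular x y z ⟨hz.1.2, hz.2.2⟩)
  ne_zero x y z hz := mul_ne_zero (L.ne_zero x y z ⟨hz.1.1, hz.2.1⟩)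
    (M.ne_zero x y z ⟨hz.1.2, hz.2.2⟩)
  cocycle x y w z hz := by
    rw [← L.cocycle x y w z ⟨⟨hz.1.1.1, hz.1.2.1⟩, hz.2.1⟩,
      ← M.cocycle x y w z ⟨⟨hz.1.1.2, hz.1.2.2⟩, hz.2.2⟩]
    ring

/-- The dual line bundle. -/
def dual (L : LineBundle X) : LineBundle X where
  nhd := L.nhd
  isOpen_nhd := L.isOpen_nhd
  mem_nhd := L.mem_nhd
  g x y z := (L.g x y z)⁻¹
  regular x y z hz := inv_mem (L.regular x y z hz) (L.ne_zero x y z hz)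
  ne_zero x y z hz := inv_ne_zero (L.ne_zero x y z hz)
  cocycle x y w z hz := by rw [← L.cocycle x y w z hz, mul_inv]

/-- The pull-back of a line bundle along a morphism. -/
def pullback (φ : RegularMap X Y) (L : LineBundle Y) : LineBundle X where
  nhd x := φ.toFun ⁻¹' L.nhd (φ.toFun x)
  isOpen_nhd x := (L.isOpen_nhd _).preimage φ.continuous_toFun
  mem_nhd x := L.mem_nhd _
  g x y z := L.g (φ.toFun x) (φ.toFun y) (φ.toFun z)
  regular x y z hz := φ.regular_comp z _ (L.regular _ _ _ hz)
  ne_zero x y z hz := L.ne_zero _ _ _ hz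
  cocycle x y w z hz := L.cocycle _ _ _ _ hz

theorem Iso.tensor {L L' M M' : LineBundle X} :
    Iso L L' → Iso M M' → Iso (L.tensor M) (L'.tensor M') := by
  rintro ⟨V, h, ho, hm, hs, hr, hc⟩ ⟨V', h', ho', hm', hs', hr', hc'⟩
  refine ⟨fun x => V x ∩ V' x, fun x z => h x z * h' x z, fun x => (ho x).inter (ho' x),
    fun x => ⟨hm x, hm' x⟩,
    fun x z hz => ⟨⟨(hs x hz.1).1, (hs' x hz.2).1⟩, ⟨(hs x hz.1).2, (hs' x hz.2).2⟩⟩,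
    fun x z hz => ⟨mul_mem (hr x z hz.1).1 (hr' x z hz.2).1,
      mul_ne_zero (hr x z hz.1).2 (hr' x z hz.2).2⟩, ?_⟩
  intro x y z hz
  have h1 := hc x y z ⟨hz.1.1, hz.2.1⟩
  have h2 := hc' x y z ⟨hz.1.2, hz.2.2⟩
  change L'.g x y z * M'.g x y z * (h y z * h' y z) = h x z * h' x z * (L.g x y z * M.g x y z)
  linear_combination (M'.g x y z * h' y z) * h1 + (h x z * L.g x y z) * h2

theorem Iso.dual {L M : LineBundle X} : Iso L M → Iso L.dual M.dual := by
  rintro ⟨V, h, ho, hm, hs, hr, hc⟩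
  refine ⟨V, fun x z => (h x z)⁻¹, ho, hm, hs,
    fun x z hz => ⟨inv_mem (hr x z hz).1 (hr x z hz).2, inv_ne_zero (hr x z hz).2⟩, ?_⟩
  intro x y z hz
  change (M.g x y z)⁻¹ * (h y z)⁻¹ = (h x z)⁻¹ * (L.g x y z)⁻¹
  rw [← mul_inv, hc x y z hz, mul_inv]

theorem Iso.pullback (φ : RegularMap X Y) {L M : LineBundle Y} :
    Iso L M → Iso (L.pullback φ) (M.pullback φ) := by
  rintro ⟨V, h, ho, hm, hs, hr, hc⟩
  exact ⟨fun x => φ.toFun ⁻¹' V (φ.toFun x), fun x z => h (φ.toFun x) (φ.toFun z),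
    fun x => (ho _).preimage φ.continuous_toFun, fun x => hm _, fun x z hz => hs _ hz,
    fun x z hz => ⟨φ.regular_comp z _ (hr _ _ hz).1, (hr _ _ hz).2⟩,
    fun x y z hz => hc _ _ _ hz⟩

end LineBundle

/-- The Picard group: isomorphism classes of line bundles, written additively. -/
def Pic (X : Type u) [SpaceWithFunctions X] : Type u := Quotient (LineBundle.setoid X)

namespace Pic

variable {X : Type u} {Y : Type v} [SpaceWithFunctions X] [SpaceWithFunctions Y]

/-- The class of a line bundle. -/
def mk (L : LineBundle X) : Pic X := Quotient.mk _ L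

theorem mk_eq_of_iso {L M : LineBundle X} (h : LineBundle.Iso L M) : mk L = mk M := Quotient.sound h

instance : Zero (Pic X) := ⟨mk (LineBundle.trivial X)⟩

instance : Add (Pic X) :=
  ⟨Quotient.map₂ LineBundle.tensor fun _ _ h _ _ h' => LineBundle.Iso.tensor h h'⟩

instance : Neg (Pic X) := ⟨Quotient.map LineBundle.dual fun _ _ h => LineBundle.Iso.dual h⟩

instance : AddCommGroup (Pic X) where
  add_assoc := by
    rintro ⟨L⟩ ⟨M⟩ ⟨N⟩
    exact mk_eq_of_iso (LineBundle.Iso.of_eq fun _ _ _ _ => (mul_assoc _ _ _).symm)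
  zero_add := by
    rintro ⟨L⟩
    exact mk_eq_of_iso (LineBundle.Iso.of_eq fun _ _ _ _ => (one_mul _).symm)
  add_zero := by
    rintro ⟨L⟩
    exact mk_eq_of_iso (LineBundle.Iso.of_eq fun _ _ _ _ => (mul_one _).symm)
  add_comm := by
    rintro ⟨L⟩ ⟨M⟩
    exact mk_eq_of_iso (LineBundle.Iso.of_eq fun _ _ _ _ => mul_comm _ _)
  neg_add_cancel := by
    rintro ⟨L⟩
    exact mk_eq_of_iso (LineBundle.Iso.of_eq fun x y z hz =>
      (inv_mul_cancel₀ (L.ne_zero x y z ⟨hz.1.1.1, hz.2.1.1⟩)).symm)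
  nsmul := nsmulRec
  zsmul := zsmulRec

/-- The homomorphism `φ^* : Pic Y → Pic X` induced by a morphism `φ : X → Y`. -/
def pullback (φ : RegularMap X Y) : Pic Y →+ Pic X where
  toFun := Quotient.map (LineBundle.pullback φ) fun _ _ h => LineBundle.Iso.pullback φ h
  map_zero' := mk_eq_of_iso (LineBundle.Iso.of_eq fun _ _ _ _ => rfl)
  map_add' := by
    rintro ⟨L⟩ ⟨M⟩
    exact mk_eq_of_iso (LineBundle.Iso.of_eq fun _ _ _ _ => rfl)

end Pic

/-! ## Subvarieties of products of projective spaces -/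

section Multiprojective

variable {I : Type} [Fintype I] {E : I → Type v} [∀ i, AddCommGroup (E i)] [∀ i, Module ℂ (E i)]

/-- Multihomogeneous polynomial functions of multidegree `a` on `∏ i, E i`.  The algebra of
polynomial functions is the algebra generated by the linear functionals. -/
def IsForm (a : I → ℕ) (A : (Π i, E i) → ℂ) : Prop :=
  A ∈ Algebra.adjoin ℂ {f : (Π i, E i) → ℂ | ∃ ξ : Dual ℂ (Π i, E i), f = ξ} ∧
    ∀ (c : I → ℂ) (x : Π i, E i), A (fun i => c i • x i) = (∏ i, c i ^ a i) * A x

theorem IsForm.mul {a b : I → ℕ} {A B : (Π i, E i) → ℂ} (hA : IsForm a A) (hB : IsForm b B) :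
    IsForm (a + b) (A * B) := by
  refine ⟨mul_mem hA.1 hB.1, fun c x => ?_⟩
  simp only [Pi.mul_apply, hA.2 c x, hB.2 c x, Pi.add_apply, pow_add, Finset.prod_mul_distrib]
  ring

theorem IsForm.add {a : I → ℕ} {A B : (Π i, E i) → ℂ} (hA : IsForm a A) (hB : IsForm a B) :
    IsForm a (A + B) := by
  refine ⟨add_mem hA.1 hB.1, fun c x => ?_⟩
  simp only [Pi.add_apply, hA.2 c x, hB.2 c x]
  ring

theorem IsForm.const (c : ℂ) : IsForm (0 : I → ℕ) (fun _ : (Π i, E i) => c) :=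
  ⟨Subalgebra.algebraMap_mem _ c, fun _ _ => by simp⟩

variable {X : Type u} (ι : X → Π i, Projectivization ℂ (E i))

/-- The value of a form at (a representative of) the image of `x` in `∏ i, ℙ (E i)`.  Whether it
vanishes, and quotients of two such values for forms of equal multidegree, do not depend on the
representatives. -/
def formValue (A : (Π i, E i) → ℂ) (x : X) : ℂ := A fun i => (ι x i).rep

/-- The locally closed structure induced on `X` by a map `ι` (meant to be injective) to a product
of projective spaces: the Zariski topology has as basis the non-vanishing loci of multihomogeneous
forms, and a function is regular at `x` if near `x` it is a quotient of two multihomogeneous forms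
of the same multidegree. -/
@[reducible]
def SpaceWithFunctions.ofMultiprojective : SpaceWithFunctions X where
  toTopologicalSpace := TopologicalSpace.generateFrom
    {U | ∃ (a : I → ℕ) (B : (Π i, E i) → ℂ), IsForm a B ∧ U = {x | formValue ι B x ≠ 0}}
  regularAt x :=
    { carrier := {f | ∃ (a : I → ℕ) (A B : (Π i, E i) → ℂ), IsForm a A ∧ IsForm a B ∧
        formValue ι B x ≠ 0 ∧
        ∀ y, formValue ι B y ≠ 0 → f y = formValue ι A y / formValue ι B y}
      mul_mem' := by
        rintro f f' ⟨a, A, B, hA, hB, hx, hf⟩ ⟨a', A', B', hA', hB', hx', hf'⟩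
        refine ⟨a + a', A * A', B * B', hA.mul hA', hB.mul hB', mul_ne_zero hx hx', ?_⟩
        intro y hy
        have hy1 : formValue ι B y ≠ 0 := left_ne_zero_of_mul hy
        have hy2 : formValue ι B' y ≠ 0 := right_ne_zero_of_mul hy
        rw [Pi.mul_apply, hf y hy1, hf' y hy2]
        exact div_mul_div_comm _ _ _ _
      add_mem' := by
        rintro f f' ⟨a, A, B, hA, hB, hx, hf⟩ ⟨a', A', B', hA', hB', hx', hf'⟩
        refine ⟨a + a', A * B' + B * A', B * B', (hA.mul hB').add (hB.mul hA'), hB.mul hB',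
          mul_ne_zero hx hx', ?_⟩
        intro y hy
        have hy1 : formValue ι B y ≠ 0 := left_ne_zero_of_mul hy
        have hy2 : formValue ι B' y ≠ 0 := right_ne_zero_of_mul hy
        rw [Pi.add_apply, hf y hy1, hf' y hy2]
        exact div_add_div _ _ hy1 hy2
      algebraMap_mem' := by
        intro c
        refine ⟨0, fun _ => c, fun _ => 1, IsForm.const c, IsForm.const 1, one_ne_zero, ?_⟩
        intro y _
        simp [formValue] }
  congr_germ := by
    rintro x f g ⟨a, A, B, hA, hB, hx, hf⟩ hfg
    let _ : TopologicalSpace X := TopologicalSpace.generateFrom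
      {U | ∃ (a : I → ℕ) (B : (Π i, E i) → ℂ), IsForm a B ∧ U = {x | formValue ι B x ≠ 0}}
    have hbasis : TopologicalSpace.IsTopologicalBasis
        {U : Set X | ∃ (a : I → ℕ) (B : (Π i, E i) → ℂ),
          IsForm a B ∧ U = {x | formValue ι B x ≠ 0}} := by
      refine ⟨?_, ?_, rfl⟩
      · rintro _ ⟨a, B, hB, rfl⟩ _ ⟨a', B', hB', rfl⟩ y hy
        refine ⟨_, ⟨a + a', B * B', hB.mul hB', rfl⟩, mul_ne_zero hy.1 hy.2, fun z hz => ?_⟩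
        exact ⟨left_ne_zero_of_mul hz, right_ne_zero_of_mul hz⟩
      · refine Set.eq_univ_of_forall fun y => ?_
        exact ⟨_, ⟨0, fun _ => 1, IsForm.const 1, rfl⟩, one_ne_zero⟩
    obtain ⟨_, ⟨a', C, hC, rfl⟩, hxC, hsub⟩ := hbasis.mem_nhds_iff.1 hfg
    refine ⟨a + a', A * C, B * C, hA.mul hC, hB.mul hC, mul_ne_zero hx hxC, fun y hy => ?_⟩
    have hy1 : formValue ι B y ≠ 0 := left_ne_zero_of_mul hy
    have hy2 : formValue ι C y ≠ 0 := right_ne_zero_of_mul hy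
    have h1 : f y = g y := hsub hy2
    rw [← h1, hf y hy1]
    exact (mul_div_mul_right _ _ hy2).symm
  eventually_mem := by
    rintro x f ⟨a, A, B, hA, hB, hx, hf⟩
    let _ : TopologicalSpace X := TopologicalSpace.generateFrom
      {U | ∃ (a : I → ℕ) (B : (Π i, E i) → ℂ), IsForm a B ∧ U = {x | formValue ι B x ≠ 0}}
    have ho : IsOpen {y | formValue ι B y ≠ 0} :=
      TopologicalSpace.isOpen_generateFrom_of_mem ⟨a, B, hB, rfl⟩
    filter_upwards [ho.mem_nhds hx] with y hy
    exact ⟨a, A, B, hA, hB, hy, hf⟩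
  eventually_ne := by
    rintro x f ⟨a, A, B, hA, hB, hx, hf⟩ hfx
    let _ : TopologicalSpace X := TopologicalSpace.generateFrom
      {U | ∃ (a : I → ℕ) (B : (Π i, E i) → ℂ), IsForm a B ∧ U = {x | formValue ι B x ≠ 0}}
    have ho : IsOpen {y | formValue ι (A * B) y ≠ 0} :=
      TopologicalSpace.isOpen_generateFrom_of_mem ⟨a + a, A * B, hA.mul hB, rfl⟩
    rw [hf x hx] at hfx
    have hAx : formValue ι A x ≠ 0 := fun h => hfx (by rw [h, zero_div])
    filter_upwards [ho.mem_nhds (mul_ne_zero hAx hx : formValue ι (A * B) x ≠ 0)] with y hy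
    have hy1 : formValue ι A y ≠ 0 := left_ne_zero_of_mul hy
    have hy2 : formValue ι B y ≠ 0 := right_ne_zero_of_mul hy
    rw [hf y hy2]
    exact div_ne_zero hy1 hy2
  inv_mem := by
    rintro x f ⟨a, A, B, hA, hB, hx, hf⟩ hfx
    rw [hf x hx] at hfx
    have hAx : formValue ι A x ≠ 0 := fun h => hfx (by rw [h, zero_div])
    refine ⟨a + a, B * B, A * B, hB.mul hB, hA.mul hB, mul_ne_zero hAx hx, fun y hy => ?_⟩
    have hy2 : formValue ι B y ≠ 0 := right_ne_zero_of_mul hy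
    change (f y)⁻¹ = _
    rw [hf y hy2, inv_div]
    exact (mul_div_mul_right _ _ hy2).symm

end Multiprojective

/-! ## Projective spaces and `𝒪(1)` -/

/-- The projective space of lines in `E`, with its structure of an algebraic variety. -/
def ProjSpace (E : Type u) [AddCommGroup E] [Module ℂ E] : Type u := Projectivization ℂ E

namespace ProjSpace

variable {E : Type u} [AddCommGroup E] [Module ℂ E]

instance : SpaceWithFunctions (ProjSpace E) :=
  SpaceWithFunctions.ofMultiprojective (I := Unit) (E := fun _ => E) fun x _ => x

/-- A nonzero vector spanning the line `x`. -/
def vec (x : ProjSpace E) : E := Projectivization.rep x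

theorem exists_dual_ne_zero (x : ProjSpace E) : ∃ ξ : Dual ℂ E, ξ x.vec ≠ 0 := by
  by_contra! h
  exact Projectivization.rep_nonzero x ((Module.forall_dual_apply_eq_zero_iff ℂ _).1 h)

/-- A linear form not vanishing at `x`. -/
def chart (x : ProjSpace E) : Dual ℂ E := (exists_dual_ne_zero x).choose

theorem chart_ne_zero (x : ProjSpace E) : x.chart x.vec ≠ 0 := (exists_dual_ne_zero x).choose_spec

theorem isForm_dual (ξ : Dual ℂ E) :
    IsForm (I := Unit) (E := fun _ => E) (fun _ => 1) (fun v => ξ (v ())) :=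
  ⟨Algebra.subset_adjoin ⟨ξ ∘ₗ LinearMap.proj (φ := fun _ : Unit => E) (), rfl⟩,
    fun c x => by simp⟩

/-- The line bundle `𝒪(1)`, whose global sections are the linear forms on `E`: near `x` it is
trivialised by a linear form `ξ_x` not vanishing at `x`, and the transition functions are
`ξ_y / ξ_x`. -/
def twist (E : Type u) [AddCommGroup E] [Module ℂ E] : LineBundle (ProjSpace E) where
  nhd x := {z | x.chart z.vec ≠ 0}
  isOpen_nhd x := TopologicalSpace.isOpen_generateFrom_of_mem ⟨_, _, isForm_dual x.chart, rfl⟩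
  mem_nhd x := x.chart_ne_zero
  g x y z := y.chart z.vec / x.chart z.vec
  regular x y z hz :=
    ⟨_, _, _, isForm_dual y.chart, isForm_dual x.chart, hz.1, fun _ _ => rfl⟩
  ne_zero x y z hz := div_ne_zero hz.2 hz.1
  cocycle x y w z hz := by
    have h1 : x.chart z.vec ≠ 0 := hz.1.1
    have h2 : y.chart z.vec ≠ 0 := hz.1.2
    field_simp

end ProjSpace

/-! ## Flag varieties -/

/-- The variety `Fl(d_1, …, d_k; W)` of flags `F_1 ⊆ … ⊆ F_k` of subspaces of `W` with
`dim F_i = d_i` (indexed by `Fin k`, so that `sub i` is the `(i+1)`-st subspace). -/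
@[ext]
structure FlagVariety (W : Type u) [AddCommGroup W] [Module ℂ W] {k : ℕ} (d : Fin k → ℕ) where
  sub : Fin k → Submodule ℂ W
  finrank_sub : ∀ i, finrank ℂ (sub i) = d i
  mono : Monotone sub

section Plucker

variable {W : Type u} [AddCommGroup W] [Module ℂ W] [FiniteDimensional ℂ W]

/-- A basis of a `p`-dimensional subspace. -/
def subspaceBasis {p : ℕ} (F : Submodule ℂ W) (h : finrank ℂ F = p) : Basis (Fin p) ℂ F :=
  finBasisOfFinrankEq ℂ F h

theorem pluckerVector_ne_zero {p : ℕ} (F : Submodule ℂ W) (h : finrank ℂ F = p) :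
    exteriorPower.ιMulti ℂ p (fun i => (subspaceBasis F h i : W)) ≠ 0 := by
  intro h0
  have h1 : exteriorPower.map p F.subtype (exteriorPower.ιMulti ℂ p (subspaceBasis F h)) = 0 := by
    rw [exteriorPower.map_apply_ιMulti]
    exact h0
  have h2 : exteriorPower.ιMulti ℂ p (subspaceBasis F h) = 0 :=
    exteriorPower.map_injective_field F.injective_subtype (by rw [h1, map_zero])
  have h3 := exteriorPower.alternatingMapLinearEquiv_apply_ιMulti (subspaceBasis F h).det
    (subspaceBasis F h)
  rw [h2, map_zero, Basis.det_self] at h3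
  exact zero_ne_one h3

/-- The Plücker point `[v_1 ∧ … ∧ v_p] ∈ ℙ(⋀^p W)` of the subspace with basis `v_1, …, v_p`. -/
def plucker {p : ℕ} (F : Submodule ℂ W) (h : finrank ℂ F = p) : ProjSpace (⋀[ℂ]^p W) :=
  Projectivization.mk ℂ (exteriorPower.ιMulti ℂ p fun i => (subspaceBasis F h i : W))
    (pluckerVector_ne_zero F h)

end Plucker

namespace FlagVariety

variable {W : Type u} [AddCommGroup W] [Module ℂ W] {k : ℕ} {d : Fin k → ℕ}

/-- The structure of a projective variety on `Fl(d_1, …, d_k; W)`, as a subvariety of a product of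
Grassmannians, each embedded by its Plücker embedding:
`Fl(d_1, …, d_k; W) ⊆ ∏ i, Gr(d_i; W) ⊆ ∏ i, ℙ(⋀^{d_i} W)`. -/
instance [FiniteDimensional ℂ W] : SpaceWithFunctions (FlagVariety W d) :=
  SpaceWithFunctions.ofMultiprojective (I := Fin k) (E := fun i => ⋀[ℂ]^(d i) W)
    fun F i => plucker (F.sub i) (F.finrank_sub i)

/-- The composition `Fl(d_1, …, d_k; W) → Gr(d_i; W) → ℙ(⋀^{d_i} W)` of the `i`-th projection with
the Plücker embedding. -/
def projPlucker [FiniteDimensional ℂ W] (d : Fin k → ℕ) (i : Fin k) :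
    RegularMap (FlagVariety W d) (ProjSpace (⋀[ℂ]^(d i) W)) :=
  have key : ∀ (a : Unit → ℕ) (A : (Unit → ⋀[ℂ]^(d i) W) → ℂ),
      IsForm (I := Unit) (E := fun _ => ⋀[ℂ]^(d i) W) a A →
      IsForm (I := Fin k) (E := fun i => ⋀[ℂ]^(d i) W) (Pi.single i (a ()))
        (fun v => A fun _ => v i) := by
    intro a A hA
    refine ⟨?_, fun c x => ?_⟩
    · have h0 : ∀ f ∈ Algebra.adjoin ℂ {f : (Unit → ⋀[ℂ]^(d i) W) → ℂ |
          ∃ ξ : Dual ℂ (Unit → ⋀[ℂ]^(d i) W), f = ξ},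
          (fun v : (Π i, ⋀[ℂ]^(d i) W) => f fun _ => v i) ∈
            Algebra.adjoin ℂ {f : (Π i, ⋀[ℂ]^(d i) W) → ℂ |
              ∃ ξ : Dual ℂ (Π i, ⋀[ℂ]^(d i) W), f = ξ} := by
        intro f hf
        induction hf using Algebra.adjoin_induction with
        | mem f hf =>
          obtain ⟨ξ, rfl⟩ := hf
          exact Algebra.subset_adjoin
            ⟨ξ ∘ₗ LinearMap.pi fun _ => LinearMap.proj (φ := fun i => ⋀[ℂ]^(d i) W) i, rfl⟩
        | algebraMap r => exact Subalgebra.algebraMap_mem _ r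
        | add f g _ _ hf hg => exact add_mem hf hg
        | mul f g _ _ hf hg => exact mul_mem hf hg
      exact h0 A hA.1
    · have h1 := hA.2 (fun _ => c i) (fun _ => x i)
      have h2 : ∏ l, c l ^ (Pi.single i (a ()) : Fin k → ℕ) l = c i ^ a () := by
        rw [Finset.prod_eq_single i (fun l _ hl => by rw [Pi.single_eq_of_ne hl, pow_zero])
          (fun h => absurd (Finset.mem_univ i) h), Pi.single_eq_same]
      simpa [h2] using h1
  { toFun := fun F => plucker (F.sub i) (F.finrank_sub i)
    continuous_toFun := by
      refine continuous_generateFrom_iff.2 ?_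
      rintro _ ⟨a, B, hB, rfl⟩
      exact TopologicalSpace.isOpen_generateFrom_of_mem ⟨_, _, key a B hB, rfl⟩
    regular_comp := by
      rintro x f ⟨a, A, B, hA, hB, hx, hf⟩
      exact ⟨_, _, _, key a A hA, key a B hB, hx, fun y hy => hf _ hy⟩ }

/-- The preferred generator `[L_i]` of the Picard group of `Fl(d_1, …, d_k; W)`: the class of the
pull-back of `𝒪(1)` along `Fl(d_1, …, d_k; W) → Gr(d_i; W) → ℙ(⋀^{d_i} W)`. -/
def picGen (W : Type u) [AddCommGroup W] [Module ℂ W] [FiniteDimensional ℂ W]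
    (d : Fin k → ℕ) (i : Fin k) : Pic (FlagVariety W d) :=
  Pic.pullback (projPlucker d i) (Pic.mk (ProjSpace.twist _))

/-- The preferred generators indexed by `1, …, k`, with the convention that the class is `0` for
the indices `0` and `k + 1`. -/
def picGenExt (W : Type u) [AddCommGroup W] [Module ℂ W] [FiniteDimensional ℂ W]
    (d : Fin k → ℕ) (i : ℕ) : Pic (FlagVariety W d) :=
  if h : 1 ≤ i ∧ i ≤ k then picGen W d ⟨i - 1, by omega⟩ else 0

/-- The subspaces of a flag indexed by `1, …, k`, with the convention `F_0 = 0`, `F_{k+1} = W`. -/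
def space (F : FlagVariety W d) (i : ℕ) : Submodule ℂ W :=
  if i = 0 then ⊥ else if h : i - 1 < k then F.sub ⟨i - 1, h⟩ else ⊤

/-- The action of `GL(W)` on flags. -/
instance : MulAction (W ≃ₗ[ℂ] W) (FlagVariety W d) where
  smul g F :=
    { sub := fun i => (F.sub i).map (g : W →ₗ[ℂ] W)
      finrank_sub := fun i => by rw [LinearEquiv.finrank_map_eq, F.finrank_sub]
      mono := fun i j h => Submodule.map_mono (F.mono h) }
  one_smul F := by
    ext1
    funext i
    exact Submodule.map_id _
  mul_smul g h F := by
    ext1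
    funext i
    exact Submodule.map_comp (h : W →ₗ[ℂ] W) (g : W →ₗ[ℂ] W) (F.sub i)

/-- The duality map `Fl(d_1, …, d_k; W) → Fl(dim W - d_k, …, dim W - d_1; W^*)`, which sends a flag
to the flag of the annihilators of its members. -/
def duality [FiniteDimensional ℂ W] (F : FlagVariety W d) :
    FlagVariety (Dual ℂ W) (fun i => finrank ℂ W - d i.rev) where
  sub i := (F.sub i.rev).dualAnnihilator
  finrank_sub i := by
    have := Subspace.finrank_add_finrank_dualAnnihilator_eq (F.sub i.rev)
    rw [F.finrank_sub] at this
    omega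
  mono i j h := Submodule.dualAnnihilator_anti (F.mono (Fin.rev_le_rev.2 h))

/-- The flag of coordinate subspaces `⟨e_x : x ∈ S_i⟩` for a basis `e` and an increasing family of
subsets `S_i` of its index set. -/
def coordinate {κ : Type} (e : Basis κ ℂ W) (S : Fin k → Finset κ) (hS : Monotone S) :
    FlagVariety W (fun i => (S i).card) where
  sub i := Submodule.span ℂ (e '' (S i : Set κ))
  finrank_sub i := by
    rw [Set.image_eq_range]
    have := finrank_span_eq_card (R := ℂ) (b := fun x : (S i : Set κ) => e x)
      (e.linearIndependent.comp _ Subtype.val_injective)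
    simpa using this
  mono i j h := Submodule.span_mono (Set.image_mono (by exact_mod_cast hS h))

end FlagVariety

/-! ## Linear maps and standard extensions -/

section MapsOfFlagVarieties

variable {V W : Type u} [AddCommGroup V] [Module ℂ V] [AddCommGroup W] [Module ℂ W]
  {k l : ℕ} {p : Fin k → ℕ} {q : Fin l → ℕ}

/-- A morphism of flag varieties is linear if the pull-back of each preferred generator is zero or
a preferred generator. -/
def IsLinearMorphism [FiniteDimensional ℂ V] [FiniteDimensional ℂ W]
    (φ : RegularMap (FlagVariety V p) (FlagVariety W q)) : Prop :=
  ∀ j : Fin l, Pic.pullback φ (FlagVariety.picGen W q j) = 0 ∨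
    ∃ i : Fin k, Pic.pullback φ (FlagVariety.picGen W q j) = FlagVariety.picGen V p i

/-- Strict standard extensions: for some decomposition `W = V' ⊕ Z`, isomorphism `ε : V ≃ V'`, chain
`Z_1 ⊆ … ⊆ Z_l` of subspaces of `Z` and nondecreasing `κ : {1, …, l} → {0, …, k + 1}`, the flag
`{V_1, …, V_k}` is sent to `{ε(V_{κ(j)}) + Z_j}_j`, where `V_0 = 0` and `V_{k+1} = V`. -/
def IsStrictStandardExtension (φ : FlagVariety V p → FlagVariety W q) : Prop :=
  ∃ (V' Z : Submodule ℂ W) (ε : V ≃ₗ[ℂ] V') (Zs : Fin l → Submodule ℂ W) (κ : Fin l → Fin (k + 2)),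
    IsCompl V' Z ∧ Monotone Zs ∧ (∀ j, Zs j ≤ Z) ∧ Monotone κ ∧
    ∀ (F : FlagVariety V p) (j : Fin l),
      (φ F).sub j = (F.space (κ j)).map (V'.subtype ∘ₗ (ε : V →ₗ[ℂ] V')) ⊔ Zs j

/-- Standard extensions: `φ` or its composition with the duality map is a strict standard
extension. -/
def IsStandardExtension [FiniteDimensional ℂ W] (φ : FlagVariety V p → FlagVariety W q) : Prop :=
  IsStrictStandardExtension φ ∨ IsStrictStandardExtension (fun F => (φ F).duality)

end MapsOfFlagVarieties

/-! ## Parabolic subgroups and the diagonal embedding -/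

section Diagonal

variable {W : Type u} [AddCommGroup W] [Module ℂ W]

/-- A parabolic subgroup of `GL(W)`: the stabilizer of a flag, i.e. of a chain of subspaces. -/
def IsParabolic (Q : Subgroup (W ≃ₗ[ℂ] W)) : Prop :=
  ∃ C : Set (Submodule ℂ W), IsChain (· ≤ ·) C ∧
    ∀ g : W ≃ₗ[ℂ] W, g ∈ Q ↔ ∀ F ∈ C, F.map (g : W →ₗ[ℂ] W) = F

/-- The strict diagonal embedding `GL(W) → GL(W^d)`, `x ↦ diag(x, …, x)`. -/
def diagonalEmbedding (W : Type u) [AddCommGroup W] [Module ℂ W] (d : ℕ) :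
    (W ≃ₗ[ℂ] W) →* ((Fin d → W) ≃ₗ[ℂ] (Fin d → W)) where
  toFun x := LinearEquiv.piCongrRight fun _ => x
  map_one' := rfl
  map_mul' _ _ := rfl

/-- The map `GL(W)/(P ∩ GL(W)) → GL(W^d)/P` induced by the diagonal embedding. -/
def diagonalQuotientMap (W : Type u) [AddCommGroup W] [Module ℂ W] (d : ℕ)
    (P : Subgroup ((Fin d → W) ≃ₗ[ℂ] (Fin d → W))) :
    (W ≃ₗ[ℂ] W) ⧸ P.comap (diagonalEmbedding W d) → ((Fin d → W) ≃ₗ[ℂ] (Fin d → W)) ⧸ P :=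
  Quotient.map' (diagonalEmbedding W d) fun x y h => by
    rw [QuotientGroup.leftRel_apply] at h ⊢
    rw [← map_inv, ← map_mul]
    exact h

/-- For a subspace `M` of `W`, its copy `M^{(i)}` in the `i`-th summand of `W^d`. -/
def copy {d : ℕ} (M : Submodule ℂ W) (i : Fin d) : Submodule ℂ (Fin d → W) :=
  M.map (LinearMap.single ℂ (fun _ : Fin d => W) i)

variable {m d s t : ℕ}

/-- The basis of `W^d` consisting of the copies `e_r^{(k)}` of the vectors of a basis of `W`. -/
def diagonalBasis (d : ℕ) (e : Basis (Fin m) ℂ W) : Basis (Fin d × Fin m) ℂ (Fin d → W) :=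
  (Pi.basis fun _ : Fin d => e).reindex (Equiv.sigmaEquivProd (Fin d) (Fin m))

theorem diagonalBasis_apply (e : Basis (Fin m) ℂ W) (k : Fin d) (r : Fin m) :
    diagonalBasis d e (k, r) = Pi.single k (e r) := by
  simp [diagonalBasis]

/-- The sets `{x : α(x) ≤ j}`, for all but the last value `j` of `α`. -/
def alphaSets (α : Fin d × Fin m → Fin (s + 1)) (j : Fin s) : Finset (Fin d × Fin m) :=
  {x | α x ≤ j.castSucc}

/-- The flag `𝓕_α = {⟨e_x : α(x) ≤ j⟩}_j` in `W^d`. -/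
def flagAlpha (e : Basis (Fin m) ℂ W) (α : Fin d × Fin m → Fin (s + 1)) :
    FlagVariety (Fin d → W) (fun j => (alphaSets α j).card) :=
  FlagVariety.coordinate (diagonalBasis d e) (alphaSets α) fun i j h x hx => by
    simp only [alphaSets, Finset.mem_filter, Finset.mem_univ, true_and] at hx ⊢
    exact hx.trans (Fin.castSucc_le_castSucc_iff.2 h)

/-- The parabolic subgroup `P = Stab(𝓕_α)` of `GL(W^d)`. -/
def parabolicAlpha (e : Basis (Fin m) ℂ W) (α : Fin d × Fin m → Fin (s + 1)) :
    Subgroup ((Fin d → W) ≃ₗ[ℂ] (Fin d → W)) :=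
  MulAction.stabilizer _ (flagAlpha e α)

/-- The map `β`, `r ↦ (α(1, r), …, α(d, r))`, with values in the product partial order. -/
def beta (α : Fin d × Fin m → Fin (s + 1)) (r : Fin m) : Fin d → Fin (s + 1) := fun k => α (k, r)

open Classical in
/-- The sets `{r : β(r) ≤ b_j}`, for all but the last `b_j`. -/
def betaSets (α : Fin d × Fin m → Fin (s + 1)) (b : Fin (t + 1) → Fin d → Fin (s + 1))
    (j : Fin t) : Finset (Fin m) :=
  {r | beta α r ≤ b j.castSucc}

/-- The flag `𝓕_β = {⟨e_r : β(r) ≤ b_j⟩}_j` in `W`. -/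
def flagBeta (e : Basis (Fin m) ℂ W) (α : Fin d × Fin m → Fin (s + 1))
    (b : Fin (t + 1) → Fin d → Fin (s + 1)) (hb : StrictMono b) :
    FlagVariety W (fun j => (betaSets α b j).card) :=
  FlagVariety.coordinate e (betaSets α b) fun i j h r hr => by
    simp only [betaSets, Finset.mem_filter, Finset.mem_univ, true_and] at hr ⊢
    exact hr.trans (hb.monotone (Fin.castSucc_le_castSucc_iff.2 h))

end Diagonal

/-! ## The coloured graph -/

section EGraph

variable {d s t : ℕ}

/-- The edges of the E-graph with left vertices `l_i`, `i : Fin (t + 1)`, right vertices `r_j`,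
`j : Fin (s + 1)`, and colours `Fin d`, attached to `b_1 < … < b_q`: there is an edge of colour `k`
between `l_i` and `r_j` if `(b_i)_k = j` and `i` is maximal for this property. -/
def IsEdge (b : Fin (t + 1) → Fin d → Fin (s + 1)) (k : Fin d) (i : Fin (t + 1))
    (j : Fin (s + 1)) : Prop :=
  b i k = j ∧ ∀ i', b i' k = j → i' ≤ i

/-- The ordinary edges, i.e. the edges that do not pass through the last left vertex. -/
def IsOrdinaryEdge (b : Fin (t + 1) → Fin d → Fin (s + 1)) (k : Fin d) (i : Fin (t + 1))
    (j : Fin (s + 1)) : Prop :=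
  IsEdge b k i j ∧ i ≠ Fin.last t

/-- `l_i` is the left end point of the last edge of colour `k` arriving at or above `r_j`. -/
def IsLastLeftEnd (b : Fin (t + 1) → Fin d → Fin (s + 1)) (k : Fin d) (j : Fin (s + 1))
    (i : Fin (t + 1)) : Prop :=
  ∃ j' ≤ j, IsEdge b k i j' ∧ ∀ i'' j'', j'' ≤ j → IsEdge b k i'' j'' → j'' ≤ j'

open Classical in
/-- The index `i_k` in `{1, …, q}` of the left end point of the edge of colour `k` arriving at
`r_j`, and `0` if there is no such edge.  (Left vertices are counted from `1` here.) -/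
def edgeIndex (b : Fin (t + 1) → Fin d → Fin (s + 1)) (k : Fin d) (j : Fin (s + 1)) : ℕ :=
  if h : ∃ i, IsEdge b k i j then (h.choose : ℕ) + 1 else 0

open Classical in
/-- The index `i'_k` in `{1, …, q}` of the left end point of the last edge of colour `k` arriving
at or above `r_j`, and `0` if there is no such edge. -/
def lastEdgeIndex (b : Fin (t + 1) → Fin d → Fin (s + 1)) (k : Fin d) (j : Fin (s + 1)) : ℕ :=
  if h : ∃ i, IsLastLeftEnd b k j i then (h.choose : ℕ) + 1 else 0

end EGraph

end

noncomputable section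

universe u v

open SpaceWithFunctions

/-! ### Transitivity of `GL` on flags and the orbit map -/

section Transitivity

variable {W : Type u} [AddCommGroup W] [Module ℂ W]

/-! Total order of the image of `β`. The transformation `v ↦ v + e_r^*(v) e_q` lies in `Q` exactly
when `β(q) ≤ β(r)` (`elementary_mem_iff`). If `Q` stabilizes a chain, the case `q = r` shows that
each member of the chain contains every basis vector that occurs in one of its vectors. Incomparable
`β(q)` and `β(r)` would then give two members of the chain, each containing only one of `e_q`, `e_r`
(`isChain_range_beta`).

Formula for `φ`. Since `b_i(k)` is nondecreasing in `i`, the index `i'_k(j)` is simply the number of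
`i` with `b_i(k) ≤ j` (`lt_lastEdgeIndex_iff`). Hence the `j`-th member of `𝓕_α` is the direct sum
of the copies of the members of `𝓕_β` with indices `i'_k(j)`. Every proper member of `𝓕_β` occurs in
this way, so `Q` is the stabilizer of `𝓕_β`; as `GL(W)` is transitive on flags, equivariance gives
the formula everywhere.

Picard groups. The Plücker vector of a direct sum is the product of the Plücker vectors of the
summands, so `φ` lifts to a multihomogeneous polynomial map (`directSumLift`). This makes `φ` a
morphism and shows how it transforms multidegrees. A bundle with transition functions `B_y / B_x`,
for forms `B_x` of one multidegree, is determined up to isomorphism by that multidegree, which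
yields the pull-back formula. Conversely the multidegree is determined by the class: along a
projective line of flags in which only the `i`-th member moves, an isomorphism is a nowhere
vanishing section of a bundle of degree `b_i - a_i` (`IsLevelFlag.multidegree_unique`).

Linearity. Call a colour active at `r_j` if `1 ≤ i'_k(j) ≤ q - 1`. The total degree of the pull-back
of `L_j` is the number of active colours, so linearity means at most one active colour at each
`r_j`; the graph condition says the same.

Standard extensions. If only one colour is ever active, the remaining summands are `0` or whole
copies of `W`, and `φ` is visibly a strict standard extension. For the converse, intersect and sum
the `j`-th members over all flags. In a strict standard extension a nonconstant member has
intersection `Z_j ⊆ Z` and sum `A' + Z_j`. The dimensions leave one active colour at each such `j`,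
and different colours at `j` and `j'` would force `A' ⊆ Z`. Annihilators exchange sums with
intersections, which settles the dual case. -/

theorem exists_linearEquiv_apply_eq {v w : W} (hv : v ≠ 0) (hw : w ≠ 0) :
    ∃ g : W ≃ₗ[ℂ] W, g v = w := by
  obtain ⟨g, hg⟩ := Submodule.exists_linearEquiv_restrict_eq
    ((LinearEquiv.toSpanNonzeroSingleton ℂ W v hv).symm.trans
      (LinearEquiv.toSpanNonzeroSingleton ℂ W w hw))
  refine ⟨g, ?_⟩
  rw [← hg ⟨v, Submodule.mem_span_singleton_self v⟩]
  have h1 : (LinearEquiv.toSpanNonzeroSingleton ℂ W v hv).symm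
      ⟨v, Submodule.mem_span_singleton_self v⟩ = 1 := by
    rw [LinearEquiv.symm_apply_eq, LinearEquiv.toSpanNonzeroSingleton_one]
  rw [LinearEquiv.trans_apply, h1, LinearEquiv.toSpanNonzeroSingleton_one]

/-- Match the largest members first, then use induction inside the largest member of the target
chain and extend the result to the whole space. The space is quantified inside the induction because
the inductive step changes it. -/
theorem exists_linearEquiv_map_chain_eq (k : ℕ) :
    ∀ {W : Type u} [AddCommGroup W] [Module ℂ W] [FiniteDimensional ℂ W]
      (S T : Fin k → Submodule ℂ W), Monotone S → Monotone T →
      (∀ i, finrank ℂ (S i) = finrank ℂ (T i)) →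
      ∃ g : W ≃ₗ[ℂ] W, ∀ i, (S i).map (g : W →ₗ[ℂ] W) = T i := by
  induction k with
  | zero => exact fun S T _ _ _ => ⟨LinearEquiv.refl ℂ _, fun i => i.elim0⟩
  | succ k ih =>
    intro W _ _ _ S T hS hT h
    obtain ⟨g₁, hg₁⟩ := Submodule.exists_linearEquiv_restrict_eq
      (LinearEquiv.ofFinrankEq _ _ (h (Fin.last k)))
    have hlast : (S (Fin.last k)).map (g₁ : W →ₗ[ℂ] W) = T (Fin.last k) := by
      refine Submodule.eq_of_le_of_finrank_eq ?_
        (by rw [LinearEquiv.finrank_map_eq, h])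
      rintro _ ⟨x, hx, rfl⟩
      exact hg₁ ⟨x, hx⟩ ▸ Subtype.coe_prop _
    have hle : ∀ i : Fin k, (S i.castSucc).map (g₁ : W →ₗ[ℂ] W) ≤ T (Fin.last k) := fun i =>
      (Submodule.map_mono (hS (Fin.le_last _))).trans hlast.le
    have hle' : ∀ i : Fin k, T i.castSucc ≤ T (Fin.last k) := fun i => hT (Fin.le_last _)
    obtain ⟨f, hf⟩ := ih
      (fun i : Fin k =>
        ((S i.castSucc).map (g₁ : W →ₗ[ℂ] W)).comap (T (Fin.last k)).subtype)
      (fun i : Fin k => (T i.castSucc).comap (T (Fin.last k)).subtype)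
      (fun i j hij => Submodule.comap_mono (Submodule.map_mono (hS (by simpa using hij))))
      (fun i j hij => Submodule.comap_mono (hT (by simpa using hij)))
      (fun i => by
        rw [(Submodule.comapSubtypeEquivOfLe (hle i)).finrank_eq,
          (Submodule.comapSubtypeEquivOfLe (hle' i)).finrank_eq,
          LinearEquiv.finrank_map_eq, h])
    obtain ⟨g₂, hg₂⟩ := Submodule.exists_linearEquiv_restrict_eq f
    refine ⟨g₁.trans g₂, fun i => ?_⟩
    have hmap : ∀ N : Submodule ℂ W, N.map (g₁.trans g₂ : W →ₗ[ℂ] W) =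
        (N.map (g₁ : W →ₗ[ℂ] W)).map (g₂ : W →ₗ[ℂ] W) := fun N => Submodule.map_comp _ _ _
    rw [hmap]
    refine Submodule.eq_of_le_of_finrank_eq ?_
      (by rw [LinearEquiv.finrank_map_eq, LinearEquiv.finrank_map_eq, h])
    induction i using Fin.lastCases with
    | last =>
      rw [hlast]
      rintro _ ⟨x, hx, rfl⟩
      exact hg₂ ⟨x, hx⟩ ▸ Subtype.coe_prop _
    | cast i =>
      rintro _ ⟨x, hx, rfl⟩
      have h1 : f ⟨x, hle i hx⟩ ∈ (T i.castSucc).comap (T (Fin.last k)).subtype := by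
        rw [← hf i]
        exact ⟨⟨x, hle i hx⟩, Submodule.mem_comap.2 hx, rfl⟩
      exact hg₂ ⟨x, hle i hx⟩ ▸ h1

theorem FlagVariety.exists_smul_eq [FiniteDimensional ℂ W] {k : ℕ} {d : Fin k → ℕ} (F F' : FlagVariety W d) :
    ∃ g : W ≃ₗ[ℂ] W, g • F = F' := by
  obtain ⟨g, hg⟩ := exists_linearEquiv_map_chain_eq k F.sub F'.sub F.mono F'.mono
    (fun i => by rw [F.finrank_sub, F'.finrank_sub])
  exact ⟨g, FlagVariety.ext (funext hg)⟩

end Transitivity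

theorem exists_quotientEquiv_of_stabilizer {G X : Type*} [Group G] [MulAction G X]
    (x₀ : X) (H : Subgroup G) (hH : H = MulAction.stabilizer G x₀) (hX : ∀ x, ∃ g : G, g • x₀ = x) :
    ∃ θ : G ⧸ H ≃ X, ∀ g : G, θ (QuotientGroup.mk g) = g • x₀ := by
  subst hH
  refine ⟨Equiv.ofBijective (MulAction.ofQuotientStabilizer G x₀)
    ⟨MulAction.injective_ofQuotientStabilizer G x₀, fun x => ?_⟩, fun g => rfl⟩
  obtain ⟨g, rfl⟩ := hX x
  exact ⟨QuotientGroup.mk g, rfl⟩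

/-! ### Flags and their extended members -/

namespace FlagVariety

variable {W : Type u} [AddCommGroup W] [Module ℂ W] {k : ℕ} {d : Fin k → ℕ}

@[simp]
theorem smul_sub (g : W ≃ₗ[ℂ] W) (F : FlagVariety W d) (i : Fin k) :
    (g • F).sub i = (F.sub i).map (g : W →ₗ[ℂ] W) := rfl

@[simp]
theorem space_zero (F : FlagVariety W d) : F.space 0 = ⊥ := rfl

theorem space_succ (F : FlagVariety W d) (i : Fin k) : F.space (i + 1) = F.sub i := by
  simp [space]

theorem space_of_lt (F : FlagVariety W d) {i : ℕ} (h : k < i) : F.space i = ⊤ := by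
  have h0 : i ≠ 0 := by omega
  have h1 : ¬ i - 1 < k := by omega
  simp [space, h0, h1]

theorem space_mono (F : FlagVariety W d) : Monotone F.space := by
  intro i j hij
  rcases Nat.eq_zero_or_pos i with rfl | hi
  · exact bot_le
  rcases Nat.lt_or_ge k j with hj | hj
  · rw [F.space_of_lt hj]
    exact le_top
  obtain ⟨i, rfl⟩ : ∃ i' : Fin k, i = i' + 1 := ⟨⟨i - 1, by omega⟩, by simp; omega⟩
  obtain ⟨j, rfl⟩ : ∃ j' : Fin k, j = j' + 1 := ⟨⟨j - 1, by omega⟩, by simp; omega⟩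
  rw [space_succ, space_succ]
  exact F.mono (by simpa using hij)

theorem space_smul (g : W ≃ₗ[ℂ] W) (F : FlagVariety W d) (i : ℕ) :
    (g • F).space i = (F.space i).map (g : W →ₗ[ℂ] W) := by
  rcases Nat.eq_zero_or_pos i with rfl | hi
  · simp
  rcases Nat.lt_or_ge k i with h | h
  · rw [space_of_lt _ h, space_of_lt _ h, Submodule.map_top, LinearEquiv.range]
  obtain ⟨i, rfl⟩ : ∃ i' : Fin k, i = i' + 1 := ⟨⟨i - 1, by omega⟩, by simp; omega⟩
  rw [space_succ, space_succ, smul_sub]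

/-- A nonzero `w` in all these members could be written as `g v` with `v` outside `F₀.sub i`, and
then the flag `g • F₀` omits it. -/
theorem iInf_sub_eq_bot (F₀ : FlagVariety W d) {i : Fin k} (h : F₀.sub i ≠ ⊤) :
    ⨅ F : FlagVariety W d, F.sub i = ⊥ := by
  rw [eq_bot_iff]
  intro w hw
  by_contra hw0
  obtain ⟨v, -, hv⟩ := SetLike.exists_of_lt (lt_top_iff_ne_top.2 h)
  have hv0 : v ≠ 0 := fun h0 => hv (h0 ▸ zero_mem _)
  obtain ⟨g, rfl⟩ := exists_linearEquiv_apply_eq hv0 (by simpa using hw0)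
  have := (Submodule.mem_iInf _).1 hw (g • F₀)
  rw [smul_sub, Submodule.mem_map] at this
  obtain ⟨x, hx, hxv⟩ := this
  exact hv (g.injective hxv ▸ hx)

theorem iSup_sub_eq_top (F₀ : FlagVariety W d) {i : Fin k} (h : F₀.sub i ≠ ⊥) :
    ⨆ F : FlagVariety W d, F.sub i = ⊤ := by
  rw [eq_top_iff]
  intro w _
  obtain ⟨v, hv, hv0⟩ := Submodule.exists_mem_ne_zero_of_ne_bot h
  rcases eq_or_ne w 0 with rfl | hw
  · exact zero_mem _
  obtain ⟨g, rfl⟩ := exists_linearEquiv_apply_eq hv0 hw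
  exact Submodule.mem_iSup_of_mem (g • F₀) (Submodule.mem_map_of_mem hv)

end FlagVariety

/-! ### Subspaces of a power of a vector space -/

section Pi

variable {W : Type u} [AddCommGroup W] [Module ℂ W] {d : ℕ}

theorem iSup_copy (M : Fin d → Submodule ℂ W) :
    ⨆ k, copy (M k) k = Submodule.pi Set.univ M := by
  unfold copy
  exact Submodule.iSup_map_single (R := ℂ) (φ := fun _ : Fin d => W)

theorem mem_iSup_copy {M : Fin d → Submodule ℂ W} {v : Fin d → W} :
    v ∈ ⨆ k, copy (M k) k ↔ ∀ k, v k ∈ M k := by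
  rw [iSup_copy]
  simp

theorem finrank_iSup_copy [FiniteDimensional ℂ W] (M : Fin d → Submodule ℂ W) :
    finrank ℂ (⨆ k, copy (M k) k : Submodule ℂ (Fin d → W)) = ∑ k, finrank ℂ (M k) := by
  rw [← Module.finrank_pi_fintype ℂ (M := fun k => M k)]
  refine LinearEquiv.finrank_eq
    { toFun := fun v k => ⟨v.1 k, mem_iSup_copy.1 v.2 k⟩
      invFun := fun w => ⟨fun k => w k, mem_iSup_copy.2 fun k => (w k).2⟩
      map_add' := fun _ _ => rfl
      map_smul' := fun _ _ => rfl
      left_inv := fun _ => rfl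
      right_inv := fun _ => rfl }

theorem map_diagonalEmbedding_iSup_copy (g : W ≃ₗ[ℂ] W) (M : Fin d → Submodule ℂ W) :
    (⨆ k, copy (M k) k).map (diagonalEmbedding W d g : (Fin d → W) →ₗ[ℂ] (Fin d → W)) =
      ⨆ k, copy ((M k).map (g : W →ₗ[ℂ] W)) k := by
  ext v
  rw [mem_iSup_copy]
  simp only [Submodule.mem_map, mem_iSup_copy]
  constructor
  · rintro ⟨x, hx, rfl⟩ k
    exact ⟨x k, hx k, rfl⟩
  · intro h
    choose x hx hxv using h
    exact ⟨x, hx, funext hxv⟩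

theorem iSup_copy_injective :
    Function.Injective fun M : Fin d → Submodule ℂ W => ⨆ k, copy (M k) k := by
  intro M N h
  funext k
  ext w
  have key : ∀ M : Fin d → Submodule ℂ W, w ∈ M k ↔ Pi.single k w ∈ ⨆ k, copy (M k) k := by
    intro M
    rw [mem_iSup_copy]
    refine ⟨fun hw l => ?_, fun hw => by simpa using hw k⟩
    rcases eq_or_ne l k with rfl | hl
    · simpa using hw
    · simp [Pi.single_eq_of_ne hl]
  rw [key M, key N]
  exact iff_of_eq (congrArg (fun N : Submodule ℂ (Fin d → W) => Pi.single k w ∈ N) h)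

end Pi

/-! ### Elementary transformations and the parabolic subgroup `Q` -/

section Elementary

variable {W : Type u} [AddCommGroup W] [Module ℂ W] {m : ℕ}

/-- The transformation `v ↦ v + e_r^*(v) e_q`. -/
def elementary (e : Basis (Fin m) ℂ W) (q r : Fin m) : W ≃ₗ[ℂ] W :=
  -- The map is invertible because `1 + e_r^*(e_q)` is `2` for `q = r` and `1` otherwise. The case
  -- `q = r` is a torus element that doubles `e_r`.
  LinearEquiv.dilatransvection (f := e.coord r) (v := e q) (by
    rcases eq_or_ne q r with rfl | h
    · simp [one_add_one_eq_two]
    · simp [Finsupp.single_eq_of_ne h.symm])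

theorem elementary_apply (e : Basis (Fin m) ℂ W) (q r : Fin m) (v : W) :
    elementary e q r v = v + e.coord r v • e q :=
  LinearEquiv.dilatransvection.apply

theorem map_eq_self_iff_map_le [FiniteDimensional ℂ W] (g : W ≃ₗ[ℂ] W) (F : Submodule ℂ W) :
    F.map (g : W →ₗ[ℂ] W) = F ↔ F.map (g : W →ₗ[ℂ] W) ≤ F :=
  ⟨le_of_eq, fun h => Submodule.eq_of_le_of_finrank_eq h (LinearEquiv.finrank_map_eq g F)⟩

/-- The difference between a vector and its image is its `r`-th coordinate times `e q`; this is the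
only direction that `F` may fail to contain. -/
theorem map_elementary_eq_iff [FiniteDimensional ℂ W] (e : Basis (Fin m) ℂ W) (q r : Fin m)
    (F : Submodule ℂ W) : F.map (elementary e q r : W →ₗ[ℂ] W) = F ↔
      ((∃ v ∈ F, e.coord r v ≠ 0) → e q ∈ F) := by
  rw [map_eq_self_iff_map_le]
  constructor
  · rintro h ⟨v, hv, hvr⟩
    have h1 : elementary e q r v ∈ F := h (Submodule.mem_map_of_mem hv)
    rw [elementary_apply] at h1
    exact (F.smul_mem_iff hvr).1 ((F.add_mem_iff_right hv).1 h1)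
  · rintro h _ ⟨v, hv, rfl⟩
    change elementary e q r v ∈ F
    rw [elementary_apply]
    by_cases hvr : e.coord r v = 0
    · simpa [hvr] using hv
    · exact add_mem hv (F.smul_mem _ (h ⟨v, hv, hvr⟩))

theorem Module.Basis.apply_mem_span_image_iff (e : Basis (Fin m) ℂ W) (q : Fin m)
    (S : Set (Fin m)) : e q ∈ Submodule.span ℂ (e '' S) ↔ q ∈ S := by
  simp [Basis.mem_span_image, Finsupp.support_single]

theorem map_elementary_span_eq_iff [FiniteDimensional ℂ W] (e : Basis (Fin m) ℂ W) (q r : Fin m)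
    (S : Set (Fin m)) :
    (Submodule.span ℂ (e '' S)).map (elementary e q r : W →ₗ[ℂ] W) = Submodule.span ℂ (e '' S) ↔
      (r ∈ S → q ∈ S) := by
  rw [map_elementary_eq_iff, e.apply_mem_span_image_iff]
  refine imp_congr_left ⟨?_, fun h => ⟨e r, (e.apply_mem_span_image_iff r S).2 h, by simp⟩⟩
  rintro ⟨v, hv, hvr⟩
  rw [Basis.mem_span_image] at hv
  exact hv (by simpa using hvr)

variable {d s : ℕ}

theorem flagAlpha_sub (e : Basis (Fin m) ℂ W) (α : Fin d × Fin m → Fin (s + 1)) (j : Fin s) :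
    (flagAlpha e α).sub j =
      ⨆ k, copy (Submodule.span ℂ (e '' {r | α (k, r) ≤ j.castSucc})) k := by
  change Submodule.span ℂ (diagonalBasis d e '' (alphaSets α j : Set (Fin d × Fin m))) = _
  simp only [copy, Submodule.map_span, ← Submodule.span_iUnion]
  congr 1
  ext v
  simp only [alphaSets, Set.mem_image, Set.mem_iUnion, Finset.coe_filter, Finset.mem_univ,
    true_and, Set.mem_ofPred_eq, Prod.exists, diagonalBasis_apply, exists_exists_and_eq_and,
    LinearMap.single_apply]

theorem mem_comap_parabolicAlpha_iff (e : Basis (Fin m) ℂ W) (α : Fin d × Fin m → Fin (s + 1))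
    (g : W ≃ₗ[ℂ] W) : g ∈ (parabolicAlpha e α).comap (diagonalEmbedding W d) ↔
      ∀ (j : Fin s) (k : Fin d),
        (Submodule.span ℂ (e '' {r | α (k, r) ≤ j.castSucc})).map (g : W →ₗ[ℂ] W) =
          Submodule.span ℂ (e '' {r | α (k, r) ≤ j.castSucc}) := by
  rw [Subgroup.mem_comap, parabolicAlpha, MulAction.mem_stabilizer_iff, FlagVariety.ext_iff,
    funext_iff]
  refine forall_congr' fun j => ?_
  rw [FlagVariety.smul_sub, flagAlpha_sub, map_diagonalEmbedding_iSup_copy, ← funext_iff]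
  exact iSup_copy_injective.eq_iff

/-- Stability of each coordinate subspace `{α(k, ·) ≤ j}` says that `α(k, r) ≤ j` implies `α(k, q) ≤
j`; over all `j` and `k` this is the componentwise inequality. -/
theorem elementary_mem_iff [FiniteDimensional ℂ W] (e : Basis (Fin m) ℂ W)
    (α : Fin d × Fin m → Fin (s + 1)) (q r : Fin m) :
    elementary e q r ∈ (parabolicAlpha e α).comap (diagonalEmbedding W d) ↔
      beta α q ≤ beta α r := by
  simp only [mem_comap_parabolicAlpha_iff, map_elementary_span_eq_iff, Set.mem_ofPred_eq]
  constructor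
  · intro h k
    -- The flag has no member for the last value of `α`, but the inequality is automatic there.
    rcases Fin.eq_castSucc_or_eq_last (α (k, r)) with ⟨j, hj⟩ | hl
    · have := h j k hj.le
      rwa [← hj] at this
    · exact (Fin.le_last _).trans hl.ge
  · exact fun h j k hr => (h k).trans hr

theorem isChain_range_beta [FiniteDimensional ℂ W] (e : Basis (Fin m) ℂ W)
    (α : Fin d × Fin m → Fin (s + 1))
    (hQ : IsParabolic ((parabolicAlpha e α).comap (diagonalEmbedding W d))) (q r : Fin m) :
    beta α q ≤ beta α r ∨ beta α r ≤ beta α q := by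
  obtain ⟨C, hC, hCQ⟩ := hQ
  -- Torus elements belong to `Q` because `β(r) ≤ β(r)`.
  have hcoord : ∀ F ∈ C, ∀ r, (∃ v ∈ F, e.coord r v ≠ 0) → e r ∈ F := fun F hF r =>
    (map_elementary_eq_iff e r r F).1
      ((hCQ _).1 ((elementary_mem_iff e α r r).2 le_rfl) F hF)
  have hnot : ∀ q r, ¬ beta α q ≤ beta α r → ∃ F ∈ C, e r ∈ F ∧ e q ∉ F := by
    intro q r h
    rw [← elementary_mem_iff e, hCQ] at h
    push Not at h
    obtain ⟨F, hF, h⟩ := h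
    rw [ne_eq, map_elementary_eq_iff, Classical.not_imp] at h
    exact ⟨F, hF, hcoord F hF r h.1, h.2⟩
  by_contra! h
  obtain ⟨F, hF, hr, hq⟩ := hnot q r h.1
  obtain ⟨F', hF', hq', hr'⟩ := hnot r q h.2
  rcases hC.total hF hF' with hle | hle
  · exact hr' (hle hr)
  · exact hq (hle hq')

end Elementary

theorem exists_strictMono_range_eq {P : Type*} [PartialOrder P] {ι : Type*} [Finite ι] [Nonempty ι]
    (f : ι → P) (hf : ∀ i j, f i ≤ f j ∨ f j ≤ f i) :
    ∃ (t : ℕ) (b : Fin (t + 1) → P), StrictMono b ∧ Set.range b = Set.range f := by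
  classical
  let _ : LinearOrder (Set.range f) :=
    { (inferInstance : PartialOrder (Set.range f)) with
      le_total := by
        rintro ⟨_, i, rfl⟩ ⟨_, j, rfl⟩
        exact hf i j
      toDecidableLE := Classical.decRel _ }
  have : Fintype (Set.range f) := Fintype.ofFinite _
  obtain ⟨t, ht⟩ : ∃ t, Fintype.card (Set.range f) = t + 1 :=
    Nat.exists_eq_succ_of_ne_zero Fintype.card_ne_zero
  let o := Fintype.orderIsoFinOfCardEq (Set.range f) ht
  refine ⟨t, fun i => o i, fun i j h => o.strictMono h, ?_⟩
  ext x
  constructor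
  · rintro ⟨i, rfl⟩
    exact (o i).2
  · intro hx
    exact ⟨o.symm ⟨x, hx⟩, by simp⟩

/-! ### Combinatorics of the coloured graph -/

section Graph

variable {d s t : ℕ} {b : Fin (t + 1) → Fin d → Fin (s + 1)}

theorem exists_isEdge_iff {k : Fin d} {j : Fin (s + 1)} :
    (∃ i, IsEdge b k i j) ↔ ∃ i, b i k = j := by
  classical
  refine ⟨fun ⟨i, h, _⟩ => ⟨i, h⟩, fun ⟨i, h⟩ => ?_⟩
  have hne : (Finset.univ.filter fun i => b i k = j).Nonempty := ⟨i, by simpa using h⟩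
  refine ⟨_, by simpa using Finset.max'_mem _ hne, fun i' hi' => ?_⟩
  exact Finset.le_max' _ _ (by simpa using hi')

/-- Along a nondecreasing coordinate, the largest value not exceeding `j` is taken at the largest
`i` with `b i k ≤ j`, and the edge at that value starts from this `i`. -/
theorem isLastLeftEnd_iff (hb : Monotone b) {k : Fin d} {j : Fin (s + 1)} {i : Fin (t + 1)} :
    IsLastLeftEnd b k j i ↔ b i k ≤ j ∧ ∀ i', b i' k ≤ j → i' ≤ i := by
  constructor
  · rintro ⟨j', hj', hi, hmax⟩
    refine ⟨hi.1.le.trans hj', fun i' hi' => ?_⟩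
    by_contra! hlt
    obtain ⟨i'', hi''⟩ := exists_isEdge_iff.2 ⟨i', rfl⟩
    have h1 := hmax i'' _ hi' hi''
    have h2 : b i k ≤ b i' k := hb hlt.le k
    exact hlt.not_ge (hi.2 i' (le_antisymm h1 (hi.1 ▸ h2)))
  · rintro ⟨hi, hmax⟩
    exact ⟨b i k, hi, ⟨rfl, fun i' h => hmax i' (h.le.trans hi)⟩,
      fun i'' j'' hj'' h => h.1 ▸ hb (hmax i'' (h.1.le.trans hj'')) k⟩

/-- The working description of `i'_k(j)`: it counts the `i` with `b i k ≤ j`, which form an initial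
segment. The strict inequality reflects that left vertices are numbered from `0` in `Fin (t + 1)`
and from `1` in `lastEdgeIndex`. -/
theorem lt_lastEdgeIndex_iff (hb : Monotone b) (k : Fin d) (j : Fin (s + 1)) (i : Fin (t + 1)) :
    (i : ℕ) < lastEdgeIndex b k j ↔ b i k ≤ j := by
  classical
  unfold lastEdgeIndex
  split_ifs with h
  · have := (isLastLeftEnd_iff hb).1 h.choose_spec
    refine ⟨fun hi => (hb (Fin.le_iff_val_le_val.2 (Nat.lt_succ_iff.1 hi)) k).trans this.1,
      fun hi => Nat.lt_succ_iff.2 (this.2 i hi)⟩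
  · refine ⟨fun hi => absurd hi (Nat.not_lt_zero _), fun hi => absurd ?_ h⟩
    have hne : (Finset.univ.filter fun i => b i k ≤ j).Nonempty := ⟨i, by simpa using hi⟩
    refine ⟨_, (isLastLeftEnd_iff hb).2 ⟨by simpa using Finset.max'_mem _ hne, fun i' hi' => ?_⟩⟩
    exact Finset.le_max' _ _ (by simpa using hi')

theorem lastEdgeIndex_le (k : Fin d) (j : Fin (s + 1)) : lastEdgeIndex b k j ≤ t + 1 := by
  unfold lastEdgeIndex
  split_ifs with h
  · omega
  · omega

theorem lastEdgeIndex_mono (hb : Monotone b) (k : Fin d) : Monotone (lastEdgeIndex b k) := by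
  intro j j' hj
  by_contra! h
  have h1 := lastEdgeIndex_le (b := b) k j
  have h2 := (lt_lastEdgeIndex_iff hb k j ⟨lastEdgeIndex b k j', by omega⟩).1 h
  exact lt_irrefl _ ((lt_lastEdgeIndex_iff hb k j' ⟨lastEdgeIndex b k j', by omega⟩).2 (h2.trans hj))

theorem lastEdgeIndex_eq_of_forall (hb : Monotone b) {k : Fin d} {j : Fin (s + 1)} {n : ℕ}
    (hn : n ≤ t + 1) (h : ∀ i : Fin (t + 1), (i : ℕ) < n ↔ b i k ≤ j) :
    lastEdgeIndex b k j = n := by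
  have h0 := lastEdgeIndex_le (b := b) k j
  by_contra hne
  rcases Nat.lt_or_gt_of_ne hne with hlt | hlt
  · have := (h ⟨lastEdgeIndex b k j, by omega⟩).1 hlt
    exact lt_irrefl _ ((lt_lastEdgeIndex_iff hb k j ⟨lastEdgeIndex b k j, by omega⟩).2 this)
  · have := (lt_lastEdgeIndex_iff hb k j ⟨n, by omega⟩).1 hlt
    exact lt_irrefl _ ((h ⟨n, by omega⟩).2 this)

theorem edgeIndex_eq_lastEdgeIndex (hb : Monotone b) {k : Fin d} {j : Fin (s + 1)}
    (h : ∃ i, b i k = j) : edgeIndex b k j = lastEdgeIndex b k j := by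
  have h' := exists_isEdge_iff.2 h
  rw [edgeIndex, dif_pos h']
  have hs := h'.choose_spec
  symm
  refine lastEdgeIndex_eq_of_forall hb (by omega) fun i =>
    ⟨fun hi => (hb (Fin.le_iff_val_le_val.2 (Nat.lt_succ_iff.1 hi)) k).trans hs.1.le, fun hi => ?_⟩
  refine Nat.lt_succ_iff.2 (Fin.le_iff_val_le_val.1 ?_)
  by_contra! hlt
  exact hlt.not_ge (hs.2 i (le_antisymm hi (hs.1 ▸ hb hlt.le k)))

theorem edgeIndex_eq_zero {k : Fin d} {j : Fin (s + 1)}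
    (h : ¬ ∃ i, b i k = j) : edgeIndex b k j = 0 := by
  rw [edgeIndex, dif_neg (exists_isEdge_iff.not.2 h)]

theorem edgeIndex_le_lastEdgeIndex (hb : Monotone b) (k : Fin d) (j : Fin (s + 1)) :
    edgeIndex b k j ≤ lastEdgeIndex b k j := by
  by_cases h : ∃ i, b i k = j
  · exact (edgeIndex_eq_lastEdgeIndex hb h).le
  · rw [edgeIndex_eq_zero h]
    exact Nat.zero_le _

theorem lastEdgeIndex_zero_eq_zero (hb : Monotone b) {k : Fin d} (h : ¬ ∃ i, b i k = 0) :
    lastEdgeIndex b k 0 = 0 :=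
  lastEdgeIndex_eq_of_forall hb (Nat.zero_le _) fun i =>
    ⟨fun hi => absurd hi (Nat.not_lt_zero _), fun hi => absurd ⟨i, Fin.le_zero_iff.1 hi⟩ h⟩

theorem lastEdgeIndex_eq_pred (hb : Monotone b) {k : Fin d} {j j' : Fin (s + 1)}
    (hj : (j : ℕ) = j' + 1) (h : ¬ ∃ i, b i k = j) :
    lastEdgeIndex b k j = lastEdgeIndex b k j' := by
  refine lastEdgeIndex_eq_of_forall hb (lastEdgeIndex_le k j') fun i => ?_
  rw [lt_lastEdgeIndex_iff hb]
  refine ⟨fun hi => hi.trans (Fin.le_iff_val_le_val.2 (by omega)), fun hi => ?_⟩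
  have hne : b i k ≠ j := fun h' => h ⟨i, h'⟩
  have h1 : (b i k : ℕ) ≠ j := fun h' => hne (Fin.ext h')
  have h2 : (b i k : ℕ) ≤ j := hi
  exact Fin.le_iff_val_le_val.2 (by omega)

/-- Every proper index is the index of the last edge of some colour at some right vertex. -/
theorem exists_lastEdgeIndex_eq (hb : StrictMono b) (i : Fin t) :
    ∃ (k : Fin d) (j : Fin s), lastEdgeIndex b k j.castSucc = i + 1 := by
  have h : b i.castSucc < b i.succ := hb (Fin.castSucc_lt_succ)
  -- Consecutive values of `b` differ strictly in some coordinate `k`; for `j = b_i(k)` exactly the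
  -- left vertices up to `l_i` are counted.
  obtain ⟨-, k, hk⟩ := Pi.lt_def.1 h
  obtain ⟨j, hj⟩ : ∃ j : Fin s, b i.castSucc k = j.castSucc :=
    (Fin.eq_castSucc_or_eq_last _).resolve_right
      fun hl => (hk.trans_le (Fin.le_last _)).ne hl
  refine ⟨k, j, lastEdgeIndex_eq_of_forall hb.monotone (by omega) fun i' => ?_⟩
  rw [← hj]
  refine ⟨fun h => hb.monotone (Fin.le_iff_val_le_val.2 (Nat.lt_succ_iff.1 h)) k, fun h => ?_⟩
  by_contra! hlt
  exact (hk.trans_le (hb.monotone (Fin.le_iff_val_le_val.2 (by simpa using hlt)) k)).not_ge h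

/-- A colour is active at `r_j` if the last edge of this colour at or above `r_j` is ordinary. -/
def IsActive (b : Fin (t + 1) → Fin d → Fin (s + 1)) (k : Fin d) (j : Fin (s + 1)) : Prop :=
  1 ≤ lastEdgeIndex b k j ∧ lastEdgeIndex b k j ≤ t

/-- At least one but not all of the `b i k` are at most `j`, so by monotonicity the first and the
last of them decide. -/
theorem isActive_iff (hb : Monotone b) {k : Fin d} {j : Fin (s + 1)} :
    IsActive b k j ↔ b 0 k ≤ j ∧ j < b (Fin.last t) k := by
  rw [← not_le, ← lt_lastEdgeIndex_iff hb, ← lt_lastEdgeIndex_iff hb, IsActive, Fin.val_last,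
    Fin.val_zero, not_lt, Nat.succ_le_iff]

theorem isActive_of_isOrdinaryEdge (hb : Monotone b) {k : Fin d} {i : Fin (t + 1)}
    {j : Fin (s + 1)} (h : IsOrdinaryEdge b k i j) : IsActive b k j := by
  obtain ⟨⟨h1, h2⟩, h3⟩ := h
  rw [isActive_iff hb]
  refine ⟨h1 ▸ hb (Fin.zero_le i) k, lt_of_le_of_ne (h1 ▸ hb (Fin.le_last i) k) fun h => ?_⟩
  exact h3 (le_antisymm (Fin.le_last i) (h2 _ h.symm))

theorem exists_isOrdinaryEdge_of_isActive (hb : Monotone b) {k : Fin d} {j : Fin (s + 1)}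
    (h : IsActive b k j) : ∃ i, ∃ j' ≤ j, IsOrdinaryEdge b k i j' := by
  obtain ⟨h1, h2⟩ := h
  -- The shift by one returns from the numbering of `lastEdgeIndex` to `Fin (t + 1)`; this vertex is
  -- not the last one because the index is at most `t`.
  have hi := (lt_lastEdgeIndex_iff hb k j ⟨lastEdgeIndex b k j - 1, by omega⟩).1
    (Nat.sub_lt h1 one_pos)
  refine ⟨_, _, hi, ⟨rfl, fun i' hi' => ?_⟩, fun hl => ?_⟩
  · have := (lt_lastEdgeIndex_iff hb k j i').2 (hi'.le.trans hi)
    exact Fin.le_iff_val_le_val.2 (Nat.le_sub_one_of_lt this)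
  · have := congrArg Fin.val hl
    simp only [Fin.val_last] at this
    omega

/-- Two edges of colour `c` enclose `r_j`, the upper one possibly at `r_j` itself, exactly when `b 0
c ≤ j < b (Fin.last t) c`, that is, when `c` is active there. -/
theorem forall_isActive_eq_iff (hb : Monotone b) :
    (∀ j c c', IsActive b c j → IsActive b c' j → c = c') ↔
      ∀ (c : Fin d) (j j' : Fin (s + 1)), j < j' →
        (∃ i, IsEdge b c i j) → (∃ i, IsEdge b c i j') →
        ∀ j'', j ≤ j'' → j'' < j' → ∀ c' i, IsOrdinaryEdge b c' i j'' → c' = c := by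
  constructor
  · intro h c j j' _ hj hj' j'' h1 h2 c' i hi
    obtain ⟨i₁, hi₁⟩ := exists_isEdge_iff.1 hj
    obtain ⟨i₂, hi₂⟩ := exists_isEdge_iff.1 hj'
    refine h j'' c' c (isActive_of_isOrdinaryEdge hb hi) ((isActive_iff hb).2 ⟨?_, ?_⟩)
    · exact (hb (Fin.zero_le i₁) c).trans (hi₁.le.trans h1)
    · exact h2.trans_le (hi₂ ▸ hb (Fin.le_last i₂) c)
  · intro h j₀ c c' hc hc'
    -- Colour `c` arrives at `r_j` and, through its bounding edge, below `r_{j₀}`; the ordinary edge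
    -- of colour `c'` at `r_{j'}` lies in between.
    have key : ∀ c c' i j i' j', IsActive b c j₀ → IsOrdinaryEdge b c i j → j ≤ j₀ →
        IsOrdinaryEdge b c' i' j' → j' ≤ j₀ → j ≤ j' → c' = c := by
      intro c c' i j i' j' hc hi hj hi' hj' hjj'
      have h1 := ((isActive_iff hb).1 hc).2
      exact h c j _ (hj.trans_lt h1) ⟨i, hi.1⟩ (exists_isEdge_iff.2 ⟨_, rfl⟩) j' hjj'
        (hj'.trans_lt h1) c' i' hi'
    obtain ⟨i, j, hj, hi⟩ := exists_isOrdinaryEdge_of_isActive hb hc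
    obtain ⟨i', j', hj', hi'⟩ := exists_isOrdinaryEdge_of_isActive hb hc'
    rcases le_total j j' with hle | hle
    · exact (key c c' i j i' j' hc hi hj hi' hj' hle).symm
    · exact key c' c i' j' i j hc' hi' hj' hi hj hle

theorem forall_isOrdinaryEdge_eq_iff (hb : Monotone b) :
    (∀ c c' i i' j j', IsOrdinaryEdge b c i j → IsOrdinaryEdge b c' i' j' → c = c') ↔
      ∀ c c' j j', IsActive b c j → IsActive b c' j' → c = c' := by
  constructor
  · intro h c c' j j' hc hc'
    obtain ⟨i, l, -, hi⟩ := exists_isOrdinaryEdge_of_isActive hb hc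
    obtain ⟨i', l', -, hi'⟩ := exists_isOrdinaryEdge_of_isActive hb hc'
    exact h c c' i i' l l' hi hi'
  · intro h c c' i i' j j' hi hi'
    exact h c c' j j' (isActive_of_isOrdinaryEdge hb hi) (isActive_of_isOrdinaryEdge hb hi')

end Graph

/-! ### Volume elements of subspaces in the exterior algebra -/

section Volume

variable {V : Type u} [AddCommGroup V] [Module ℂ V]

/-- The product in the exterior algebra of a list of vectors. -/
def wedge (l : List V) : ExteriorAlgebra ℂ V := (l.map (ExteriorAlgebra.ι ℂ)).prod

theorem wedge_ofFn {n : ℕ} (v : Fin n → V) :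
    wedge (List.ofFn v) = ExteriorAlgebra.ιMulti ℂ n v := by
  rw [wedge, List.map_ofFn, ExteriorAlgebra.ιMulti_apply]
  rfl

/-- `x` is a nonzero multiple of `v_1 ∧ … ∧ v_n` for a basis `v_1, …, v_n` of `M`. -/
def IsVolume (M : Submodule ℂ V) (x : ExteriorAlgebra ℂ V) : Prop :=
  ∃ l : List V, l.length = finrank ℂ M ∧ Submodule.span ℂ {v | v ∈ l} = M ∧
    ∃ c : ℂ, c ≠ 0 ∧ x = c • wedge l

theorem IsVolume.smul {M : Submodule ℂ V} {x : ExteriorAlgebra ℂ V} (h : IsVolume M x) {c : ℂ}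
    (hc : c ≠ 0) : IsVolume M (c • x) := by
  obtain ⟨l, h1, h2, a, ha, rfl⟩ := h
  exact ⟨l, h1, h2, c * a, mul_ne_zero hc ha, smul_smul _ _ _⟩

/-- The factor is the determinant of the change of basis: an alternating map in `n = dim M` vectors
of `M` is `e.det` times its value at a basis `e`. -/
theorem exists_ιMulti_eq_smul [FiniteDimensional ℂ V] {M : Submodule ℂ V} {n : ℕ}
    (hn : finrank ℂ M = n) {v w : Fin n → V} (hv : Submodule.span ℂ (Set.range v) = M)
    (hw : Submodule.span ℂ (Set.range w) = M) :
    ∃ c : ℂ, c ≠ 0 ∧ ExteriorAlgebra.ιMulti ℂ n w = c • ExteriorAlgebra.ιMulti ℂ n v := by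
  have key : ∀ u : Fin n → V, Submodule.span ℂ (Set.range u) = M →
      ∃ e : Basis (Fin n) ℂ M, ∀ i, (e i : V) = u i := by
    intro u hu
    have hmem : ∀ i, u i ∈ M := fun i => hu ▸ Submodule.subset_span ⟨i, rfl⟩
    have hspan : ⊤ ≤ Submodule.span ℂ (Set.range fun i => (⟨u i, hmem i⟩ : M)) := by
      rw [← Submodule.map_le_map_iff_of_injective M.injective_subtype, Submodule.map_span,
        ← Set.range_comp, Submodule.map_subtype_top]
      exact hu.ge
    refine ⟨basisOfTopLeSpanOfCardEqFinrank _ hspan (by rw [Fintype.card_fin, hn]), fun i => ?_⟩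
    rw [coe_basisOfTopLeSpanOfCardEqFinrank]
  obtain ⟨e, he⟩ := key v hv
  obtain ⟨e', he'⟩ := key w hw
  let f : M [⋀^Fin n]→ₗ[ℂ] ExteriorAlgebra ℂ V :=
    (ExteriorAlgebra.ιMulti ℂ n).compLinearMap M.subtype
  have hf : f = (LinearMap.toSpanSingleton ℂ _ (f e)).compAlternatingMap e.det := by
    refine Basis.ext_alternating e fun σ hσ => ?_
    obtain ⟨σ, rfl⟩ : ∃ τ : Equiv.Perm (Fin n), σ = τ :=
      ⟨Equiv.ofBijective σ (Finite.injective_iff_bijective.1 hσ), rfl⟩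
    have h1 := f.map_perm e σ
    have h2 := e.det.map_perm e σ
    rw [Basis.det_self] at h2
    rw [LinearMap.compAlternatingMap_apply, LinearMap.toSpanSingleton_apply]
    change f (e ∘ σ) = e.det (e ∘ σ) • f e
    rw [h1, h2]
    rcases Int.units_eq_one_or (Equiv.Perm.sign σ) with h | h <;> simp [h]
  have hfe : f e = ExteriorAlgebra.ιMulti ℂ n v := by
    rw [← funext he]
    rfl
  have hfe' : f e' = ExteriorAlgebra.ιMulti ℂ n w := by
    rw [← funext he']
    rfl
  refine ⟨e.det e', (e.isUnit_det e').ne_zero, ?_⟩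
  rw [← hfe, ← hfe']
  conv_lhs => rw [hf]
  rfl

/-- This allows the arbitrarily chosen representative of a Plücker point to be replaced by any
explicit product. -/
theorem IsVolume.exists_eq_smul [FiniteDimensional ℂ V] {M : Submodule ℂ V}
    {x y : ExteriorAlgebra ℂ V} (hx : IsVolume M x) (hy : IsVolume M y) :
    ∃ c : ℂ, c ≠ 0 ∧ x = c • y := by
  obtain ⟨l, h1, h2, a, ha, rfl⟩ := hx
  obtain ⟨l', h1', h2', a', ha', rfl⟩ := hy
  have key : ∀ (l : List V) (n : ℕ) (h : l.length = n), ∃ v : Fin n → V,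
      Set.range v = {v | v ∈ l} ∧ wedge l = ExteriorAlgebra.ιMulti ℂ n v := by
    rintro l _ rfl
    refine ⟨l.get, ?_, ?_⟩
    · ext v
      simp [List.mem_iff_get]
    · rw [← wedge_ofFn, List.ofFn_get]
  obtain ⟨v, hv, hv'⟩ := key l _ h1
  obtain ⟨w, hw, hw'⟩ := key l' _ h1'
  obtain ⟨c, hc, h⟩ := exists_ιMulti_eq_smul rfl (hw ▸ h2') (hv ▸ h2)
  refine ⟨a * c * a'⁻¹, mul_ne_zero (mul_ne_zero ha hc) (inv_ne_zero ha'), ?_⟩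
  rw [hv', hw', h, smul_smul, smul_smul, mul_assoc, inv_mul_cancel₀ ha', mul_one]

theorem isVolume_wedge {M : Submodule ℂ V} (l : List V) (h1 : l.length = finrank ℂ M)
    (h2 : Submodule.span ℂ {v | v ∈ l} = M) : IsVolume M (wedge l) :=
  ⟨l, h1, h2, 1, one_ne_zero, (one_smul _ _).symm⟩

theorem isVolume_basis {M : Submodule ℂ V} {n : ℕ} (e : Basis (Fin n) ℂ M) :
    IsVolume M (ExteriorAlgebra.ιMulti ℂ n fun i => (e i : V)) := by
  rw [← wedge_ofFn]
  refine isVolume_wedge _ (by rw [List.length_ofFn, finrank_eq_card_basis e, Fintype.card_fin]) ?_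
  have h1 : {v | v ∈ List.ofFn fun i => (e i : V)} = M.subtype '' Set.range e := by
    ext v
    simp [List.mem_ofFn]
  rw [h1, ← Submodule.map_span, e.span_eq, Submodule.map_subtype_top]

theorem isVolume_bot : IsVolume (⊥ : Submodule ℂ V) 1 := by
  refine ⟨[], by simp, by simp, 1, one_ne_zero, by simp [wedge]⟩

theorem isVolume_rep_plucker [FiniteDimensional ℂ V] {p : ℕ} (F : Submodule ℂ V)
    (h : finrank ℂ F = p) :
    IsVolume F (((plucker F h).rep : ⋀[ℂ]^p V) : ExteriorAlgebra ℂ V) := by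
  obtain ⟨a, ha⟩ := Projectivization.exists_smul_eq_mk_rep ℂ _ (pluckerVector_ne_zero F h)
  have h1 : (plucker F h).rep =
    (a : ℂ) • exteriorPower.ιMulti ℂ p fun i => (subspaceBasis F h i : V) := ha.symm
  rw [h1, Submodule.coe_smul, exteriorPower.ιMulti_apply_coe]
  exact (isVolume_basis _).smul a.ne_zero

theorem map_wedge {W : Type u} [AddCommGroup W] [Module ℂ W] (f : W →ₗ[ℂ] V) (l : List W) :
    ExteriorAlgebra.map f (wedge l) = wedge (l.map f) := by
  simp [wedge, map_list_prod, Function.comp_def]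

theorem wedge_flatten (L : List (List V)) : wedge L.flatten = (L.map wedge).prod := by
  rw [wedge, List.map_flatten, List.prod_flatten, List.map_map]
  rfl

theorem List.prod_ofFn_smul {A : Type*} [Ring A] [Algebra ℂ A] :
    ∀ {d : ℕ} (c : Fin d → ℂ) (x : Fin d → A),
      (List.ofFn fun k => c k • x k).prod = (∏ k, c k) • (List.ofFn x).prod
  | 0, c, x => by simp
  | d + 1, c, x => by
    rw [List.ofFn_succ, List.ofFn_succ, List.prod_cons, List.prod_cons, List.prod_ofFn_smul,
      Fin.prod_univ_succ, smul_mul_smul_comm]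

/-- The product of the copies of `x_k` in the `k`-th summands. -/
def copyWedge {W : Type u} [AddCommGroup W] [Module ℂ W] {d : ℕ}
    (x : Fin d → ExteriorAlgebra ℂ W) : ExteriorAlgebra ℂ (Fin d → W) :=
  (List.ofFn fun k =>
    ExteriorAlgebra.map (LinearMap.single ℂ (fun _ : Fin d => W) k) (x k)).prod

theorem copyWedge_smul {W : Type u} [AddCommGroup W] [Module ℂ W] {d : ℕ} (c : Fin d → ℂ)
    (x : Fin d → ExteriorAlgebra ℂ W) :
    copyWedge (fun k => c k • x k) = (∏ k, c k) • copyWedge x := by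
  simp only [copyWedge, map_smul, List.prod_ofFn_smul]

/-- Concatenating copies of bases of the `M k` gives a basis of the direct sum, and concatenation of
lists becomes multiplication in the exterior algebra. -/
theorem isVolume_copyWedge {W : Type u} [AddCommGroup W] [Module ℂ W] [FiniteDimensional ℂ W]
    {d : ℕ} {M : Fin d → Submodule ℂ W} {x : Fin d → ExteriorAlgebra ℂ W}
    (h : ∀ k, IsVolume (M k) (x k)) : IsVolume (⨆ k, copy (M k) k) (copyWedge x) := by
  choose l h1 h2 c hc hx using h
  refine ⟨(List.ofFn fun k => (l k).map (LinearMap.single ℂ (fun _ : Fin d => W) k)).flatten,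
    ?_, ?_, ∏ k, c k, Finset.prod_ne_zero_iff.2 fun k _ => hc k, ?_⟩
  · rw [finrank_iSup_copy, List.length_flatten, List.map_ofFn, List.sum_ofFn]
    exact Finset.sum_congr rfl fun k _ => by simp [h1]
  · simp only [copy, ← h2, Submodule.map_span, Submodule.iSup_span]
    congr 1
    ext v
    simp [List.mem_ofFn, List.mem_flatten]
  · rw [funext hx, copyWedge_smul, wedge_flatten, copyWedge, List.map_ofFn]
    simp only [map_wedge, Function.comp_def]

end Volume

/-! ### Polynomial maps -/

section PolynomialMaps

variable {I : Type} {E : I → Type v} [∀ i, AddCommGroup (E i)] [∀ i, Module ℂ (E i)]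

/-- The algebra of polynomial functions on `∏ i, E i`. -/
def polyAlgebra (E : I → Type v) [∀ i, AddCommGroup (E i)] [∀ i, Module ℂ (E i)] :
    Subalgebra ℂ ((Π i, E i) → ℂ) :=
  Algebra.adjoin ℂ {f : (Π i, E i) → ℂ | ∃ ξ : Dual ℂ (Π i, E i), f = ξ}

theorem dual_mem_polyAlgebra (ξ : Dual ℂ (Π i, E i)) : (ξ : (Π i, E i) → ℂ) ∈ polyAlgebra E :=
  Algebra.subset_adjoin ⟨ξ, rfl⟩

/-- The algebra of polynomial maps from `∏ i, E i` to an algebra. -/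
def polyMapAlgebra (E : I → Type v) [∀ i, AddCommGroup (E i)] [∀ i, Module ℂ (E i)]
    (A : Type*) [Ring A] [Algebra ℂ A] : Subalgebra ℂ ((Π i, E i) → A) :=
  (Submodule.span ℂ {f : (Π i, E i) → A | ∃ p ∈ polyAlgebra E, ∃ a : A,
    f = fun x => p x • a}).toSubalgebra
    (Submodule.subset_span ⟨1, one_mem _, 1, by ext; simp⟩)
    (fun f g hf hg => by
      have h := Submodule.mul_mem_mul hf hg
      rw [Submodule.span_mul_span] at h
      refine Submodule.span_mono ?_ h
      rintro _ ⟨_, ⟨p, hp, a, rfl⟩, _, ⟨q, hq, b, rfl⟩, rfl⟩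
      exact ⟨p * q, mul_mem hp hq, a * b, funext fun x => smul_mul_smul_comm _ _ _ _⟩)

theorem smul_const_mem_polyMapAlgebra {A : Type*} [Ring A] [Algebra ℂ A] {p : (Π i, E i) → ℂ}
    (hp : p ∈ polyAlgebra E) (a : A) : (fun x => p x • a) ∈ polyMapAlgebra E A :=
  Submodule.subset_span ⟨p, hp, a, rfl⟩

theorem const_mem_polyMapAlgebra {A : Type*} [Ring A] [Algebra ℂ A] (a : A) :
    (fun _ => a) ∈ polyMapAlgebra E A := by
  simpa using smul_const_mem_polyMapAlgebra (one_mem (polyAlgebra E)) a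

theorem linear_mem_polyMapAlgebra [Finite I] [∀ i, FiniteDimensional ℂ (E i)] {A : Type*} [Ring A]
    [Algebra ℂ A] (L : (Π i, E i) →ₗ[ℂ] A) : (L : (Π i, E i) → A) ∈ polyMapAlgebra E A := by
  let e := finBasis ℂ (Π i, E i)
  have h : (L : (Π i, E i) → A) = ∑ r, fun x => e.coord r x • L (e r) := by
    ext x
    conv_lhs => rw [← e.sum_repr x, map_sum]
    simp
  rw [h]
  exact sum_mem fun r _ => smul_const_mem_polyMapAlgebra (dual_mem_polyAlgebra _) _

theorem map_comp_mem_polyMapAlgebra {A B : Type*} [Ring A] [Algebra ℂ A] [Ring B] [Algebra ℂ B]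
    {f : (Π i, E i) → A} (hf : f ∈ polyMapAlgebra E A) (L : A →ₗ[ℂ] B) :
    (fun x => L (f x)) ∈ polyMapAlgebra E B := by
  change f ∈ Submodule.span ℂ _ at hf
  induction hf using Submodule.span_induction with
  | mem f hf =>
    obtain ⟨p, hp, a, rfl⟩ := hf
    simp only [map_smul]
    exact smul_const_mem_polyMapAlgebra hp _
  | zero =>
    simp only [Pi.zero_apply, map_zero]
    exact zero_mem _
  | add f g _ _ hf hg =>
    simp only [Pi.add_apply, map_add]
    exact add_mem hf hg
  | smul c f _ hf =>
    simp only [Pi.smul_apply, map_smul]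
    exact (polyMapAlgebra E B).smul_mem hf c

theorem mem_polyAlgebra_of_mem_polyMapAlgebra {f : (Π i, E i) → ℂ}
    (hf : f ∈ polyMapAlgebra E ℂ) : f ∈ polyAlgebra E := by
  refine Submodule.span_le (p := (polyAlgebra E).toSubmodule).2 ?_ hf
  rintro _ ⟨p, hp, a, rfl⟩
  have h : (fun x => p x • a) = a • p := by
    ext x
    simp [mul_comm]
  rw [h]
  exact (polyAlgebra E).smul_mem hp a

theorem dual_comp_mem_polyAlgebra {A : Type*} [Ring A] [Algebra ℂ A] {f : (Π i, E i) → A}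
    (hf : f ∈ polyMapAlgebra E A) (ξ : Dual ℂ A) : (fun x => ξ (f x)) ∈ polyAlgebra E :=
  mem_polyAlgebra_of_mem_polyMapAlgebra (map_comp_mem_polyMapAlgebra hf ξ)

variable {J : Type} [Fintype J] {E' : J → Type v} [∀ j, AddCommGroup (E' j)]
  [∀ j, Module ℂ (E' j)]

/-- Linear functionals generate the polynomial functions, and each is a sum of functionals of single
components. -/
theorem comp_mem_polyAlgebra [DecidableEq J] {Φ : (Π i, E i) → Π j, E' j}
    (hΦ : ∀ (j : J) (ξ : Dual ℂ (E' j)), (fun x => ξ (Φ x j)) ∈ polyAlgebra E)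
    {A : (Π j, E' j) → ℂ} (hA : A ∈ polyAlgebra E') : A ∘ Φ ∈ polyAlgebra E := by
  induction hA using Algebra.adjoin_induction with
  | mem f hf =>
    obtain ⟨ξ, rfl⟩ := hf
    have h : (ξ : (Π j, E' j) → ℂ) ∘ Φ =
        ∑ j, fun x => (ξ ∘ₗ LinearMap.single ℂ E' j) (Φ x j) := by
      ext x
      conv_lhs => rw [Function.comp_apply, ← LinearMap.sum_single_apply E' (Φ x), map_sum]
      simp
    rw [h]
    exact sum_mem fun j _ => hΦ j _
  | algebraMap r => exact (polyAlgebra E).algebraMap_mem r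
  | add f g _ _ hf hg => exact add_mem hf hg
  | mul f g _ _ hf hg => exact mul_mem hf hg

end PolynomialMaps

/-! ### Line bundles on flag varieties given by forms -/

namespace FlagVariety

section Twist

variable {W : Type u} [AddCommGroup W] [Module ℂ W] {k : ℕ} {d : Fin k → ℕ}

theorem isForm_dual_apply (i : Fin k) (ξ : Dual ℂ (⋀[ℂ]^(d i) W)) :
    IsForm (E := fun i => ⋀[ℂ]^(d i) W) (Pi.single i 1) fun w => ξ (w i) := by
  refine ⟨dual_mem_polyAlgebra (ξ ∘ₗ LinearMap.proj (φ := fun i => ⋀[ℂ]^(d i) W) i), fun c x => ?_⟩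
  rw [Finset.prod_eq_single i (fun l _ hl => by rw [Pi.single_eq_of_ne hl, pow_zero])
    (fun h => absurd (Finset.mem_univ i) h), Pi.single_eq_same, pow_one]
  simp

variable [FiniteDimensional ℂ W]

/-- The value of a form at the chosen representative of the Plücker image of a flag. -/
def value (A : (Π i, ⋀[ℂ]^(d i) W) → ℂ) (F : FlagVariety W d) : ℂ :=
  A fun i => (plucker (F.sub i) (F.finrank_sub i)).rep

/-- The line bundle `L` has transition functions `B_y / B_x` for forms `B_x` of multidegree `a`. -/
def IsTwist (a : Fin k → ℕ) (L : LineBundle (FlagVariety W d)) : Prop :=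
  ∃ B : FlagVariety W d → (Π i, ⋀[ℂ]^(d i) W) → ℂ, (∀ x, IsForm a (B x)) ∧
    ∀ x y, ∀ z ∈ L.nhd x ∩ L.nhd y, value (B x) z ≠ 0 ∧ L.g x y z * value (B x) z = value (B y) z

theorem isOpen_value_ne_zero {a : Fin k → ℕ} {B : (Π i, ⋀[ℂ]^(d i) W) → ℂ} (hB : IsForm a B) :
    IsOpen {z : FlagVariety W d | value B z ≠ 0} :=
  TopologicalSpace.isOpen_generateFrom_of_mem ⟨a, B, hB, rfl⟩

theorem div_mem_regularAt {a : Fin k → ℕ} {A B : (Π i, ⋀[ℂ]^(d i) W) → ℂ} (hA : IsForm a A)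
    (hB : IsForm a B) {z : FlagVariety W d} (hz : value B z ≠ 0) :
    (fun y => value A y / value B y) ∈ regularAt z :=
  ⟨a, A, B, hA, hB, hz, fun _ _ => rfl⟩

/-- The quotients `B_x / C_x` of forms of equal multidegree are regular, do not vanish on the common
domains, and intertwine the two cocycles. -/
theorem IsTwist.iso {a : Fin k → ℕ} {L M : LineBundle (FlagVariety W d)} (hL : IsTwist a L)
    (hM : IsTwist a M) : L.Iso M := by
  obtain ⟨B, hB, hL⟩ := hL
  obtain ⟨C, hC, hM⟩ := hM
  have hB0 : ∀ x, ∀ z ∈ L.nhd x, value (B x) z ≠ 0 := fun x z hz => (hL x x z ⟨hz, hz⟩).1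
  have hC0 : ∀ x, ∀ z ∈ M.nhd x, value (C x) z ≠ 0 := fun x z hz => (hM x x z ⟨hz, hz⟩).1
  refine ⟨fun x => L.nhd x ∩ M.nhd x, fun x z => value (B x) z / value (C x) z,
    fun x => (L.isOpen_nhd x).inter (M.isOpen_nhd x), fun x => ⟨L.mem_nhd x, M.mem_nhd x⟩,
    fun x => le_rfl, fun x z hz => ⟨div_mem_regularAt (hB x) (hC x) (hC0 x z hz.2),
      div_ne_zero (hB0 x z hz.1) (hC0 x z hz.2)⟩, fun x y z hz => ?_⟩
  have h1 := (hL x y z ⟨hz.1.1, hz.2.1⟩).2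
  have h2 := (hM x y z ⟨hz.1.2, hz.2.2⟩).2
  have h3 := hC0 x z hz.1.2
  have h4 := hC0 y z hz.2.2
  rw [div_mul_eq_mul_div, mul_div_assoc', div_eq_div_iff h4 h3, ← h1, ← h2]
  ring

theorem isTwist_trivial : IsTwist (0 : Fin k → ℕ) (LineBundle.trivial (FlagVariety W d)) :=
  ⟨fun _ _ => 1, fun _ => IsForm.const 1, fun _ _ _ _ => ⟨one_ne_zero, one_mul _⟩⟩

theorem IsTwist.tensor {a b : Fin k → ℕ} {L M : LineBundle (FlagVariety W d)} (hL : IsTwist a L)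
    (hM : IsTwist b M) : IsTwist (a + b) (L.tensor M) := by
  obtain ⟨B, hB, hL⟩ := hL
  obtain ⟨C, hC, hM⟩ := hM
  refine ⟨fun x => B x * C x, fun x => (hB x).mul (hC x), fun x y z hz => ?_⟩
  obtain ⟨h1, h2⟩ := hL x y z ⟨hz.1.1, hz.2.1⟩
  obtain ⟨h3, h4⟩ := hM x y z ⟨hz.1.2, hz.2.2⟩
  refine ⟨mul_ne_zero h1 h3, ?_⟩
  change L.g x y z * M.g x y z * (value (B x) z * value (C x) z) = value (B y) z * value (C y) z
  rw [← h2, ← h4]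
  ring

theorem isTwist_pullback_twist (i : Fin k) :
    IsTwist (Pi.single i 1) ((ProjSpace.twist _).pullback (projPlucker (W := W) d i)) := by
  refine ⟨fun x w => ((projPlucker d i).toFun x).chart (w i), fun x => isForm_dual_apply i _,
    fun x y z hz => ⟨hz.1, div_mul_cancel₀ _ hz.1⟩⟩

/-- The class `P` is represented by a line bundle given by forms of multidegree `a`. -/
def HasMultidegree (a : Fin k → ℕ) (P : Pic (FlagVariety W d)) : Prop :=
  ∃ L, IsTwist a L ∧ Pic.mk L = P

theorem HasMultidegree.eq {a : Fin k → ℕ} {P Q : Pic (FlagVariety W d)} (hP : HasMultidegree a P)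
    (hQ : HasMultidegree a Q) : P = Q := by
  obtain ⟨L, hL, rfl⟩ := hP
  obtain ⟨M, hM, rfl⟩ := hQ
  exact Pic.mk_eq_of_iso (hL.iso hM)

theorem hasMultidegree_zero : HasMultidegree 0 (0 : Pic (FlagVariety W d)) :=
  ⟨_, isTwist_trivial, rfl⟩

theorem HasMultidegree.add {a b : Fin k → ℕ} {P Q : Pic (FlagVariety W d)}
    (hP : HasMultidegree a P) (hQ : HasMultidegree b Q) : HasMultidegree (a + b) (P + Q) := by
  obtain ⟨L, hL, rfl⟩ := hP
  obtain ⟨M, hM, rfl⟩ := hQ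
  exact ⟨_, hL.tensor hM, rfl⟩

theorem HasMultidegree.sum {κ : Type*} (s : Finset κ) {a : κ → Fin k → ℕ}
    {P : κ → Pic (FlagVariety W d)} (h : ∀ l ∈ s, HasMultidegree (a l) (P l)) :
    HasMultidegree (∑ l ∈ s, a l) (∑ l ∈ s, P l) := by
  classical
  induction s using Finset.induction_on with
  | empty => exact hasMultidegree_zero
  | insert l s hl ih =>
    rw [Finset.sum_insert hl, Finset.sum_insert hl]
    exact (h l (Finset.mem_insert_self l s)).add
      (ih fun l' hl' => h l' (Finset.mem_insert_of_mem hl'))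

theorem hasMultidegree_picGen (i : Fin k) : HasMultidegree (Pi.single i 1) (picGen W d i) :=
  ⟨_, isTwist_pullback_twist i, rfl⟩

/-- The multidegree of the `n`-th preferred generator, extended by `0`. -/
def genDegree (k n : ℕ) : Fin k → ℕ := fun i => if n = i + 1 then 1 else 0

theorem hasMultidegree_picGenExt (n : ℕ) : HasMultidegree (genDegree k n) (picGenExt W d n) := by
  unfold picGenExt
  split_ifs with h
  · convert hasMultidegree_picGen (W := W) (d := d) ⟨n - 1, by omega⟩ using 1
    ext i
    by_cases hi : n = i + 1
    · subst hi
      simp [genDegree]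
    · rw [genDegree, if_neg hi, Pi.single_eq_of_ne]
      rintro rfl
      simp at hi
      omega
  · convert hasMultidegree_zero (W := W) (d := d) using 1
    ext i
    have hi : n ≠ i + 1 := by omega
    simp [genDegree, hi]

end Twist

end FlagVariety

/-! ### Direct sums of members of a flag -/

namespace FlagVariety

section DirectSum

variable {W : Type u} [AddCommGroup W] [Module ℂ W] {d s t : ℕ} {p : Fin t → ℕ} {q : Fin s → ℕ}

/-- The flag with members `⨁_k F_{N(k, j)}^{(k)}`. -/
def directSum (N : Fin d → Fin s → ℕ) (hN : ∀ k, Monotone (N k))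
    (hq : ∀ (F : FlagVariety W p) (j : Fin s),
      finrank ℂ (⨆ k, copy (F.space (N k j)) k : Submodule ℂ (Fin d → W)) = q j)
    (F : FlagVariety W p) : FlagVariety (Fin d → W) q where
  sub j := ⨆ k, copy (F.space (N k j)) k
  finrank_sub j := hq F j
  mono i j h := iSup_mono fun k => Submodule.map_mono (F.space_mono (hN k h))

/-- The scalar `c_n`, extended by `1`. -/
def extScalar (c : Fin t → ℂ) (n : ℕ) : ℂ :=
  if h : 1 ≤ n ∧ n ≤ t then c ⟨n - 1, by omega⟩ else 1

theorem extScalar_eq_prod (c : Fin t → ℂ) (n : ℕ) :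
    extScalar c n = ∏ i, c i ^ genDegree t n i := by
  unfold extScalar genDegree
  split_ifs with h
  · rw [Finset.prod_eq_single ⟨n - 1, by omega⟩]
    · rw [if_pos (by simp; omega), pow_one]
    · intro i _ hi
      rw [if_neg, pow_zero]
      rintro rfl
      exact hi (Fin.ext (by simp))
    · exact fun h => absurd (Finset.mem_univ _) h
  · refine (Finset.prod_eq_one fun i _ => ?_).symm
    rw [if_neg (by omega), pow_zero]

variable [FiniteDimensional ℂ W]

/-- The `n`-th component `w_n`, extended by `1` for `n = 0` and by a volume element of `W` for
`n > t`. -/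
def extVolume (w : Π i, ⋀[ℂ]^(p i) W) (n : ℕ) : ExteriorAlgebra ℂ W :=
  if h : 1 ≤ n ∧ n ≤ t then w ⟨n - 1, by omega⟩
  else if n = 0 then 1 else (plucker (⊤ : Submodule ℂ W) rfl).rep

theorem extVolume_smul (c : Fin t → ℂ) (w : Π i, ⋀[ℂ]^(p i) W) (n : ℕ) :
    extVolume (fun i => c i • w i) n = extScalar c n • extVolume w n := by
  unfold extVolume extScalar
  split_ifs <;> simp

theorem extVolume_mem (n : ℕ) :
    (fun w => extVolume w n) ∈ polyMapAlgebra (fun i => ⋀[ℂ]^(p i) W) (ExteriorAlgebra ℂ W) := by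
  unfold extVolume
  split_ifs with h h
  · exact linear_mem_polyMapAlgebra ((Submodule.subtype _) ∘ₗ
      LinearMap.proj (φ := fun i => ⋀[ℂ]^(p i) W) ⟨n - 1, by omega⟩)
  · exact const_mem_polyMapAlgebra _
  · exact const_mem_polyMapAlgebra _

/-- A representative of the Plücker image of a flag. -/
def pluckerRep (F : FlagVariety W p) (i : Fin t) : ⋀[ℂ]^(p i) W :=
  (plucker (F.sub i) (F.finrank_sub i)).rep

theorem isVolume_extVolume (F : FlagVariety W p) (n : ℕ) :
    IsVolume (F.space n) (extVolume F.pluckerRep n) := by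
  unfold extVolume
  split_ifs with h h0
  · have h1 : F.space n = F.sub ⟨n - 1, by omega⟩ := by
      rw [← space_succ]
      congr 1
      simp
      omega
    rw [h1]
    exact isVolume_rep_plucker _ _
  · subst h0
    exact isVolume_bot
  · rw [F.space_of_lt (by omega)]
    exact isVolume_rep_plucker _ _

/-- A linear projection of the exterior algebra onto its component of degree `n`. -/
def gradedProj (V : Type u) [AddCommGroup V] [Module ℂ V] (n : ℕ) :
    ExteriorAlgebra ℂ V →ₗ[ℂ] ⋀[ℂ]^n V :=
  (LinearMap.exists_leftInverse_of_injective (⋀[ℂ]^n V).subtype (Submodule.ker_subtype _)).choose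

theorem gradedProj_coe {V : Type u} [AddCommGroup V] [Module ℂ V] {n : ℕ} (x : ⋀[ℂ]^n V) :
    gradedProj V n x = x :=
  LinearMap.congr_fun (LinearMap.exists_leftInverse_of_injective (⋀[ℂ]^n V).subtype
    (Submodule.ker_subtype _)).choose_spec x

/-- The polynomial map `w ↦ (⋀_k w_{N(k, j)}^{(k)})_j` on Plücker coordinates. -/
def directSumLift (N : Fin d → Fin s → ℕ) (q : Fin s → ℕ) (w : Π i, ⋀[ℂ]^(p i) W) (j : Fin s) :
    ⋀[ℂ]^(q j) (Fin d → W) :=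
  gradedProj _ _ (copyWedge fun k => extVolume w (N k j))

theorem directSumLift_smul (N : Fin d → Fin s → ℕ) (c : Fin t → ℂ) (w : Π i, ⋀[ℂ]^(p i) W) :
    directSumLift N q (fun i => c i • w i) =
      fun j => (∏ k, extScalar c (N k j)) • directSumLift N q w j := by
  funext j
  simp only [directSumLift, extVolume_smul, copyWedge_smul, map_smul]

theorem dual_directSumLift_mem (N : Fin d → Fin s → ℕ) (j : Fin s)
    (ξ : Dual ℂ (⋀[ℂ]^(q j) (Fin d → W))) :
    (fun w => ξ (directSumLift N q w j)) ∈ polyAlgebra fun i => ⋀[ℂ]^(p i) W := by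
  have h : (fun w => copyWedge fun k => extVolume w (N k j)) ∈
      polyMapAlgebra (fun i => ⋀[ℂ]^(p i) W) (ExteriorAlgebra ℂ (Fin d → W)) := by
    have h0 : (fun w : Π i, ⋀[ℂ]^(p i) W => copyWedge fun k => extVolume w (N k j)) =
        (List.ofFn fun k w => ExteriorAlgebra.map (LinearMap.single ℂ (fun _ : Fin d => W) k)
          (extVolume w (N k j))).prod := by
      funext w
      rw [Pi.list_prod_apply, List.map_ofFn]
      rfl
    rw [h0]
    refine Subalgebra.list_prod_mem _ fun f hf => ?_
    obtain ⟨k, rfl⟩ := (List.mem_ofFn' _ _).1 hf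
    exact map_comp_mem_polyMapAlgebra (extVolume_mem (N k j)) 
      (ExteriorAlgebra.map (LinearMap.single ℂ (fun _ : Fin d => W) k)).toLinearMap
  exact dual_comp_mem_polyAlgebra h (ξ ∘ₗ gradedProj _ _)

/-- The effect of `directSumLift` on multidegrees of forms. -/
def pullDegree (t : ℕ) (N : Fin d → Fin s → ℕ) (a : Fin s → ℕ) : Fin t → ℕ :=
  ∑ j, a j • ∑ k, genDegree t (N k j)

/-- Rescaling `w_i` by `c_i` multiplies the `j`-th component of the lift by `∏_k c_{N(k, j)}`, where
scalars with index outside `1, …, t` count as `1`. -/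
theorem isForm_comp_directSumLift (N : Fin d → Fin s → ℕ) {a : Fin s → ℕ}
    {A : (Π j, ⋀[ℂ]^(q j) (Fin d → W)) → ℂ} (hA : IsForm a A) :
    IsForm (pullDegree t N a) (A ∘ directSumLift (p := p) N q) := by
  refine ⟨comp_mem_polyAlgebra (dual_directSumLift_mem N) hA.1, fun c w => ?_⟩
  rw [Function.comp_apply, directSumLift_smul, hA.2]
  congr 1
  simp only [extScalar_eq_prod, pullDegree, Finset.sum_apply, Pi.smul_apply, smul_eq_mul,
    ← Finset.prod_pow, ← pow_mul, ← Finset.prod_pow_eq_pow_sum, Finset.mul_sum]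
  simp only [Finset.prod_comm (s := (Finset.univ : Finset (Fin t)))]
  refine Finset.prod_congr rfl fun j _ => Finset.prod_congr rfl fun k _ =>
    Finset.prod_congr rfl fun i _ => by rw [mul_comm]

variable (N : Fin d → Fin s → ℕ) (hN : ∀ k, Monotone (N k))
    (hq : ∀ (F : FlagVariety W p) (j : Fin s),
      finrank ℂ (⨆ k, copy (F.space (N k j)) k : Submodule ℂ (Fin d → W)) = q j)

/-- In each component both sides are volume elements of the same direct sum. `gradedProj` only
transports the identity from the exterior algebra to its graded piece. -/
theorem exists_pluckerRep_directSum (F : FlagVariety W p) :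
    ∃ c : Fin s → ℂ, (∀ j, c j ≠ 0) ∧
      (directSum N hN hq F).pluckerRep = fun j => c j • directSumLift N q F.pluckerRep j := by
  have h : ∀ j, ∃ c : ℂ, c ≠ 0 ∧
      ((directSum N hN hq F).pluckerRep j : ExteriorAlgebra ℂ (Fin d → W)) =
        c • copyWedge fun k => extVolume F.pluckerRep (N k j) := fun j =>
    (isVolume_rep_plucker ((directSum N hN hq F).sub j) _).exists_eq_smul
      (isVolume_copyWedge fun k => isVolume_extVolume F (N k j))
  choose c hc h using h
  refine ⟨c, hc, funext fun j => ?_⟩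
  rw [directSumLift, ← map_smul, ← h, gradedProj_coe]

/-- Values of forms of multidegree `a` at the image of `F` are, up to a common nonzero factor, values
of their pull-backs at `F`. -/
theorem exists_value_directSum (F : FlagVariety W p) (a : Fin s → ℕ) : ∃ c : ℂ, c ≠ 0 ∧
    ∀ A : (Π j, ⋀[ℂ]^(q j) (Fin d → W)) → ℂ, IsForm a A →
      value A (directSum N hN hq F) = c * value (A ∘ directSumLift (p := p) N q) F := by
  obtain ⟨c, hc, h⟩ := exists_pluckerRep_directSum N hN hq F
  refine ⟨∏ j, c j ^ a j, Finset.prod_ne_zero_iff.2 fun j _ => pow_ne_zero _ (hc j),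
    fun A hA => ?_⟩
  change A (directSum N hN hq F).pluckerRep = _ * A (directSumLift N q F.pluckerRep)
  rw [h, hA.2]

/-- The morphism `F ↦ (⨁_k F_{N(k, j)}^{(k)})_j`. -/
def directSumMap : RegularMap (FlagVariety W p) (FlagVariety (Fin d → W) q) where
  toFun := directSum N hN hq
  continuous_toFun := by
    refine continuous_generateFrom_iff.2 ?_
    rintro _ ⟨a, B, hB, rfl⟩
    convert isOpen_value_ne_zero (isForm_comp_directSumLift (p := p) N hB) using 1
    ext F
    obtain ⟨c, hc, h⟩ := exists_value_directSum N hN hq F a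
    change value B (directSum N hN hq F) ≠ 0 ↔ value _ F ≠ 0
    rw [h B hB, mul_ne_zero_iff, and_iff_right hc]
  regular_comp := by
    rintro x f ⟨a, A, B, hA, hB, hx, hf⟩
    -- Numerator and denominator have the same multidegree, so the same factor `c` occurs in both
    -- and cancels.
    have key : ∀ F : FlagVariety W p, ∃ c : ℂ, c ≠ 0 ∧
        value A (directSum N hN hq F) = c * value (A ∘ directSumLift (p := p) N q) F ∧
        value B (directSum N hN hq F) = c * value (B ∘ directSumLift (p := p) N q) F := by
      intro F
      obtain ⟨c, hc, h⟩ := exists_value_directSum N hN hq F a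
      exact ⟨c, hc, h A hA, h B hB⟩
    refine ⟨_, _, _, isForm_comp_directSumLift (p := p) N hA,
      isForm_comp_directSumLift (p := p) N hB, ?_, fun y hy => ?_⟩
    · obtain ⟨c, hc, -, h⟩ := key x
      exact right_ne_zero_of_mul (h ▸ hx : c * value _ x ≠ 0)
    · obtain ⟨c, hc, h1, h2⟩ := key y
      have h3 : value B (directSum N hN hq y) ≠ 0 := h2 ▸ mul_ne_zero hc hy
      change f (directSum N hN hq y) = value _ y / value _ y
      rw [hf _ h3]
      change value A (directSum N hN hq y) / value B (directSum N hN hq y) = _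
      rw [h1, h2, mul_div_mul_left _ _ hc]

theorem IsTwist.pullback {a : Fin s → ℕ} {L : LineBundle (FlagVariety (Fin d → W) q)}
    (hL : IsTwist a L) : IsTwist (pullDegree t N a) (L.pullback (directSumMap N hN hq)) := by
  obtain ⟨B, hB, hL⟩ := hL
  refine ⟨fun x => B (directSum N hN hq x) ∘ directSumLift N q,
    fun x => isForm_comp_directSumLift N (hB _), fun x y z hz => ?_⟩
  obtain ⟨h1, h2⟩ := hL _ _ _ hz
  obtain ⟨c, hc, h⟩ := exists_value_directSum N hN hq z a
  change value (B (directSum N hN hq x)) (directSum N hN hq z) ≠ 0 at h1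
  change L.g (directSum N hN hq x) (directSum N hN hq y) (directSum N hN hq z) *
    value (B (directSum N hN hq x)) (directSum N hN hq z) =
    value (B (directSum N hN hq y)) (directSum N hN hq z) at h2
  rw [h _ (hB _)] at h1 h2
  rw [h _ (hB _), mul_left_comm] at h2
  exact ⟨right_ne_zero_of_mul h1, mul_left_cancel₀ hc h2⟩

theorem hasMultidegree_pullback_picGen (j : Fin s) :
    HasMultidegree (∑ k, genDegree t (N k j))
      (Pic.pullback (directSumMap N hN hq) (picGen (Fin d → W) q j)) := by
  obtain ⟨L, hL, h⟩ := hasMultidegree_picGen (W := Fin d → W) (d := q) j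
  have h1 : pullDegree t N (Pi.single j 1) = ∑ k, genDegree t (N k j) := by
    unfold pullDegree
    rw [Finset.sum_eq_single j (fun l _ hl => by rw [Pi.single_eq_of_ne hl, zero_smul])
      (fun h => absurd (Finset.mem_univ j) h), Pi.single_eq_same, one_smul]
  rw [← h, ← h1]
  exact ⟨_, hL.pullback N hN hq, rfl⟩

/-- Both sides have multidegree `∑ k, genDegree t (N k j)`, and the multidegree determines the
class. -/
theorem pullback_picGen_eq (j : Fin s) :
    Pic.pullback (directSumMap N hN hq) (picGen (Fin d → W) q j) =
      ∑ k, picGenExt W p (N k j) :=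
  (hasMultidegree_pullback_picGen N hN hq j).eq
    (HasMultidegree.sum _ fun k _ => hasMultidegree_picGenExt (N k j))

end DirectSum

end FlagVariety

/-! ### Independence of the preferred generators of the Picard group -/

section PolynomialFunctions

open Polynomial

theorem exists_polynomial_eval_eq {I : Type} {E : I → Type v} [∀ i, AddCommGroup (E i)]
    [∀ i, Module ℂ (E i)] {A : (Π i, E i) → ℂ} (hA : A ∈ polyAlgebra E) (x y : Π i, E i) :
    ∃ P : ℂ[X], ∀ τ, P.eval τ = A (x + τ • y) := by
  induction hA using Algebra.adjoin_induction with
  | mem f hf =>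
    obtain ⟨ξ, rfl⟩ := hf
    exact ⟨C (ξ x) + C (ξ y) * X, fun τ => by simp [mul_comm τ]⟩
  | algebraMap r => exact ⟨C r, fun τ => by simp⟩
  | add f g _ _ hf hg =>
    obtain ⟨P, hP⟩ := hf
    obtain ⟨Q, hQ⟩ := hg
    exact ⟨P + Q, fun τ => by simp [hP, hQ]⟩
  | mul f g _ _ hf hg =>
    obtain ⟨P, hP⟩ := hf
    obtain ⟨Q, hQ⟩ := hg
    exact ⟨P * Q, fun τ => by simp [hP, hQ]⟩

theorem Polynomial.eq_of_forall_ne_zero {P Q : ℂ[X]} (h : ∀ y ≠ 0, P.eval y = Q.eval y) :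
    P = Q := by
  refine Polynomial.eq_of_infinite_eval_eq P Q (Set.Infinite.mono (s := {0}ᶜ) h ?_)
  exact (Set.finite_singleton 0).infinite_compl

/-- If `P(τ) = F(1, τ)` and `R(τ) = F(τ, 1)` for a form `F` of degree `n` not vanishing at
`(0, 1)`, then `P` has degree `n`. -/
theorem Polynomial.natDegree_eq_of_dehomogenization {P R : ℂ[X]} {n : ℕ}
    (h : ∀ y ≠ 0, R.eval y = y ^ n * P.eval y⁻¹) (hR : R.eval 0 ≠ 0) :
    P ≠ 0 ∧ P.natDegree = n := by
  have hR0 : R ≠ 0 := by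
    rintro rfl
    simp at hR
  have hP0 : P ≠ 0 := by
    rintro rfl
    exact hR0 (eq_of_forall_ne_zero fun y hy => by simp [h y hy])
  refine ⟨hP0, ?_⟩
  -- Neither `R` nor the reverse of `P` vanishes at `0`, so comparing orders at `0` gives `deg P =
  -- n`.
  have h1 : X ^ P.natDegree * R = X ^ n * P.reverse := by
    refine eq_of_forall_ne_zero fun y hy => ?_
    have hinv : Invertible y⁻¹ := invertibleOfNonzero (inv_ne_zero hy)
    have h2 := eval₂_reverse_mul_pow (RingHom.id ℂ) y⁻¹ P
    rw [← eval, ← eval, invOf_eq_inv, inv_inv] at h2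
    rw [eval_mul, eval_mul, eval_pow, eval_pow, eval_X, h y hy, ← h2, inv_pow]
    field_simp
  have h2 := congrArg natTrailingDegree h1
  have h3 : P.reverse ≠ 0 := by simpa using hP0
  have h4 : R.natTrailingDegree = 0 := by
    rw [natTrailingDegree_eq_zero, coeff_zero_eq_eval_zero]
    exact Or.inr hR
  rw [mul_comm, natTrailingDegree_mul_X_pow hR0, mul_comm, natTrailingDegree_mul_X_pow h3,
    h4, natTrailingDegree_reverse] at h2
  omega

theorem Polynomial.natDegree_eq_of_rootMultiplicity_eq {P Q : ℂ[X]}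
    (h : ∀ x, P.rootMultiplicity x = Q.rootMultiplicity x) : P.natDegree = Q.natDegree := by
  rw [(IsAlgClosed.splits P).natDegree_eq_card_roots,
    (IsAlgClosed.splits Q).natDegree_eq_card_roots]
  congr 1
  ext x
  rw [count_roots, count_roots, h]

end PolynomialFunctions

namespace FlagVariety

section Independence

variable {W : Type u} [AddCommGroup W] [Module ℂ W] [FiniteDimensional ℂ W] {k : ℕ} {d : Fin k → ℕ}

theorem exists_value_ne_zero_subset {x : FlagVariety W d} {U : Set (FlagVariety W d)}
    (hU : IsOpen U) (hx : x ∈ U) :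
    ∃ (a : Fin k → ℕ) (G : (Π i, ⋀[ℂ]^(d i) W) → ℂ), IsForm a G ∧ value G x ≠ 0 ∧
      ∀ z, value G z ≠ 0 → z ∈ U := by
  have hbasis : TopologicalSpace.IsTopologicalBasis
      {U : Set (FlagVariety W d) | ∃ (a : Fin k → ℕ) (B : (Π i, ⋀[ℂ]^(d i) W) → ℂ),
        IsForm a B ∧ U = {x | value B x ≠ 0}} := by
    refine ⟨?_, ?_, rfl⟩
    · rintro _ ⟨a, B, hB, rfl⟩ _ ⟨a', B', hB', rfl⟩ y hy
      exact ⟨_, ⟨a + a', B * B', hB.mul hB', rfl⟩, mul_ne_zero hy.1 hy.2, fun z hz =>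
        ⟨left_ne_zero_of_mul hz, right_ne_zero_of_mul hz⟩⟩
    · exact Set.eq_univ_of_forall fun y =>
        ⟨_, ⟨0, fun _ => 1, IsForm.const 1, rfl⟩, one_ne_zero⟩
  obtain ⟨_, ⟨a, G, hG, rfl⟩, hxG, hsub⟩ := hbasis.exists_subset_of_mem_open hx hU
  exact ⟨a, G, hG, hxG, fun z hz => hsub hz⟩

/-- An isomorphism of line bundles of multidegrees `a` and `b` is a nowhere vanishing function that
is locally a quotient of forms whose multidegrees differ by `b - a`. -/
theorem IsTwist.exists_local_quotient {a b : Fin k → ℕ} {L M : LineBundle (FlagVariety W d)}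
    (hL : IsTwist a L) (hM : IsTwist b M) (h : L.Iso M) :
    ∃ σ : FlagVariety W d → ℂ, ∀ x, ∃ (ν δ : Fin k → ℕ) (N D : (Π i, ⋀[ℂ]^(d i) W) → ℂ),
      IsForm ν N ∧ IsForm δ D ∧ ν + a = δ + b ∧ value N x ≠ 0 ∧ value D x ≠ 0 ∧
      ∀ z, value N z ≠ 0 → value D z ≠ 0 → σ z * value D z = value N z := by
  obtain ⟨B, hB, hL⟩ := hL
  obtain ⟨C, hC, hM⟩ := hM
  obtain ⟨V, h, ho, hmem, hsub, hr, hc⟩ := h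
  -- The isomorphism is read off at `z` in the trivialisations attached to `z` itself. On `V x` the
  -- cocycle relation turns this into `h x * C x / B x`, hence locally a quotient of forms.
  refine ⟨fun z => h z z * value (C z) z / value (B z) z, fun x => ?_⟩
  obtain ⟨c, A, D, hA, hD, hDx, hh⟩ := (hr x x (hmem x)).1
  change value D x ≠ 0 at hDx
  have hAx : value A x ≠ 0 := by
    intro h0
    refine (hr x x (hmem x)).2 ((hh x hDx).trans ?_)
    change value A x / _ = 0
    rw [h0, zero_div]
  -- Multiplying numerator and denominator by `G` restricts the identity to points of `V x`, where
  -- the relation holds.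
  obtain ⟨g, G, hG, hGx, hGV⟩ := exists_value_ne_zero_subset (ho x) (hmem x)
  have hx1 := (hsub x (hmem x)).1
  have hx2 := (hsub x (hmem x)).2
  refine ⟨c + b + g, c + a + g, A * C x * G, D * B x * G, (hA.mul (hC x)).mul hG,
    (hD.mul (hB x)).mul hG, by abel, mul_ne_zero (mul_ne_zero hAx (hM x x x ⟨hx2, hx2⟩).1) hGx,
    mul_ne_zero (mul_ne_zero hDx (hL x x x ⟨hx1, hx1⟩).1) hGx, fun z hz hz' => ?_⟩
  have hzG : value G z ≠ 0 := right_ne_zero_of_mul hz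
  have hzV := hGV z hzG
  have hzD : value D z ≠ 0 := left_ne_zero_of_mul (left_ne_zero_of_mul hz')
  have h1 := hc x z z ⟨hzV, hmem z⟩
  have h2 := hL x z z ⟨(hsub x hzV).1, L.mem_nhd z⟩
  have h3 := hM x z z ⟨(hsub x hzV).2, M.mem_nhd z⟩
  have h4 := (hL z z z ⟨L.mem_nhd z, L.mem_nhd z⟩).1
  have h5 : h x z * value D z = value A z := by
    rw [hh z hzD]
    exact div_mul_cancel₀ _ hzD
  change h z z * value (C z) z / value (B z) z * (value D z * value (B x) z * value G z) =
    value A z * value (C x) z * value G z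
  have h6 : L.g x z z ≠ 0 := L.ne_zero x z z ⟨(hsub x hzV).1, L.mem_nhd z⟩
  have h7 := h2.1
  rw [← h2.2, ← h3.2, ← h5]
  field_simp
  linear_combination value (C x) z * h1

/-- The vector `w` consists of Plücker coordinates of the flag `z`. -/
def Represents (z : FlagVariety W d) (w : Π i, ⋀[ℂ]^(d i) W) : Prop :=
  ∃ c : Fin k → ℂ, (∀ i, c i ≠ 0) ∧ z.pluckerRep = fun i => c i • w i

theorem Represents.exists_value_eq {z : FlagVariety W d} {w : Π i, ⋀[ℂ]^(d i) W}
    (h : Represents z w) (a : Fin k → ℕ) :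
    ∃ c : ℂ, c ≠ 0 ∧ ∀ A, IsForm a A → value A z = c * A w := by
  obtain ⟨c, hc, h⟩ := h
  refine ⟨∏ i, c i ^ a i, Finset.prod_ne_zero_iff.2 fun i _ => pow_ne_zero _ (hc i),
    fun A hA => ?_⟩
  change A z.pluckerRep = _
  rw [h, hA.2]

theorem Represents.value_ne_zero_iff {z : FlagVariety W d} {w : Π i, ⋀[ℂ]^(d i) W}
    (h : Represents z w) {a : Fin k → ℕ} {A : (Π i, ⋀[ℂ]^(d i) W) → ℂ} (hA : IsForm a A) :
    value A z ≠ 0 ↔ A w ≠ 0 := by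
  obtain ⟨c, hc, h⟩ := h.exists_value_eq a
  rw [h A hA, mul_ne_zero_iff, and_iff_right hc]

theorem represents_of_isVolume {z : FlagVariety W d} {x : Fin k → ExteriorAlgebra ℂ W}
    (h : ∀ i, IsVolume (z.sub i) (x i)) : Represents z fun i => gradedProj W (d i) (x i) := by
  have h' := fun i => (isVolume_rep_plucker (z.sub i) (z.finrank_sub i)).exists_eq_smul (h i)
  choose c hc hx using h'
  refine ⟨c, hc, funext fun i => ?_⟩
  rw [← map_smul, ← hx i, gradedProj_coe]
  rfl

open Polynomial in
/-- Isomorphic line bundles have the same degree along a curve of flags whose `i`-th Plücker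
coordinates are `P₁ + τ P₂` and whose other Plücker coordinates are constant. -/
theorem IsTwist.eq_of_iso {a b : Fin k → ℕ} {L M : LineBundle (FlagVariety W d)}
    (hL : IsTwist a L) (hM : IsTwist b M) (h : L.Iso M) (i : Fin k)
    {P₀ P₁ P₂ : Π i, ⋀[ℂ]^(d i) W} (h₀ : P₀ i = 0) (h₁ : ∀ l ≠ i, P₁ l = 0)
    (h₂ : ∀ l ≠ i, P₂ l = 0) (hcurve : ∀ τ : ℂ, ∃ z, Represents z (P₀ + P₁ + τ • P₂))
    (hinf : ∃ z, Represents z (P₀ + P₂)) : a i = b i := by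
  obtain ⟨σ, hσ⟩ := hL.exists_local_quotient hM h
  choose ν δ N D hN hD hdeg hNx hDx hσ using hσ
  have hpoly : ∀ {c : Fin k → ℕ} {A : (Π i, ⋀[ℂ]^(d i) W) → ℂ}, IsForm c A →
      ∃ P : ℂ[X], ∀ τ, P.eval τ = A (P₀ + P₁ + τ • P₂) :=
    fun hA => exists_polynomial_eval_eq hA.1 _ _
  obtain ⟨z₀, hz₀⟩ := hinf
  -- On the line, `A` becomes a binary form of degree `c i`. If it does not vanish at infinity, its
  -- restriction to the affine part has full degree.
  have hinfdeg : ∀ {c : Fin k → ℕ} {A : (Π i, ⋀[ℂ]^(d i) W) → ℂ} {P : ℂ[X]}, IsForm c A →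
      (∀ τ, P.eval τ = A (P₀ + P₁ + τ • P₂)) → value A z₀ ≠ 0 → P ≠ 0 ∧ P.natDegree = c i := by
    intro c A P hA hP hA0
    obtain ⟨R, hR⟩ := exists_polynomial_eval_eq hA.1 (P₀ + P₂) P₁
    refine natDegree_eq_of_dehomogenization (R := R) (fun y hy => ?_) ?_
    · rw [hR, hP]
      have h1 := hA.2 (Pi.mulSingle i y) (P₀ + P₁ + y⁻¹ • P₂)
      have h2 : ∏ l, (Pi.mulSingle i y : Fin k → ℂ) l ^ c l = y ^ c i := by
        rw [Finset.prod_eq_single i (fun l _ hl => by rw [Pi.mulSingle_eq_of_ne hl, one_pow])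
          (fun h => absurd (Finset.mem_univ i) h), Pi.mulSingle_eq_same]
      rw [← h2, ← h1]
      congr 1
      funext l
      rcases eq_or_ne l i with rfl | hl
      · simp [h₀, smul_smul, hy, add_comm]
      · simp [h₁ l hl, h₂ l hl, Pi.mulSingle_eq_of_ne hl]
    · rw [hR, zero_smul, add_zero]
      exact (hz₀.value_ne_zero_iff hA).1 hA0
  -- The quotient chosen at the point at infinity is followed along the whole line. Once numerator
  -- and denominator have equal degrees, `ν z₀ i = δ z₀ i`, and the degree relation yields `a i = b
  -- i`.
  obtain ⟨PN, hPN⟩ := hpoly (hN z₀)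
  obtain ⟨PD, hPD⟩ := hpoly (hD z₀)
  obtain ⟨hPN0, hPNdeg⟩ := hinfdeg (hN z₀) hPN (hNx z₀)
  obtain ⟨hPD0, hPDdeg⟩ := hinfdeg (hD z₀) hPD (hDx z₀)
  -- At each finite point `σ` is also a quotient `QN / QD` of polynomials that are nonzero there, so
  -- `PN / PD` has neither zero nor pole.
  have hmult : ∀ τ, PN.rootMultiplicity τ = PD.rootMultiplicity τ := by
    intro τ₀
    obtain ⟨z, hz⟩ := hcurve τ₀
    obtain ⟨QN, hQN⟩ := hpoly (hN z)
    obtain ⟨QD, hQD⟩ := hpoly (hD z)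
    have hQNτ : QN.eval τ₀ ≠ 0 := by
      rw [hQN]
      exact (hz.value_ne_zero_iff (hN z)).1 (hNx z)
    have hQDτ : QD.eval τ₀ ≠ 0 := by
      rw [hQD]
      exact (hz.value_ne_zero_iff (hD z)).1 (hDx z)
    have hQN0 : QN ≠ 0 := by
      rintro rfl
      simp at hQNτ
    have hQD0 : QD ≠ 0 := by
      rintro rfl
      simp at hQDτ
    -- The two quotients agree only where all four polynomials are nonzero; the extra factor makes
    -- the identity hold for every `τ`.
    have hmul : (QN * PD - PN * QD) * (QN * QD * PN * PD) = 0 := by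
      refine Polynomial.funext fun τ => ?_
      by_cases h0 : (QN * QD * PN * PD).eval τ = 0
      · rw [eval_mul, h0, mul_zero, eval_zero]
      have h0' : (((QN.eval τ ≠ 0 ∧ QD.eval τ ≠ 0) ∧ PN.eval τ ≠ 0) ∧ PD.eval τ ≠ 0) := by
        simpa [not_or] using h0
      obtain ⟨⟨⟨h1, h2⟩, h3⟩, h4⟩ := h0'
      obtain ⟨y, hy⟩ := hcurve τ
      rw [hQN, ← hy.value_ne_zero_iff (hN z)] at h1
      rw [hQD, ← hy.value_ne_zero_iff (hD z)] at h2
      rw [hPN, ← hy.value_ne_zero_iff (hN z₀)] at h3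
      rw [hPD, ← hy.value_ne_zero_iff (hD z₀)] at h4
      have h5 := hσ z y h1 h2
      have h6 := hσ z₀ y h3 h4
      have hd : ν z + δ z₀ = ν z₀ + δ z := by
        have e1 := hdeg z
        have e2 := hdeg z₀
        funext l
        have e3 := congrFun e1 l
        have e4 := congrFun e2 l
        simp only [Pi.add_apply] at e3 e4 ⊢
        omega
      obtain ⟨c, hc, hval⟩ := hy.exists_value_eq (ν z + δ z₀)
      have h7 := hval _ ((hN z).mul (hD z₀))
      have h8 := hval _ (hd ▸ (hN z₀).mul (hD z))
      have h9 : value (N z * D z₀) y = value (N z₀ * D z) y := by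
        change value (N z) y * value (D z₀) y = value (N z₀) y * value (D z) y
        rw [← h5, ← h6]
        ring
      have h10 := mul_left_cancel₀ hc (h7.symm.trans (h9.trans h8))
      simp only [Pi.mul_apply] at h10
      rw [eval_mul, eval_sub, eval_mul, eval_mul, hQN, hQD, hPN, hPD, h10, sub_self, zero_mul,
        eval_zero]
    have heq : QN * PD = PN * QD := sub_eq_zero.1 <| (mul_eq_zero.1 hmul).resolve_right
      (mul_ne_zero (mul_ne_zero (mul_ne_zero hQN0 hQD0) hPN0) hPD0)
    have hroot := congrArg (rootMultiplicity τ₀) heq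
    rw [rootMultiplicity_mul (mul_ne_zero hQN0 hPD0), rootMultiplicity_mul (mul_ne_zero hPN0 hQD0),
      rootMultiplicity_eq_zero (p := QN) hQNτ, rootMultiplicity_eq_zero (p := QD) hQDτ] at hroot
    omega
  have hfin := natDegree_eq_of_rootMultiplicity_eq hmult
  have := congrFun (hdeg z₀) i
  simp only [Pi.add_apply] at this
  omega

end Independence

end FlagVariety

/-! ### Coordinate flags and curves through them -/

theorem IsVolume.map {V V' : Type u} [AddCommGroup V] [Module ℂ V] [AddCommGroup V'] [Module ℂ V']
    {M : Submodule ℂ V} {x : ExteriorAlgebra ℂ V} (h : IsVolume M x) (g : V ≃ₗ[ℂ] V') :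
    IsVolume (M.map (g : V →ₗ[ℂ] V')) (ExteriorAlgebra.map (g : V →ₗ[ℂ] V') x) := by
  obtain ⟨l, h1, h2, c, hc, rfl⟩ := h
  refine ⟨l.map (g : V →ₗ[ℂ] V'), ?_, ?_, c, hc, ?_⟩
  · rw [List.length_map, h1, LinearEquiv.finrank_map_eq]
  · rw [← h2, Submodule.map_span]
    congr 1
    ext v
    simp
  · rw [map_smul, map_wedge]

section CoordinateFlag

variable {W : Type u} [AddCommGroup W] [Module ℂ W] {m t : ℕ}

theorem isVolume_span_basis (e : Basis (Fin m) ℂ W) {S : Finset (Fin m)} {l : List (Fin m)}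
    (hl : l.Nodup) (hlS : l.toFinset = S) :
    IsVolume (Submodule.span ℂ (e '' (S : Set (Fin m)))) (wedge (l.map e)) := by
  subst hlS
  refine isVolume_wedge _ ?_ ?_
  · have h := finrank_span_eq_card (R := ℂ) (b := fun x : (l.toFinset : Set (Fin m)) => e x)
      (e.linearIndependent.comp _ Subtype.val_injective)
    rw [Set.image_eq_range, h, List.length_map]
    exact ((Fintype.card_coe _).trans (List.toFinset_card_of_nodup hl)).symm
  · congr 1
    ext v
    simp

/-- The flag `F` is spanned by basis vectors: its `i`-th member by the `e_r` of level at most `i`. -/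
def IsLevelFlag {p : Fin t → ℕ} (e : Basis (Fin m) ℂ W) (ℓ : Fin m → Fin (t + 1))
    (F : FlagVariety W p) : Prop :=
  ∀ i, F.sub i = Submodule.span ℂ (e '' {r | ℓ r ≤ i.castSucc})

variable {p : Fin t → ℕ} {e : Basis (Fin m) ℂ W} {ℓ : Fin m → Fin (t + 1)} {F : FlagVariety W p}

theorem IsLevelFlag.sub_ne_bot (hF : IsLevelFlag e ℓ F) (hℓ : Function.Surjective ℓ) (i : Fin t) :
    F.sub i ≠ ⊥ := by
  obtain ⟨r, hr⟩ := hℓ i.castSucc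
  intro h
  have h1 : e r ∈ F.sub i := by
    rw [hF i, e.apply_mem_span_image_iff]
    exact hr.le
  rw [h, Submodule.mem_bot] at h1
  exact e.ne_zero r h1

theorem IsLevelFlag.sub_ne_top (hF : IsLevelFlag e ℓ F) (hℓ : Function.Surjective ℓ) (i : Fin t) :
    F.sub i ≠ ⊤ := by
  obtain ⟨r, hr⟩ := hℓ (Fin.last t)
  intro h
  have h1 : e r ∈ F.sub i := h ▸ Submodule.mem_top
  rw [hF i, e.apply_mem_span_image_iff, Set.mem_ofPred_eq, hr] at h1
  exact (Fin.castSucc_lt_last i).not_ge h1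

theorem IsLevelFlag.space_eq (hF : IsLevelFlag e ℓ F) (n : ℕ) :
    F.space n = Submodule.span ℂ (e '' {r | (ℓ r : ℕ) < n}) := by
  rcases Nat.eq_zero_or_pos n with rfl | hn
  · simp
  rcases Nat.lt_or_ge t n with h | h
  · have h1 : {r | (ℓ r : ℕ) < n} = Set.univ := by
      ext r
      simp
      omega
    rw [F.space_of_lt h, h1, Set.image_univ, e.span_eq]
  · obtain ⟨i, rfl⟩ : ∃ i : Fin t, n = i + 1 := ⟨⟨n - 1, by omega⟩, by simp; omega⟩
    rw [FlagVariety.space_succ, hF i]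
    congr 2
    ext r
    simp [Fin.le_iff_val_le_val]

variable [FiniteDimensional ℂ W]

/-- Plücker coordinates of the image of a coordinate flag under a transformation that maps `e_q` to
`u e_q + v e_r`, where `e_q` and `e_r` have consecutive levels. -/
theorem IsLevelFlag.represents_smul (hF : IsLevelFlag e ℓ F) {i : Fin t} {q r : Fin m}
    (hq : ℓ q = i.castSucc) (hr : ℓ r = i.succ) {g : W ≃ₗ[ℂ] W} {v : W} (hgq : g (e q) = v)
    (hv : v ∈ Submodule.span ℂ {e q, e r})
    (hgr : g (e r) ∈ Submodule.span ℂ {e q, e r})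
    (hg : ∀ x, x ≠ q → x ≠ r → g (e x) = e x) :
    FlagVariety.Represents (g • F) fun l => FlagVariety.gradedProj W (p l)
      (if l = i then ExteriorAlgebra.ι ℂ v *
        wedge (((Finset.univ.filter fun x => ℓ x ≤ i.castSucc).erase q).toList.map e)
      else wedge ((Finset.univ.filter fun x => ℓ x ≤ l.castSucc).toList.map e)) := by
  have hcoe : ∀ l : Fin t, F.sub l = Submodule.span ℂ
      (e '' ((Finset.univ.filter fun x => ℓ x ≤ l.castSucc : Finset (Fin m)) : Set (Fin m))) := by
    intro l
    rw [hF l]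
    congr 2
    ext x
    simp
  refine FlagVariety.represents_of_isVolume fun l => ?_
  split_ifs with h
  · subst h
    have h1 := (isVolume_span_basis e (S := Finset.univ.filter fun x => ℓ x ≤ l.castSucc)
      (l := q :: ((Finset.univ.filter fun x => ℓ x ≤ l.castSucc).erase q).toList)
      (by simp [Finset.nodup_toList])
      (by
        rw [List.toFinset_cons, Finset.toList_toFinset, Finset.insert_erase]
        simp [hq])).map g
    rw [← hcoe] at h1
    convert h1 using 1
    · rfl
    rw [map_wedge, List.map_cons, List.map_cons, wedge, wedge, List.map_cons, List.prod_cons]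
    congr 1
    · rw [← hgq]
      rfl
    · congr 2
      rw [List.map_map]
      refine List.map_congr_left fun x hx => ?_
      rw [Finset.mem_toList, Finset.mem_erase, Finset.mem_filter] at hx
      refine (hg x hx.1 ?_).symm
      rintro rfl
      rw [hr] at hx
      exact (Fin.castSucc_lt_succ).not_ge hx.2.2
  -- Members below the `i`-th involve neither `e q` nor `e r`, and members above it contain both.
  · have h1 : (g • F).sub l = F.sub l := by
      rw [FlagVariety.smul_sub, map_eq_self_iff_map_le, hF l, Submodule.map_span,
        Submodule.span_le]
      rintro _ ⟨_, ⟨x, hx, rfl⟩, rfl⟩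
      change g (e x) ∈ Submodule.span ℂ (e '' {r | ℓ r ≤ l.castSucc})
      have hx' : e x ∈ Submodule.span ℂ (e '' {r | ℓ r ≤ l.castSucc}) :=
        Submodule.subset_span ⟨x, hx, rfl⟩
      by_cases hxqr : x = q ∨ x = r
      · have hil : i < l := by
          refine lt_of_le_of_ne ?_ (Ne.symm h)
          rcases hxqr with rfl | rfl
          · rw [Set.mem_ofPred_eq, hq] at hx
            simpa using hx
          · rw [Set.mem_ofPred_eq, hr] at hx
            exact Fin.le_iff_val_le_val.2 (by have := Fin.le_iff_val_le_val.1 hx; simp at this; omega)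
        have hle : Submodule.span ℂ {e q, e r} ≤ Submodule.span ℂ (e '' {r | ℓ r ≤ l.castSucc}) := by
          rw [Submodule.span_le]
          rintro _ (rfl | rfl)
          · refine Submodule.subset_span ⟨q, ?_, rfl⟩
            rw [Set.mem_ofPred_eq, hq]
            simpa using hil.le
          · refine Submodule.subset_span ⟨r, ?_, rfl⟩
            rw [Set.mem_ofPred_eq, hr]
            exact Fin.le_iff_val_le_val.2 (by simpa using hil)
        rcases hxqr with rfl | rfl
        · rw [hgq]
          exact hle hv
        · exact hle hgr
      · rw [not_or] at hxqr
        rwa [hg x hxqr.1 hxqr.2]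
    rw [h1, hcoe l]
    exact isVolume_span_basis e (Finset.nodup_toList _) (Finset.toList_toFinset _)

/-- The multidegree of a class in the Picard group of a flag variety is unique. -/
theorem IsLevelFlag.multidegree_unique (hF : IsLevelFlag e ℓ F) (hℓ : Function.Surjective ℓ)
    {a b : Fin t → ℕ} {P : Pic (FlagVariety W p)} (ha : FlagVariety.HasMultidegree a P)
    (hb : FlagVariety.HasMultidegree b P) : a = b := by
  obtain ⟨L, hL, rfl⟩ := ha
  obtain ⟨M, hM, h⟩ := hb
  have hiso : L.Iso M := Quotient.exact h.symm
  funext i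
  obtain ⟨q, hq⟩ := hℓ i.castSucc
  obtain ⟨r, hr⟩ := hℓ i.succ
  have hqr : q ≠ r := by
    rintro rfl
    exact (Fin.castSucc_lt_succ (i := i)).ne (hq.symm.trans hr)
  have hmemq : e q ∈ Submodule.span ℂ {e q, e r} := Submodule.subset_span (by simp)
  have hmemr : e r ∈ Submodule.span ℂ {e q, e r} := Submodule.subset_span (by simp)
  let R : ExteriorAlgebra ℂ W :=
    wedge (((Finset.univ.filter fun x => ℓ x ≤ i.castSucc).erase q).toList.map e)
  let P : Fin t → ExteriorAlgebra ℂ W := fun l =>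
    wedge ((Finset.univ.filter fun x => ℓ x ≤ l.castSucc).toList.map e)
  -- The `i`-th Plücker coordinate along the line is `(e_q + τ e_r) ∧ R`, with `e_r ∧ R` at
  -- infinity. The finite flags come from a transvection, the flag at infinity from the
  -- transposition of `e_q` and `e_r`.
  refine hL.eq_of_iso hM hiso i
    (P₀ := fun l => if l = i then 0 else FlagVariety.gradedProj W (p l) (P l))
    (P₁ := fun l => if l = i then FlagVariety.gradedProj W (p l) (ExteriorAlgebra.ι ℂ (e q) * R) else 0)
    (P₂ := fun l => if l = i then FlagVariety.gradedProj W (p l) (ExteriorAlgebra.ι ℂ (e r) * R) else 0)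
    (if_pos rfl) (fun l hl => if_neg hl) (fun l hl => if_neg hl) (fun τ => ?_) ?_
  · let g : W ≃ₗ[ℂ] W := LinearEquiv.dilatransvection (f := e.coord q) (v := τ • e r)
      (by simp [Finsupp.single_eq_of_ne hqr])
    have hg : ∀ x, g (e x) = e x + e.coord q (e x) • τ • e r := fun x =>
      LinearEquiv.dilatransvection.apply
    have h1 := hF.represents_smul hq hr (g := g) (v := e q + τ • e r) (by rw [hg]; simp)
      (add_mem hmemq (Submodule.smul_mem _ _ hmemr))
      (by rw [hg]; simpa [Finsupp.single_eq_of_ne hqr] using hmemr)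
      (fun x hx _ => by rw [hg]; simp [Finsupp.single_eq_of_ne hx.symm])
    refine ⟨g • F, ?_⟩
    convert h1 using 1
    funext l
    simp only [Pi.add_apply, Pi.smul_apply]
    split_ifs with h
    · rw [map_add, map_smul, add_mul, smul_mul_assoc, map_add, map_smul, zero_add]
    · simp [P]
  · let g : W ≃ₗ[ℂ] W := e.equiv e (Equiv.swap q r)
    have hg : ∀ x, g (e x) = e (Equiv.swap q r x) := fun x => e.equiv_apply x e _
    have h1 := hF.represents_smul hq hr (g := g) (v := e r) (by rw [hg]; simp)
      hmemr (by rw [hg]; simpa using hmemq)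
      (fun x hx hx' => by rw [hg, Equiv.swap_apply_of_ne_of_ne hx hx'])
    refine ⟨g • F, ?_⟩
    convert h1 using 1
    funext l
    simp only [Pi.add_apply]
    split_ifs with h
    · rw [zero_add]
    · simp [P]

end CoordinateFlag

/-! ### Standard extensions -/

section StandardExtension

variable {W : Type u} [AddCommGroup W] [Module ℂ W] {d s t : ℕ} {p : Fin t → ℕ}

/-- The sum of the copies of `W` with indices in a set. -/
def copySum (W : Type u) [AddCommGroup W] [Module ℂ W] {d : ℕ} (T : Set (Fin d)) :
    Submodule ℂ (Fin d → W) :=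
  ⨆ k, copy (⨆ _ : k ∈ T, ⊤) k

theorem mem_copySum {T : Set (Fin d)} {v : Fin d → W} : v ∈ copySum W T ↔ ∀ k ∉ T, v k = 0 := by
  rw [copySum, mem_iSup_copy]
  refine forall_congr' fun k => ?_
  by_cases h : k ∈ T <;> simp [h]

theorem copySum_mono {S T : Set (Fin d)} (h : S ⊆ T) : copySum W S ≤ copySum W T := fun v hv =>
  mem_copySum.2 fun k hk => mem_copySum.1 hv k fun hk' => hk (h hk')

theorem copySum_injective [Nontrivial W] : Function.Injective (copySum W (d := d)) := by
  obtain ⟨w, hw⟩ := exists_ne (0 : W)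
  intro S T h
  ext k
  have key : ∀ T : Set (Fin d), k ∈ T ↔ Pi.single k w ∈ copySum W T := by
    intro T
    rw [mem_copySum]
    constructor
    · intro hk l hl
      refine Pi.single_eq_of_ne ?_ _
      rintro rfl
      exact hl hk
    · intro h'
      by_contra hk
      exact hw (by simpa using h' k hk)
  rw [key S, key T, h]

theorem finrank_copySum [FiniteDimensional ℂ W] (T : Set (Fin d)) :
    finrank ℂ (copySum W T) = T.ncard * finrank ℂ W := by
  classical
  rw [copySum, finrank_iSup_copy, Set.ncard_eq_toFinset_card', ← Set.filter_mem_univ_eq_toFinset,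
    Finset.card_filter, Finset.sum_mul]
  refine Finset.sum_congr rfl fun k _ => ?_
  by_cases h : k ∈ T
  · rw [if_pos h, one_mul, iSup_pos h, finrank_top]
  · rw [if_neg h, zero_mul, iSup_neg h, finrank_bot]

/-- Some flag has only proper nonzero members. -/
def HasProperFlag (W : Type u) [AddCommGroup W] [Module ℂ W] (p : Fin t → ℕ) : Prop :=
  ∃ F : FlagVariety W p, ∀ i, F.sub i ≠ ⊥ ∧ F.sub i ≠ ⊤

namespace FlagVariety

/-- Proper members have no common nonzero vector because of transitivity on nonzero vectors. The
right-hand side encodes `W` or `0` in the form used by `copySum`. -/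
theorem iInf_space (h : HasProperFlag W p) (n : ℕ) :
    ⨅ F : FlagVariety W p, F.space n = ⨆ _ : t < n, ⊤ := by
  obtain ⟨F₀, hF₀⟩ := h
  rcases Nat.eq_zero_or_pos n with rfl | hn
  · have : Nonempty (FlagVariety W p) := ⟨F₀⟩
    simp
  rcases Nat.lt_or_ge t n with h | h
  · simp [h, space_of_lt]
  · rw [iSup_neg h.not_gt]
    obtain ⟨i, rfl⟩ : ∃ i : Fin t, n = i + 1 := ⟨⟨n - 1, by omega⟩, by simp; omega⟩
    simp only [space_succ]
    exact iInf_sub_eq_bot F₀ (hF₀ i).2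

theorem iSup_space (h : HasProperFlag W p) (n : ℕ) :
    ⨆ F : FlagVariety W p, F.space n = ⨆ _ : 1 ≤ n, ⊤ := by
  obtain ⟨F₀, hF₀⟩ := h
  rcases Nat.eq_zero_or_pos n with rfl | hn
  · simp
  rw [iSup_pos (show 1 ≤ n from hn)]
  rcases Nat.lt_or_ge t n with h | h
  · have : Nonempty (FlagVariety W p) := ⟨F₀⟩
    simp [h, space_of_lt]
  · obtain ⟨i, rfl⟩ : ∃ i : Fin t, n = i + 1 := ⟨⟨n - 1, by omega⟩, by simp; omega⟩
    simp only [space_succ]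
    exact iSup_sub_eq_top F₀ (hF₀ i).1

theorem iInf_directSum (h : HasProperFlag W p) (n : Fin d → ℕ) :
    ⨅ F : FlagVariety W p, ⨆ k, copy (F.space (n k)) k = copySum W {k | t < n k} := by
  unfold copySum
  ext v
  simp only [Submodule.mem_iInf, mem_iSup_copy, Set.mem_ofPred_eq, ← iInf_space h]
  exact forall_comm

theorem iSup_directSum (h : HasProperFlag W p) (n : Fin d → ℕ) :
    ⨆ F : FlagVariety W p, ⨆ k, copy (F.space (n k)) k = copySum W {k | 1 ≤ n k} := by
  unfold copySum
  simp only [Set.mem_ofPred_eq, ← iSup_space h, copy, Submodule.map_iSup]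
  exact iSup_comm

end FlagVariety

/-- For `1 ≤ n ≤ t` the intersection is `Z'` and the sum is `U' ⊔ Z'`; for other `n` the subspace
does not depend on the flag. -/
theorem iInf_iSup_of_standard [FiniteDimensional ℂ W] {U : Type u} [AddCommGroup U] [Module ℂ U]
    [FiniteDimensional ℂ U]
    (h : HasProperFlag W p) {U' Z Z' : Submodule ℂ U} (hUZ : IsCompl U' Z) (hZ : Z' ≤ Z)
    (ε : W ≃ₗ[ℂ] U') (n : ℕ) (D : FlagVariety W p → Submodule ℂ U)
    (hD : ∀ F, D F = (F.space n).map (U'.subtype ∘ₗ (ε : W →ₗ[ℂ] U')) ⊔ Z') :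
    ⨅ F, D F = ⨆ F, D F ∨ (⨅ F, D F ≤ Z ∧ U' ≤ ⨆ F, D F ∧
      finrank ℂ (⨆ F, D F : Submodule ℂ U) = finrank ℂ W + finrank ℂ (⨅ F, D F : Submodule ℂ U)) := by
  have hne : Nonempty (FlagVariety W p) := ⟨h.choose⟩
  by_cases hn : 1 ≤ n ∧ n ≤ t
  · right
    have hinf : ⨅ F, D F = Z' := by
      refine le_antisymm (fun x hx => ?_) (le_iInf fun F => hD F ▸ le_sup_right)
      have hx' : ∀ F : FlagVariety W p, ∃ w ∈ F.space n, ∃ z ∈ Z', (ε w : U) + z = x := by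
        intro F
        have h1 := (Submodule.mem_iInf _).1 hx F
        rw [hD F, Submodule.mem_sup] at h1
        obtain ⟨_, ⟨w, hw, rfl⟩, z, hz, h2⟩ := h1
        exact ⟨w, hw, z, hz, h2⟩
      choose w hw z hz hwz using hx'
      -- The decomposition along `U'` and `Z` is unique, so one vector `w` lies in the `n`-th member
      -- of every flag and must vanish.
      have hconst : ∀ F F', w F = w F' := by
        intro F F'
        have h1 : (ε (w F) : U) - ε (w F') = z F' - z F := by
          rw [sub_eq_sub_iff_add_eq_add, hwz F, add_comm, hwz F']
        have h2 : (ε (w F) : U) - ε (w F') ∈ U' ⊓ Z :=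
          ⟨sub_mem (ε (w F)).2 (ε (w F')).2, h1 ▸ hZ (sub_mem (hz F') (hz F))⟩
        rw [hUZ.inf_eq_bot, Submodule.mem_bot, sub_eq_zero] at h2
        exact ε.injective (Subtype.ext h2)
      obtain ⟨F⟩ := hne
      have h0 : w F ∈ ⨅ F : FlagVariety W p, F.space n :=
        (Submodule.mem_iInf _).2 fun F' => hconst F' F ▸ hw F'
      rw [FlagVariety.iInf_space h, iSup_neg (by omega), Submodule.mem_bot] at h0
      have h1 := hwz F
      rw [h0, map_zero, Submodule.coe_zero, zero_add] at h1
      exact h1 ▸ hz F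
    have hsup : ⨆ F, D F = U' ⊔ Z' := by
      simp only [hD]
      rw [← iSup_sup, ← Submodule.map_iSup, FlagVariety.iSup_space h, iSup_pos hn.1,
        Submodule.map_comp, Submodule.map_top, LinearEquiv.range, Submodule.map_subtype_top]
    have hdisj : U' ⊓ Z' = ⊥ := (hUZ.disjoint.mono_right hZ).eq_bot
    rw [hinf, hsup]
    refine ⟨hZ, le_sup_left, ?_⟩
    have h1 := Submodule.finrank_sup_add_finrank_inf_eq U' Z'
    rw [hdisj, finrank_bot, add_zero, ← ε.finrank_eq] at h1
    exact h1
  · left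
    have hconst : ∀ F F' : FlagVariety W p, F.space n = F'.space n := by
      intro F F'
      rcases Nat.eq_zero_or_pos n with rfl | hn'
      · simp
      · rw [F.space_of_lt (by omega), F'.space_of_lt (by omega)]
    have hD' : ∀ F, D F = D h.choose := fun F => by rw [hD, hD, hconst]
    simp only [hD', ciInf_const, ciSup_const]

/-- The combinatorial obstruction shared by strict standard extensions and their duals. -/
theorem active_unique_of_copySum [Nontrivial W] [FiniteDimensional ℂ W] {N : Fin d → Fin s → ℕ}
    (hN : ∀ k, Monotone (N k))
    (hdim : ∀ j c, 1 ≤ N c j → N c j ≤ t → finrank ℂ (copySum W {k | 1 ≤ N k j}) =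
      finrank ℂ W + finrank ℂ (copySum W {k | t < N k j}))
    (hle : ∀ j l c c', 1 ≤ N c j → N c j ≤ t → 1 ≤ N c' l → N c' l ≤ t →
      ¬ copySum W {k | 1 ≤ N k j} ≤ copySum W {k | t < N k l})
    {c c' : Fin d} {j j' : Fin s} (hc : 1 ≤ N c j ∧ N c j ≤ t)
    (hc' : 1 ≤ N c' j' ∧ N c' j' ≤ t) : c = c' := by
  -- The two dimensions differ by `dim W` times the number of active colours at `j`, so this number
  -- is one.
  have hone : ∀ j c c', 1 ≤ N c j ∧ N c j ≤ t → 1 ≤ N c' j ∧ N c' j ≤ t → c = c' := by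
    intro j c c' hc hc'
    have h1 := hdim j c hc.1 hc.2
    rw [finrank_copySum, finrank_copySum] at h1
    have h2 : {k | 1 ≤ N k j}.ncard = 1 + {k | t < N k j}.ncard :=
      Nat.eq_of_mul_eq_mul_right (finrank_pos (R := ℂ) (M := W)) (by rw [h1, add_mul, one_mul])
    have hsub : {k | t < N k j} ⊆ {k | 1 ≤ N k j} := fun k (hk : t < N k j) => Nat.one_le_of_lt hk
    have h3 := Set.ncard_sdiff_add_ncard_of_subset hsub
    have h4 : ({k | 1 ≤ N k j} \ {k | t < N k j}).ncard ≤ 1 := by omega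
    exact (Set.ncard_le_one (Set.toFinite _)).1 h4 c ⟨hc.1, hc.2.not_gt⟩ c' ⟨hc'.1, hc'.2.not_gt⟩
  have key : ∀ c c' j j', 1 ≤ N c j ∧ N c j ≤ t → 1 ≤ N c' j' ∧ N c' j' ≤ t → j ≤ j' → c = c' := by
    intro c c' j j' hc hc' hjj'
    by_contra hne
    -- A colour present at `j` but not full at `j'` is active at both places, hence equals `c` and
    -- `c'`. If these differ, every colour present at `j` is full at `j'`, which is the forbidden
    -- inclusion.
    refine hle j j' c c' hc.1 hc.2 hc'.1 hc'.2 (copySum_mono fun k hk => ?_)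
    have hk1 : 1 ≤ N k j := hk
    have hk2 := hN k hjj'
    by_contra hk3
    have hk4 : N k j' ≤ t := not_lt.1 hk3
    exact hne ((hone j c k hc ⟨hk1, hk2.trans hk4⟩).trans
      (hone j' k c' ⟨hk1.trans hk2, hk4⟩ hc'))
  rcases le_total j j' with h | h
  · exact key c c' j j' hc hc' h
  · exact (key c' c j' j hc' hc h).symm

variable {q : Fin s → ℕ}

theorem IsStrictStandardExtension.exists_iInf_iSup [Nontrivial W] [FiniteDimensional ℂ W]
    {U : Type u} [AddCommGroup U] [Module ℂ U] [FiniteDimensional ℂ U] (h : HasProperFlag W p)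
    {φ : FlagVariety W p → FlagVariety U q} (hφ : IsStrictStandardExtension φ) :
    ∃ U' Z : Submodule ℂ U, ¬ U' ≤ Z ∧ ∀ j, ⨅ F, (φ F).sub j ≠ ⨆ F, (φ F).sub j →
      (⨅ F, (φ F).sub j ≤ Z ∧ U' ≤ ⨆ F, (φ F).sub j ∧
        finrank ℂ (⨆ F, (φ F).sub j : Submodule ℂ U) =
          finrank ℂ W + finrank ℂ (⨅ F, (φ F).sub j : Submodule ℂ U)) := by
  obtain ⟨U', Z, ε, Zs, κ, hUZ, -, hZs, -, hF⟩ := hφ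
  refine ⟨U', Z, fun hle => ?_, fun j hj => ?_⟩
  · obtain ⟨w, hw⟩ := exists_ne (0 : W)
    have h1 := hUZ.disjoint.eq_bot_of_le hle
    have h2 : (ε w : U) = 0 := (Submodule.mem_bot ℂ).1 (h1.le (ε w).2)
    exact hw (by simpa using h2)
  · exact (iInf_iSup_of_standard h hUZ (hZs j) ε (κ j) (fun F => (φ F).sub j)
      (fun F => hF F j)).resolve_left hj

theorem active_unique_of_isStandardExtension [Nontrivial W] [FiniteDimensional ℂ W]
    (h : HasProperFlag W p) {N : Fin d → Fin s → ℕ} (hN : ∀ k, Monotone (N k))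
    {φ : FlagVariety W p → FlagVariety (Fin d → W) q}
    (hφ : ∀ F j, (φ F).sub j = ⨆ k, copy (F.space (N k j)) k) (hstd : IsStandardExtension φ)
    {c c' : Fin d} {j j' : Fin s} (hc : 1 ≤ N c j ∧ N c j ≤ t)
    (hc' : 1 ≤ N c' j' ∧ N c' j' ≤ t) : c = c' := by
  have hne : ∀ j c, 1 ≤ N c j → N c j ≤ t →
      copySum W {k | t < N k j} ≠ copySum W {k | 1 ≤ N k j} := by
    intro j c h1 h2 h3
    have h4 : c ∈ {k | t < N k j} := copySum_injective h3 ▸ h1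
    exact (h4 : t < N c j).not_ge h2
  have hinf : ∀ j, ⨅ F, (φ F).sub j = copySum W {k | t < N k j} := fun j => by
    simp only [hφ]
    exact FlagVariety.iInf_directSum h _
  have hsup : ∀ j, ⨆ F, (φ F).sub j = copySum W {k | 1 ≤ N k j} := fun j => by
    simp only [hφ]
    exact FlagVariety.iSup_directSum h _
  rcases hstd with hstd | hstd
  · obtain ⟨U', Z, hUZ, key⟩ := hstd.exists_iInf_iSup h
    have key' : ∀ j c, 1 ≤ N c j → N c j ≤ t →
        copySum W {k | t < N k j} ≤ Z ∧ U' ≤ copySum W {k | 1 ≤ N k j} ∧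
        finrank ℂ (copySum W {k | 1 ≤ N k j}) =
          finrank ℂ W + finrank ℂ (copySum W {k | t < N k j}) := by
      intro j c h1 h2
      have h3 := key j
      rw [hinf, hsup] at h3
      exact h3 (hne j c h1 h2)
    exact active_unique_of_copySum hN (fun j c h1 h2 => (key' j c h1 h2).2.2)
      (fun j l c c' h1 h2 h3 h4 hle => hUZ
        ((key' j c h1 h2).2.1.trans (hle.trans (key' l c' h3 h4).1))) hc hc'
  · obtain ⟨U', Z, hUZ, key⟩ := hstd.exists_iInf_iSup h
    -- Annihilators exchange intersections with sums and reverse the indices; the obstruction then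
    -- applies with the inclusions reversed.
    have hann : ∀ j : Fin s, ⨅ F, ((φ F).duality).sub j =
        (copySum W {k | 1 ≤ N k j.rev}).dualAnnihilator := by
      intro j
      rw [← hsup, Submodule.dualAnnihilator_iSup_eq]
      rfl
    have hann' : ∀ j : Fin s, ⨆ F, ((φ F).duality).sub j =
        (copySum W {k | t < N k j.rev}).dualAnnihilator := by
      intro j
      change ⨆ F, ((φ F).sub j.rev).dualAnnihilator = _
      rw [← Subspace.dualCoannihilator_dualAnnihilator_eq
        (W := ⨆ F, ((φ F).sub j.rev).dualAnnihilator), Submodule.dualCoannihilator_iSup_eq, ← hinf]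
      simp only [Subspace.dualAnnihilator_dualCoannihilator_eq]
    have key' : ∀ j c, 1 ≤ N c j → N c j ≤ t →
        (copySum W {k | 1 ≤ N k j}).dualAnnihilator ≤ Z ∧
        U' ≤ (copySum W {k | t < N k j}).dualAnnihilator ∧
        finrank ℂ (copySum W {k | t < N k j}).dualAnnihilator =
          finrank ℂ W + finrank ℂ (copySum W {k | 1 ≤ N k j}).dualAnnihilator := by
      intro j c h1 h2
      have h3 := key j.rev
      rw [hann, hann', Fin.rev_rev] at h3
      exact h3 fun h' => hne j c h1 h2 (Subspace.dualAnnihilator_inj.1 h'.symm)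
    refine active_unique_of_copySum hN (fun j c h1 h2 => ?_)
      (fun j l c c' h1 h2 h3 h4 hle => hUZ ((key' l c' h3 h4).2.1.trans
        ((Submodule.dualAnnihilator_anti hle).trans (key' j c h1 h2).1))) hc hc'
    have e1 := Subspace.finrank_add_finrank_dualAnnihilator_eq (copySum W {k | 1 ≤ N k j})
    have e2 := Subspace.finrank_add_finrank_dualAnnihilator_eq (copySum W {k | t < N k j})
    have e3 := (key' j c h1 h2).2.2
    omega

theorem isStrictStandardExtension_of_active_unique {N : Fin d → Fin s → ℕ}
    (hN : ∀ k, Monotone (N k)) (hNt : ∀ k j, N k j ≤ t + 1)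
    {φ : FlagVariety W p → FlagVariety (Fin d → W) q}
    (hφ : ∀ F j, (φ F).sub j = ⨆ k, copy (F.space (N k j)) k) (c : Fin d)
    (hc : ∀ k j, 1 ≤ N k j → N k j ≤ t → k = c) : IsStrictStandardExtension φ := by
  let f : W →ₗ[ℂ] (Fin d → W) := LinearMap.single ℂ (fun _ : Fin d => W) c
  have hf : Function.Injective f := Pi.single_injective (M := fun _ : Fin d => W) c
  -- The moving part is the copy of `W` of colour `c` and `Z` is the sum of the other copies. Since
  -- these are never active, each is either absent or whole, and `Z_j` collects those present at
  -- `j`.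
  refine ⟨LinearMap.range f, copySum W {k | k ≠ c}, LinearEquiv.ofInjective f hf,
    fun j => copySum W {k | k ≠ c ∧ 1 ≤ N k j}, fun j => ⟨N c j, by have := hNt c j; omega⟩,
    ⟨?_, ?_⟩, ?_, ?_, ?_, ?_⟩
  · rw [Submodule.disjoint_def]
    rintro _ ⟨w, rfl⟩ hw
    have h1 := mem_copySum.1 hw c (by simp)
    have h2 : w = 0 := by simpa [f] using h1
    rw [h2, map_zero]
  · rw [codisjoint_iff, eq_top_iff]
    intro v _
    rw [← add_sub_cancel (f (v c)) v]
    refine Submodule.add_mem_sup ⟨_, rfl⟩ (mem_copySum.2 fun k hk => ?_)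
    obtain rfl : k = c := by simpa using hk
    simp [f]
  · intro j j' h
    exact copySum_mono fun k hk => ⟨hk.1, hk.2.trans (hN k h)⟩
  · exact fun j => copySum_mono fun k hk => hk.1
  · exact fun j j' h => hN c h
  · intro F j
    rw [hφ]
    have h1 : (F.space (N c j)).map ((LinearMap.range f).subtype ∘ₗ
        (LinearEquiv.ofInjective f hf : W →ₗ[ℂ] LinearMap.range f)) =
        copy (F.space (N c j)) c := rfl
    change _ = Submodule.map _ (F.space (N c j)) ⊔ _
    rw [h1]
    refine le_antisymm (iSup_le fun k => ?_) (sup_le (le_iSup (fun k => copy (F.space (N k j)) k) c)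
      fun v hv => mem_iSup_copy.2 fun k => ?_)
    · rcases eq_or_ne k c with rfl | hk
      · exact le_sup_left
      · refine le_trans ?_ le_sup_right
        rintro _ ⟨w, hw, rfl⟩
        refine mem_copySum.2 fun l hl => ?_
        rcases eq_or_ne l k with rfl | hlk
        · have h0 : N l j = 0 := by
            by_contra h0
            exact hl ⟨hk, Nat.one_le_iff_ne_zero.2 h0⟩
          rw [h0] at hw
          have hw0 : w = 0 := by simpa using hw
          simp [hw0]
        · exact Pi.single_eq_of_ne (M := fun _ : Fin d => W) hlk w
    · by_cases hk : k ≠ c ∧ 1 ≤ N k j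
      · rw [F.space_of_lt (not_le.1 fun h => hk.1 (hc k j hk.2 h))]
        exact Submodule.mem_top
      · rw [mem_copySum.1 hv k hk]
        exact zero_mem _

end StandardExtension

/-! ### Linearity -/

theorem FlagVariety.sum_genDegree (t n : ℕ) :
    ∑ i, genDegree t n i = if 1 ≤ n ∧ n ≤ t then 1 else 0 := by
  unfold genDegree
  split_ifs with h
  · rw [Finset.sum_eq_single ⟨n - 1, by omega⟩]
    · rw [if_pos (by simp; omega)]
    · intro i _ hi
      rw [if_neg]
      rintro rfl
      exact hi (Fin.ext (by simp))
    · exact fun h => absurd (Finset.mem_univ _) h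
  · exact Finset.sum_eq_zero fun i _ => if_neg (by omega)

section Linear

variable {W : Type u} [AddCommGroup W] [Module ℂ W] [FiniteDimensional ℂ W] {m d s t : ℕ}
  {p : Fin t → ℕ} {q : Fin s → ℕ}

/-- The total degree of the pull-back counts the active colours, while `0` and a generator have
total degrees `0` and `1`. Uniqueness of the multidegree gives one direction; in the other, at most
one summand of the pull-back formula survives. -/
theorem IsLevelFlag.isLinearMorphism_directSumMap_iff {e : Basis (Fin m) ℂ W}
    {ℓ : Fin m → Fin (t + 1)} {F : FlagVariety W p} (hF : IsLevelFlag e ℓ F)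
    (hℓ : Function.Surjective ℓ) (N : Fin d → Fin s → ℕ) (hN : ∀ k, Monotone (N k))
    (hq : ∀ (F : FlagVariety W p) (j : Fin s),
      finrank ℂ (⨆ k, copy (F.space (N k j)) k : Submodule ℂ (Fin d → W)) = q j) :
    IsLinearMorphism (FlagVariety.directSumMap N hN hq) ↔
      ∀ j c c', 1 ≤ N c j ∧ N c j ≤ t → 1 ≤ N c' j ∧ N c' j ≤ t → c = c' := by
  constructor
  · intro h j c c' hc hc'
    have h1 := FlagVariety.hasMultidegree_pullback_picGen N hN hq j
    have htotal : ∑ i, (∑ k, FlagVariety.genDegree t (N k j)) i =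
        (Finset.univ.filter fun k => 1 ≤ N k j ∧ N k j ≤ t).card := by
      simp only [Finset.sum_apply]
      rw [Finset.sum_comm, Finset.card_filter]
      exact Finset.sum_congr rfl fun k _ => FlagVariety.sum_genDegree t (N k j)
    have hcard : (Finset.univ.filter fun k => 1 ≤ N k j ∧ N k j ≤ t).card ≤ 1 := by
      rw [← htotal]
      rcases h j with h2 | ⟨i, h2⟩
      · rw [h2] at h1
        rw [hF.multidegree_unique hℓ h1 FlagVariety.hasMultidegree_zero]
        simp
      · rw [h2] at h1
        rw [hF.multidegree_unique hℓ h1 (FlagVariety.hasMultidegree_picGen i)]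
        simp
    exact Finset.card_le_one.1 hcard c (by simpa using hc) c' (by simpa using hc')
  · intro h j
    rw [FlagVariety.pullback_picGen_eq]
    by_cases hj : ∃ c, 1 ≤ N c j ∧ N c j ≤ t
    · obtain ⟨c, hc⟩ := hj
      right
      refine ⟨⟨N c j - 1, by omega⟩, ?_⟩
      rw [Finset.sum_eq_single c]
      · exact dif_pos hc
      · exact fun k _ hk => dif_neg fun hk' => hk (h j k c hk' hc)
      · exact fun h => absurd (Finset.mem_univ _) h
    · left
      exact Finset.sum_eq_zero fun k _ => dif_neg fun hk => hj ⟨k, hk⟩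

end Linear

/-! ### The flags `𝓕_α` and `𝓕_β` -/

section FlagsAlphaBeta

variable {W : Type u} [AddCommGroup W] [Module ℂ W] {m d s t : ℕ} {e : Basis (Fin m) ℂ W}
  {α : Fin d × Fin m → Fin (s + 1)} {b : Fin (t + 1) → Fin d → Fin (s + 1)}

theorem isLevelFlag_flagBeta (hb : StrictMono b) {ℓ : Fin m → Fin (t + 1)}
    (hℓ : ∀ r, b (ℓ r) = beta α r) : IsLevelFlag e ℓ (flagBeta e α b hb) := by
  intro i
  change Submodule.span ℂ (e '' (betaSets α b i : Set (Fin m))) = _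
  congr 2
  ext r
  simp [betaSets, ← hℓ, hb.le_iff_le]

/-- Here `ℓ r` is the position of `β(r)` in the list `b`, so `α(k, r) ≤ j` holds exactly when `ℓ r`
is below the index `i'_k(j)`. -/
theorem flagAlpha_sub_eq (hb : StrictMono b) {ℓ : Fin m → Fin (t + 1)}
    (hℓ : ∀ r, b (ℓ r) = beta α r) (j : Fin s) :
    (flagAlpha e α).sub j =
      ⨆ k, copy ((flagBeta e α b hb).space (lastEdgeIndex b k j.castSucc)) k := by
  rw [flagAlpha_sub]
  refine iSup_congr fun k => ?_
  rw [(isLevelFlag_flagBeta hb hℓ).space_eq]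
  simp only [lt_lastEdgeIndex_iff hb.monotone, hℓ]
  rfl

/-- A diagonal transformation fixes a direct sum of copies only if it fixes each summand, and every
member of `𝓕_β` is such a summand for some colour and some `j`. -/
theorem comap_parabolicAlpha_eq (hb : StrictMono b) {ℓ : Fin m → Fin (t + 1)}
    (hℓ : ∀ r, b (ℓ r) = beta α r) :
    (parabolicAlpha e α).comap (diagonalEmbedding W d) =
      MulAction.stabilizer (W ≃ₗ[ℂ] W) (flagBeta e α b hb) := by
  ext g
  have h1 : g ∈ (parabolicAlpha e α).comap (diagonalEmbedding W d) ↔ ∀ (j : Fin s) (k : Fin d),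
      ((flagBeta e α b hb).space (lastEdgeIndex b k j.castSucc)).map (g : W →ₗ[ℂ] W) =
        (flagBeta e α b hb).space (lastEdgeIndex b k j.castSucc) := by
    rw [Subgroup.mem_comap, parabolicAlpha, MulAction.mem_stabilizer_iff, FlagVariety.ext_iff,
      funext_iff]
    refine forall_congr' fun j => ?_
    rw [FlagVariety.smul_sub, flagAlpha_sub_eq hb hℓ, map_diagonalEmbedding_iSup_copy,
      ← funext_iff]
    exact iSup_copy_injective.eq_iff
  rw [h1, MulAction.mem_stabilizer_iff]
  constructor
  · intro h
    refine FlagVariety.ext (funext fun i => ?_)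
    obtain ⟨k, j, hkj⟩ := exists_lastEdgeIndex_eq hb i
    have h2 := h j k
    rwa [hkj, FlagVariety.space_succ] at h2
  · intro h j k
    rw [← FlagVariety.space_smul, h]

theorem finrank_directSum_eq [FiniteDimensional ℂ W] (e : Basis (Fin m) ℂ W) (hb : StrictMono b)
    {ℓ : Fin m → Fin (t + 1)} (hℓ : ∀ r, b (ℓ r) = beta α r)
    (F : FlagVariety W fun j => (betaSets α b j).card) (j : Fin s) :
    finrank ℂ (⨆ k, copy (F.space (lastEdgeIndex b k j.castSucc)) k :
      Submodule ℂ (Fin d → W)) = (alphaSets α j).card := by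
  obtain ⟨g, rfl⟩ := FlagVariety.exists_smul_eq (flagBeta e α b hb) F
  rw [iSup_congr fun k => congrArg (copy · k) (FlagVariety.space_smul g _ _),
    ← map_diagonalEmbedding_iSup_copy, LinearEquiv.finrank_map_eq, ← flagAlpha_sub_eq hb hℓ,
    FlagVariety.finrank_sub]

/-- If colour `k` arrives at `r_j`, the two indices agree; otherwise the summand of colour `k` is
inherited from the previous member. With `j` counted from `0`, `space j` is that previous member. -/
theorem directSum_sub_eq_sup (hb : StrictMono b) {p : Fin t → ℕ} {q : Fin s → ℕ}
    {φ : FlagVariety W p → FlagVariety (Fin d → W) q}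
    (hφ : ∀ F j, (φ F).sub j = ⨆ k, copy (F.space (lastEdgeIndex b k j.castSucc)) k)
    (F : FlagVariety W p) (j : Fin s) : (φ F).sub j =
      (φ F).space j ⊔ ⨆ k, copy (F.space (edgeIndex b k j.castSucc)) k := by
  refine le_antisymm ?_ (sup_le ?_ ?_)
  · rw [hφ]
    refine iSup_le fun k => ?_
    by_cases h : ∃ i, b i k = j.castSucc
    · rw [← edgeIndex_eq_lastEdgeIndex hb.monotone h]
      exact le_sup_of_le_right (le_iSup (fun k => copy (F.space (edgeIndex b k j.castSucc)) k) k)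
    · refine le_sup_of_le_left ?_
      obtain ⟨_ | j, hj⟩ := j
      · have h0 : lastEdgeIndex b k (Fin.castSucc ⟨0, hj⟩) = 0 :=
          lastEdgeIndex_zero_eq_zero hb.monotone h
        rw [h0, FlagVariety.space_zero, copy, Submodule.map_bot]
        exact bot_le
      · have h1 := (φ F).space_succ ⟨j, by omega⟩
        change _ ≤ (φ F).space (j + 1)
        rw [h1, hφ, lastEdgeIndex_eq_pred hb.monotone (j' := Fin.castSucc ⟨j, by omega⟩) rfl h]
        exact le_iSup (fun k => copy (F.space
          (lastEdgeIndex b k (Fin.castSucc (⟨j, by omega⟩ : Fin s)))) k) k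
  · rw [← FlagVariety.space_succ]
    exact FlagVariety.space_mono _ (Nat.le_succ _)
  · rw [hφ]
    exact iSup_mono fun k => Submodule.map_mono
      (F.space_mono (edgeIndex_le_lastEdgeIndex hb.monotone k _))

end FlagsAlphaBeta

end

/-! ### Proof of the theorem from the preceding parts. -/

theorem proposition5p4 {W : Type*} [AddCommGroup W] [Module ℂ W] [FiniteDimensional ℂ W]
    (d m s : ℕ) (hm : 0 < m) (hd : 1 < d) (e : Basis (Fin m) ℂ W)
    (α : Fin d × Fin m → Fin (s + 1)) (hα : Function.Surjective α)
    (hQ : IsParabolic ((parabolicAlpha e α).comap (diagonalEmbedding W d))) :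
    -- `b_1 < … < b_q`, with `q = t + 1`, is the image of `β` listed in increasing order
    ∃ (t : ℕ) (b : Fin (t + 1) → Fin d → Fin (s + 1)) (hb : StrictMono b),
      Set.range b = Set.range (beta α) ∧
      -- the identifications `g Q ↦ g 𝓕_β` of `GL(m)/Q` and `g P ↦ g 𝓕_α` of `GL(n)/P` with flag
      -- varieties, and the induced morphism `φ`
      ∃ (θY : (W ≃ₗ[ℂ] W) ⧸ (parabolicAlpha e α).comap (diagonalEmbedding W d) ≃
            FlagVariety W (fun j => (betaSets α b j).card))
        (θX : ((Fin d → W) ≃ₗ[ℂ] (Fin d → W)) ⧸ parabolicAlpha e α ≃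
            FlagVariety (Fin d → W) (fun j => (alphaSets α j).card))
        (φ : RegularMap (FlagVariety W (fun j => (betaSets α b j).card))
          (FlagVariety (Fin d → W) (fun j => (alphaSets α j).card))),
        (∀ g, θY (QuotientGroup.mk g) = g • flagBeta e α b hb) ∧
        (∀ g, θX (QuotientGroup.mk g) = g • flagAlpha e α) ∧
        (∀ y, φ.toFun (θY y) = θX (diagonalQuotientMap W d (parabolicAlpha e α) y)) ∧
        -- (a) the explicit formulas for `φ`
        (∀ (F : FlagVariety W (fun j => (betaSets α b j).card)) (j : Fin s),
          (φ.toFun F).sub j =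
            (φ.toFun F).space j ⊔ ⨆ k, copy (F.space (edgeIndex b k j.castSucc)) k) ∧
        (∀ (F : FlagVariety W (fun j => (betaSets α b j).card)) (j : Fin s),
          (φ.toFun F).sub j = ⨆ k, copy (F.space (lastEdgeIndex b k j.castSucc)) k) ∧
        -- (b) the pull-back on Picard groups
        (∀ j : Fin s, Pic.pullback φ (FlagVariety.picGen _ _ j) =
          ∑ k, FlagVariety.picGenExt _ _ (lastEdgeIndex b k j.castSucc)) ∧
        -- (c) linearity
        (IsLinearMorphism φ ↔
          ∀ (c : Fin d) (j j' : Fin (s + 1)), j < j' →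
            (∃ i, IsEdge b c i j) → (∃ i, IsEdge b c i j') →
            ∀ j'', j ≤ j'' → j'' < j' → ∀ c' i, IsOrdinaryEdge b c' i j'' → c' = c) ∧
        -- (d) standard extensions
        (IsStandardExtension φ.toFun ↔
          ∀ c c' i i' j j', IsOrdinaryEdge b c i j → IsOrdinaryEdge b c' i' j' → c = c') ∧
        (IsStandardExtension φ.toFun → IsStrictStandardExtension φ.toFun) := by
  have : Nonempty (Fin m) := ⟨⟨0, hm⟩⟩
  have : Nontrivial W := ⟨e ⟨0, hm⟩, 0, e.ne_zero _⟩
  obtain ⟨t, b, hb, hrange⟩ := exists_strictMono_range_eq (beta α) (isChain_range_beta e α hQ)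
  have hℓ : ∀ r, ∃ i, b i = beta α r := fun r => by
    rw [← Set.mem_range, hrange]
    exact ⟨r, rfl⟩
  choose ℓ hℓ using hℓ
  have hsurj : Function.Surjective ℓ := fun i => by
    obtain ⟨r, hr⟩ : b i ∈ Set.range (beta α) := hrange ▸ ⟨i, rfl⟩
    exact ⟨r, hb.injective ((hℓ r).trans hr)⟩
  have hF := isLevelFlag_flagBeta (e := e) hb hℓ
  have hproper : HasProperFlag W fun j => (betaSets α b j).card :=
    ⟨_, fun i => ⟨hF.sub_ne_bot hsurj i, hF.sub_ne_top hsurj i⟩⟩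
  have hN : ∀ k, Monotone fun j : Fin s => lastEdgeIndex b k j.castSucc := fun k i j h =>
    lastEdgeIndex_mono hb.monotone k (Fin.castSucc_le_castSucc_iff.2 h)
  have hq := finrank_directSum_eq e hb hℓ
  obtain ⟨θY, hθY⟩ := exists_quotientEquiv_of_stabilizer (flagBeta e α b hb) _
    (comap_parabolicAlpha_eq hb hℓ) (FlagVariety.exists_smul_eq _)
  obtain ⟨θX, hθX⟩ := exists_quotientEquiv_of_stabilizer (flagAlpha e α) (parabolicAlpha e α) rfl
    (FlagVariety.exists_smul_eq _)
  -- The morphism is defined by the second formula of (a); its agreement with the map on cosets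
  -- follows from equivariance and the computation of `𝓕_α` from `𝓕_β`.
  let φ := FlagVariety.directSumMap (fun k (j : Fin s) => lastEdgeIndex b k j.castSucc) hN hq
  have hφ : ∀ F j, (φ.toFun F).sub j =
      ⨆ k, copy (F.space (lastEdgeIndex b k j.castSucc)) k := fun _ _ => rfl
  -- No colour is active at the last right vertex, so the graph conditions over `Fin (s + 1)` reduce
  -- to the members of the flag, indexed by `Fin s`.
  have hactive : ∀ {k j}, IsActive b k j → ∃ j' : Fin s, j = j'.castSucc := fun h =>
    (Fin.eq_castSucc_or_eq_last _).resolve_right fun hl =>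
      (((isActive_iff hb.monotone).1 h).2.trans_le (Fin.le_last _)).ne hl
  have hstd : IsStandardExtension φ.toFun →
      ∀ c c' i i' j j', IsOrdinaryEdge b c i j → IsOrdinaryEdge b c' i' j' → c = c' := by
    rw [forall_isOrdinaryEdge_eq_iff hb.monotone]
    intro h c c' j j' hc hc'
    obtain ⟨j, rfl⟩ := hactive hc
    obtain ⟨j', rfl⟩ := hactive hc'
    exact active_unique_of_isStandardExtension hproper hN hφ h hc hc'
  have hstrict : (∀ c c' i i' j j', IsOrdinaryEdge b c i j → IsOrdinaryEdge b c' i' j' → c = c') →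
      IsStrictStandardExtension φ.toFun := by
    rw [forall_isOrdinaryEdge_eq_iff hb.monotone]
    intro h
    obtain ⟨c, hc⟩ : ∃ c : Fin d, ∀ k j, IsActive b k j → k = c := by
      by_cases hex : ∃ c j, IsActive b c j
      · obtain ⟨c, j, hc⟩ := hex
        exact ⟨c, fun k j' hk => h k c j' j hk hc⟩
      -- Without active colours `φ` is constant, and any colour can serve as the moving one.
      · exact ⟨⟨0, by omega⟩, fun k j hk => absurd ⟨k, j, hk⟩ hex⟩
    exact isStrictStandardExtension_of_active_unique hN (fun k j => lastEdgeIndex_le k _) hφ c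
      fun k j h1 h2 => hc k j.castSucc ⟨h1, h2⟩
  refine ⟨t, b, hb, hrange, θY, θX, φ, hθY, hθX, fun y => ?_, directSum_sub_eq_sup hb hφ, hφ,
    FlagVariety.pullback_picGen_eq _ hN hq, ?_, ⟨hstd, fun h => Or.inl (hstrict h)⟩,
    fun h => hstrict (hstd h)⟩
  · obtain ⟨g, rfl⟩ := QuotientGroup.mk_surjective y
    rw [hθY]
    change _ = θX (QuotientGroup.mk (diagonalEmbedding W d g))
    rw [hθX]
    refine FlagVariety.ext (funext fun j => ?_)
    rw [hφ, FlagVariety.smul_sub, flagAlpha_sub_eq hb hℓ, map_diagonalEmbedding_iSup_copy]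
    simp only [FlagVariety.space_smul]
  · rw [← forall_isActive_eq_iff hb.monotone, hF.isLinearMorphism_directSumMap_iff hsurj]
    refine ⟨fun h j c c' hc hc' => ?_, fun h j c c' hc hc' => h j.castSucc c c' hc hc'⟩
    obtain ⟨j, rfl⟩ := hactive hc
    exact h j c c' hc hc'
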